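/- **Theorem.** Let $\mathcal U,\mathcal V,\mathcal S,\mathcal X_1,\mathcal X_2$ be finite sets, let $p(u,v)$ be a probability mass function (pmf) on $\mathcal U\times\mathcal V$, let $\mathcal H_B$ be a finite-dimensional Hilbert space of dimension $d_B$, and let $(x_1,x_2)\mapsto\rho_{x_1,x_2}$ be a classical-quantum multiple access channel, i.e. a family of density operators on $\mathcal H_B$ indexed by $\mathcal X_1\times\mathcal X_2$. Let $W=f(U)=g(V)$ be the common part of $(U,V)\sim p$: $k$ is the largest integer for which there are functions $f:\mathcal U\to\{1,\dots,k\}$ and $g:\mathcal V\to\{1,\dots,k\}$ with $\Pr\{f(U)=g(V)\}=1$, $\Pr\{f(U)=w\}>0$ and $\Pr\{g(V)=w\}>0$ for every $w$, and $f,g$ are such functions. Put $p(u,v,w)=p(u,v)\,\delta_{f(u),w}\,\delta_{g(v),w}$. Suppose that there are pmfs $p(s)$ on $\mathcal S$, $p(x_1|u,s)$ on $\mathcal X_1$ and $p(x_2|v,s)$ on $\mathcal X_2$ such that $$H(U|V) < I(X_1;B|X_2VS),\quad H(V|U) < I(X_2;B|X_1US),\quad H(UV|W) < I(X_1X_2;B|WS),\quad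 H(UV) < I(X_1X_2;B),$$ where any of the four inequalities is waived if its left-hand side is $0$. All quantities are computed, with one fixed base of the logarithm, for the classical-quantum state $$\sum_{u,v,w,s,x_1,x_2}p(u,v,w)\,p(s)\,p(x_1|u,s)\,p(x_2|v,s)\,|u,v,w,s,x_1,x_2\rangle\langle u,v,w,s,x_1,x_2|\otimes\rho_{x_1,x_2}.$$ (i) Then the i.i.d. source $(U^n,V^n)\sim\prod_{i=1}^n p(u_i,v_i)$ can be sent reliably over the channel: there are encoders $x_1^n:\mathcal U^n\to\mathcal X_1^n$, $x_2^n:\mathcal V^n\to\mathcal X_2^n$ and POVMs $\{\Lambda_{u^n,v^n}\}_{(u^n,v^n)\in\mathcal U^n\times\mathcal V^n}$ on $\mathcal H_B^{\otimes n}$, for all $n$, such that $$P_e^{(n)}=\sum_{u^n,v^n}p(u^n,v^n)\,\mathrm{Tr}\Big\{(I-\Lambda_{u^n,v^n})\,\bigotimes_{i=1}^n\rho_{x_{1i}(u^n),x_{2i}(v^n)}\Big\}\longrightarrow 0\qquad(n\to\infty).$$ (ii) The alphabet of the auxiliary variable $S$ can be bounded: there are a finite set $\mathcal S'$ with $$|\mathcal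 S'|\le\min\{|\mathcal X_1|\cdot|\mathcal X_2|+2,\ d_B^2+3\}$$ and pmfs $p(s)$, $p(x_1|u,s)$, $p(x_2|v,s)$ with $s\in\mathcal S'$ that satisfy the same conditions. -/

import Mathlib

open Filter Topology
open scoped ComplexOrder

noncomputable section

/-! ### Density operators, entropies, information quantities of classical-quantum states

A finite-dimensional Hilbert space with a fixed orthonormal basis indexed by `B` is represented by
the matrices over `B`. All entropies are in nats. -/

/-- A density operator: positive semidefinite with trace one. -/
def IsDensityMatrix {B : Type*} [Fintype B] (A : Matrix B B ℂ) : Prop :=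
  A.PosSemidef ∧ A.trace = 1

/-- The von Neumann entropy `-Tr (A log A)`, through the functional calculus of Hermitian
matrices applied to `x ↦ -x log x` (with value `0` at `x = 0`). -/
def vnEntropy {B : Type*} [Fintype B] [DecidableEq B] (A : Matrix B B ℂ) : ℝ :=
  (cfc Real.negMulLog A).trace.re

section Entropies

variable {Ω B C D : Type*} [Fintype Ω] [Fintype B] [DecidableEq B]
  [Fintype C] [DecidableEq C] [Fintype D] [DecidableEq D]

/-- The distribution of the label `c` when `ω` is distributed according to `P`. -/
def marginal (P : Ω → ℝ) (c : Ω → C) (a : C) : ℝ :=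
  ∑ ω, if c ω = a then P ω else 0

/-- Shannon entropy `H(c)` of the label `c`. -/
def entropy (P : Ω → ℝ) (c : Ω → C) : ℝ :=
  ∑ a, Real.negMulLog (marginal P c a)

/-- Conditional Shannon entropy `H(c | d) = H(c, d) - H(d)`. -/
def condEntropy (P : Ω → ℝ) (c : Ω → C) (d : Ω → D) : ℝ :=
  entropy P (fun ω => (c ω, d ω)) - entropy P d

/-- The reduced state on the classical register holding the label `c` and on `B`, of the
classical-quantum state `∑ ω, P ω |ω⟩⟨ω| ⊗ σ ω`. It is
`∑ a, |a⟩⟨a| ⊗ (∑ over ω with c ω = a, P ω σ ω)`, a block diagonal matrix. For `c = id` it is the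
whole state. -/
def cqReduced (P : Ω → ℝ) (σ : Ω → Matrix B B ℂ) (c : Ω → C) : Matrix (B × C) (B × C) ℂ :=
  Matrix.blockDiagonal fun a => ∑ ω, if c ω = a then (P ω : ℂ) • σ ω else 0

/-- The reduced state on `B`. -/
def cqAverage (P : Ω → ℝ) (σ : Ω → Matrix B B ℂ) : Matrix B B ℂ :=
  ∑ ω, (P ω : ℂ) • σ ω

/-- Quantum mutual information `I(c; B) = H(c) + H(B) - H(c B)`. -/
def cqMutualInfo (P : Ω → ℝ) (σ : Ω → Matrix B B ℂ) (c : Ω → C) : ℝ :=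
  entropy P c + vnEntropy (cqAverage P σ) - vnEntropy (cqReduced P σ c)

/-- Conditional quantum mutual information `I(c; B | d) = H(c d) + H(B d) - H(d) - H(c d B)`. -/
def cqCondMutualInfo (P : Ω → ℝ) (σ : Ω → Matrix B B ℂ) (c : Ω → C) (d : Ω → D) : ℝ :=
  entropy P (fun ω => (c ω, d ω)) + vnEntropy (cqReduced P σ d) - entropy P d
    - vnEntropy (cqReduced P σ fun ω => (c ω, d ω))

end Entropies

/-! ### The source and its common part -/

/-- `f(U) = g(V)` almost surely, with values in `{1, …, k}`, every value having positive
probability under both `f(U)` and `g(V)`. -/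
structure IsCommonFunction {U V : Type*} [Fintype U] [Fintype V] (p : U × V → ℝ) (k : ℕ)
    (f : U → Fin k) (g : V → Fin k) : Prop where
  agree : ∀ u v, p (u, v) ≠ 0 → f u = g v
  left_pos : ∀ w, 0 < ∑ u, ∑ v, if f u = w then p (u, v) else 0
  right_pos : ∀ w, 0 < ∑ u, ∑ v, if g v = w then p (u, v) else 0

/-- `W = f(U) = g(V)` is the common part of `(U, V)`: the number `k` of its values is the largest
possible. -/
structure IsCommonPart {U V : Type*} [Fintype U] [Fintype V] (p : U × V → ℝ) (k : ℕ)
    (f : U → Fin k) (g : V → Fin k) : Prop extends IsCommonFunction p k f g where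
  maximal : ∀ (k' : ℕ) (f' : U → Fin k') (g' : V → Fin k'),
    IsCommonFunction p k' f' g' → k' ≤ k

/-! ### Transmission of the source -/

/-- The output `ρ_{x₁₁,x₂₁} ⊗ ⋯ ⊗ ρ_{x₁ₙ,x₂ₙ}` of `n` uses of the channel, in the product basis. -/
def channelOutput {X₁ X₂ B : Type*} (ρ : X₁ → X₂ → Matrix B B ℂ) {n : ℕ}
    (x₁ : Fin n → X₁) (x₂ : Fin n → X₂) : Matrix (Fin n → B) (Fin n → B) ℂ :=
  Matrix.of fun b b' => ∏ i, ρ (x₁ i) (x₂ i) (b i) (b' i)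

/-- A positive operator-valued measure with outcomes in `J`. -/
def IsPOVM {J D : Type*} [Fintype J] [Fintype D] [DecidableEq D]
    (Λ : J → Matrix D D ℂ) : Prop :=
  (∀ j, (Λ j).PosSemidef) ∧ ∑ j, Λ j = 1

/-- The probability that the i.i.d. source output `(uⁿ, vⁿ)` is decoded incorrectly. -/
def errorProb {U V X₁ X₂ B : Type*} [Fintype U] [Fintype V] [Fintype B] [DecidableEq B]
    (p : U × V → ℝ) (ρ : X₁ → X₂ → Matrix B B ℂ) {n : ℕ}
    (e₁ : (Fin n → U) → (Fin n → X₁)) (e₂ : (Fin n → V) → (Fin n → X₂))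
    (Λ : (Fin n → U) × (Fin n → V) → Matrix (Fin n → B) (Fin n → B) ℂ) : ℝ :=
  ∑ uv : (Fin n → U) × (Fin n → V), (∏ i, p (uv.1 i, uv.2 i)) *
    ((1 - Λ uv) * channelOutput ρ (e₁ uv.1) (e₂ uv.2)).trace.re

/-- The source can be transmitted reliably: there is a sequence of block codes
`(x₁ⁿ(uⁿ), x₂ⁿ(vⁿ))` and decoding measurements whose error probability tends to zero. -/
def ReliablyTransmissible {U V X₁ X₂ B : Type*} [Fintype U] [Fintype V]
    [DecidableEq U] [DecidableEq V] [Fintype B] [DecidableEq B]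
    (p : U × V → ℝ) (ρ : X₁ → X₂ → Matrix B B ℂ) : Prop :=
  ∃ (e₁ : ∀ n : ℕ, (Fin n → U) → (Fin n → X₁)) (e₂ : ∀ n : ℕ, (Fin n → V) → (Fin n → X₂))
    (Λ : ∀ n : ℕ, (Fin n → U) × (Fin n → V) → Matrix (Fin n → B) (Fin n → B) ℂ),
    (∀ n, IsPOVM (Λ n)) ∧
    Tendsto (fun n => errorProb p ρ (e₁ n) (e₂ n) (Λ n)) atTop (𝓝 0)

/-! ### The information inequalities -/

section Conditions

variable {U V S X₁ X₂ B : Type*} {k : ℕ}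

/-- The distribution `p(u,v,w) p(s) p(x₁|u,s) p(x₂|v,s)` of `(u, v, w, s, x₁, x₂)`, where
`p(u,v,w) = p(u,v) δ_{f(u),w} δ_{g(v),w}`. -/
def codeDist (p : U × V → ℝ) (f : U → Fin k) (g : V → Fin k) (pS : S → ℝ)
    (q₁ : U → S → X₁ → ℝ) (q₂ : V → S → X₂ → ℝ) : U × V × Fin k × S × X₁ × X₂ → ℝ :=
  fun (u, v, w, s, x₁, x₂) =>
    p (u, v) * (if f u = w then 1 else 0) * (if g v = w then 1 else 0) *
      pS s * q₁ u s x₁ * q₂ v s x₂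

/-- The state of the channel output given the classical labels. -/
def codeState (ρ : X₁ → X₂ → Matrix B B ℂ) : U × V × Fin k × S × X₁ × X₂ → Matrix B B ℂ :=
  fun (_, _, _, _, x₁, x₂) => ρ x₁ x₂

/-- An entropy `h` of the source is covered by the information quantity `i`: it is strictly
smaller, unless it vanishes. -/
def Covered (h i : ℝ) : Prop := h < i ∨ h = 0

/-- `p(s)`, `p(x₁|u,s)`, `p(x₂|v,s)` are probability mass functions and the four information
inequalities hold. -/
structure InfoConditions [Fintype U] [DecidableEq U] [Fintype V] [DecidableEq V]
    [Fintype S] [DecidableEq S] [Fintype X₁] [DecidableEq X₁] [Fintype X₂] [DecidableEq X₂]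
    [Fintype B] [DecidableEq B]
    (p : U × V → ℝ) (f : U → Fin k) (g : V → Fin k) (ρ : X₁ → X₂ → Matrix B B ℂ)
    (pS : S → ℝ) (q₁ : U → S → X₁ → ℝ) (q₂ : V → S → X₂ → ℝ) : Prop where
  pmf_s : pS ∈ stdSimplex ℝ S
  pmf_x₁ : ∀ u s, q₁ u s ∈ stdSimplex ℝ X₁
  pmf_x₂ : ∀ v s, q₂ v s ∈ stdSimplex ℝ X₂
  /-- `H(U|V)` against `I(X₁;B|X₂VS)` -/
  ineq₁ : Covered
    (condEntropy (codeDist p f g pS q₁ q₂) (fun (u, _, _, _, _, _) => u)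
      (fun (_, v, _, _, _, _) => v))
    (cqCondMutualInfo (codeDist p f g pS q₁ q₂) (codeState ρ) (fun (_, _, _, _, x₁, _) => x₁)
      (fun (_, v, _, s, _, x₂) => (x₂, v, s)))
  /-- `H(V|U)` against `I(X₂;B|X₁US)` -/
  ineq₂ : Covered
    (condEntropy (codeDist p f g pS q₁ q₂) (fun (_, v, _, _, _, _) => v)
      (fun (u, _, _, _, _, _) => u))
    (cqCondMutualInfo (codeDist p f g pS q₁ q₂) (codeState ρ) (fun (_, _, _, _, _, x₂) => x₂)
      (fun (u, _, _, s, x₁, _) => (x₁, u, s)))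
  /-- `H(UV|W)` against `I(X₁X₂;B|WS)` -/
  ineq₃ : Covered
    (condEntropy (codeDist p f g pS q₁ q₂) (fun (u, v, _, _, _, _) => (u, v))
      (fun (_, _, w, _, _, _) => w))
    (cqCondMutualInfo (codeDist p f g pS q₁ q₂) (codeState ρ)
      (fun (_, _, _, _, x₁, x₂) => (x₁, x₂)) (fun (_, _, w, s, _, _) => (w, s)))
  /-- `H(UV)` against `I(X₁X₂;B)` -/
  ineq₄ : Covered
    (entropy (codeDist p f g pS q₁ q₂) (fun (u, v, _, _, _, _) => (u, v)))
    (cqMutualInfo (codeDist p f g pS q₁ q₂) (codeState ρ)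
      (fun (_, _, _, _, x₁, x₂) => (x₁, x₂)))

end Conditions

end

/-!
Part (i) is proved by random coding. For every value of the common part `w` draw one sequence
`s(w)` of the auxiliary variable, and for all `(u, s)` and `(v, s)` codewords `x₁(u, s)`,
`x₂(v, s)`, independently; since `f(u) = g(v)`, both encoders know the same `s(w)`. The argument is
carried out once and for all for a single use of an abstract channel (`CodeSetup`), which is then
instantiated with blocks of length `n` (`blockSetup`).

The decoder is the square-root measurement (`exists_povm`) of the effects
`P₄ P₃ P₂ P P₂ P₃ P₄` (`chainEffect`), where `P` projects on the typical subspace of the output of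
the codeword pair and `P₂`, `P₃`, `P₄` on those of the mean outputs given `(x₁, u, s)`, given
`(w, s)` and given nothing. By the Hayashi–Nagaoka inequality the error is controlled by the weight
that the typical subspaces miss, and by the probabilities of confusing `(u, v)` with another pair
`(u', v')`. There are four types of confusion. If `u' = u`, averaging over the codeword of `v'`
turns `P ≤ κ ρ` into the mean output given `(x₁, u, s)`, and `P₂` bounds the latter. If `u'` and
`v'` are both wrong, the mean outputs given `(w, s)` or given nothing appear, according as `w'` is
correct or not, and `P₃`, `P₄` apply. If `v' = v`, none of these projections helps; instead the
*state* is compressed by the typical projection `Q` of the mean output given `(x₂, v, s)`, which is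
averaged over `u`, so that the trace of the effect (at most `κ`) and the operator norm of the
averaged state remain. Compressing the error operator by `Q` costs only constant
factors, by the pinching inequality (`error_operator_le`), so no two noncommuting typical
projections ever have to be compared.

The number of competing pairs is bounded through the conditional probabilities of likely source
sequences, `t ≤ N p(v | u)` and the like, so that correlations of the source are used in full. If
the left-hand side of an inequality vanishes, the corresponding type of confusion does not occur on
the support of the source (`eq_of_sourceEntropy_eq_zero`). All typical projections are spectral
projections of tensor products, cut off on one side only, and the missed weight tends to zero by
the Chernoff bound for the product of the classical distribution and the eigenvalue distribution
(`IsLabelAverage.tendsto_low`, `IsLabelAverage.tendsto_high`).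

Part (ii) is a Carathéodory argument. For fixed `p(x₁|u,s)` and `p(x₂|v,s)`, the four information
quantities depend on `p(s)` only through the means of functions of `s` (`infoConditions_iff`), with
the exception of the entropy of the mean output. Moving `p(s)` along linear relations until its
support is at most the dimension of the preserved means never has to decrease `H(B|WS)`
(`exists_weight_card_support_le`), which enters with a favourable sign and therefore costs no
dimension. Preserving the distribution of `(x₁, x₂)`, `H(B|X₂VS)` and `H(B|X₁US)` gives
`|X₁||X₂| + 2`; preserving the mean output, `H(B|X₁X₂)`, `H(B|X₂VS)` and `H(B|X₁US)` gives
`d² + 3`.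
-/

set_option linter.unusedSectionVars false

namespace CqMac

noncomputable section

open Matrix
open scoped MatrixOrder

/-! ### Operator inequalities for the decoder -/

section Operators

variable {n : Type*} [Fintype n] [DecidableEq n]

lemma compl_nonneg {Q : Matrix n n ℂ} (hQ : IsStarProjection Q) : 0 ≤ 1 - Q :=
  hQ.one_sub.nonneg

lemma conj_nonneg {K Q : Matrix n n ℂ} (hQ : IsSelfAdjoint Q) (hK : 0 ≤ K) : 0 ≤ Q * K * Q := by
  simpa using hQ.conjugate_le_conjugate hK

/-- An operator is dominated by twice its pinching: `2QKQ + 2(1-Q)K(1-Q) - K` is the conjugate of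
`K` by the reflection `2Q - 1`. -/
lemma le_two_smul_pinching {K Q : Matrix n n ℂ} (hQ : IsStarProjection Q) (hK : 0 ≤ K) :
    K ≤ (2 : ℝ) • (Q * K * Q) + (2 : ℝ) • ((1 - Q) * K * (1 - Q)) := by
  have h : IsSelfAdjoint (Q - (1 - Q)) := hQ.isSelfAdjoint.sub hQ.one_sub.isSelfAdjoint
  have h' := conj_nonneg h hK
  rw [← sub_nonneg]
  convert h' using 1
  simp only [two_smul]
  noncomm_ring

lemma conj_compl_le {K Q : Matrix n n ℂ} (hQ : IsStarProjection Q) (hK : K ≤ 1) :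
    (1 - Q) * K * (1 - Q) ≤ 1 - Q := by
  have := hQ.one_sub.isSelfAdjoint.conjugate_le_conjugate hK
  rwa [mul_one, hQ.one_sub.isIdempotentElem.eq] at this

lemma le_two_smul_conj_add {K Q : Matrix n n ℂ} (hQ : IsStarProjection Q) (hK : 0 ≤ K)
    (hK1 : K ≤ 1) : K ≤ (2 : ℝ) • (Q * K * Q) + (2 : ℝ) • (1 - Q) := by
  refine (le_two_smul_pinching hQ hK).trans ?_
  gcongr
  exact conj_compl_le hQ hK1

lemma conj_le_two_smul_add {K Q : Matrix n n ℂ} (hQ : IsStarProjection Q) (hK : 0 ≤ K)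
    (hK1 : K ≤ 1) : Q * K * Q ≤ (2 : ℝ) • K + (2 : ℝ) • (1 - Q) := by
  have h := conj_nonneg (Q := 1 + (1 - Q)) ((IsSelfAdjoint.one _).add hQ.one_sub.isSelfAdjoint) hK
  have h' : Q * K * Q ≤ (2 : ℝ) • K + (2 : ℝ) • ((1 - Q) * K * (1 - Q)) := by
    rw [← sub_nonneg]
    convert h using 1
    simp only [two_smul]
    noncomm_ring
  refine h'.trans ?_
  gcongr
  exact conj_compl_le hQ hK1

/-- Gentle measurement in operator form: compressing an effect by `P` adds little to its complement. -/
lemma one_sub_conj_le {K P : Matrix n n ℂ} (hP : IsStarProjection P) (hK : 0 ≤ K) (hK1 : K ≤ 1) :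
    1 - P * K * P ≤ (3 : ℝ) • (1 - P) + (2 : ℝ) • (1 - K) := by
  have h := conj_le_two_smul_add hP (K := 1 - K) (sub_nonneg.2 hK1) (by simpa using hK)
  have e : 1 - P * K * P = (1 - P) + P * (1 - K) * P := by
    have := hP.isIdempotentElem.eq
    noncomm_ring [this]
  rw [e]
  refine (add_le_add_right h _).trans (le_of_eq ?_)
  module

lemma conj_le_one {K P : Matrix n n ℂ} (hP : IsStarProjection P) (hK1 : K ≤ 1) :
    P * K * P ≤ 1 := by
  have := hP.isSelfAdjoint.conjugate_le_conjugate hK1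
  rw [mul_one, hP.isIdempotentElem.eq] at this
  exact this.trans hP.le_one

open scoped Matrix.Norms.L2Operator in
/-- The Hayashi–Nagaoka inequality. With `R = (S + T)^{-1/2}`, write
`√T R = √T (R - 1) + √T`, and use `(S + T)^{1/2} ≥ S`. -/
lemma hayashi_nagaoka {S T R : Matrix n n ℂ} (hS : 0 ≤ S) (hS1 : S ≤ 1) (hT : 0 ≤ T)
    (hR : R = (CFC.sqrt (S + T))⁻¹) (hdet : IsUnit (S + T)) :
    IsSelfAdjoint R ∧ R * (S + T) * R = 1 ∧
      1 - R * S * R ≤ (2 : ℝ) • (1 - S) + (4 : ℝ) • T := by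
  have hST : 0 ≤ S + T := add_nonneg hS hT
  set q := CFC.sqrt (S + T) with hq
  have hqq : q * q = S + T := CFC.sqrt_mul_sqrt_self _ hST
  have hq0 : 0 ≤ q := CFC.sqrt_nonneg _
  have hqu : IsUnit q.det := by
    have : IsUnit (q.det * q.det) := by
      rw [← det_mul, hqq]; exact (isUnit_iff_isUnit_det _).1 hdet
    exact isUnit_of_mul_isUnit_left this
  have hRq : R * q = 1 := by rw [hR]; exact nonsing_inv_mul _ hqu
  have hqR : q * R = 1 := by rw [hR]; exact mul_nonsing_inv _ hqu
  have hqsa : IsSelfAdjoint q := IsSelfAdjoint.of_nonneg hq0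
  have hRsa : IsSelfAdjoint R := by
    have : star R * q = 1 := by
      have := congrArg star hqR
      rwa [star_mul, hqsa.star_eq, star_one] at this
    calc star R = star R * (q * R) := by rw [hqR, mul_one]
      _ = R := by rw [← mul_assoc, this, one_mul]
  have hRR : R * (S + T) * R = 1 := by
    rw [← hqq, ← mul_assoc, hRq, one_mul, hqR]
  refine ⟨hRsa, hRR, ?_⟩
  -- `S ≤ √S ≤ √(S + T)`
  have hSq : S ≤ q := by
    have h1 : S ^ 2 ≤ S + T := by
      have h2 : S ^ 2 ≤ S := by
        have h3 := (IsSelfAdjoint.of_nonneg (CFC.sqrt_nonneg S)).conjugate_le_conjugate hS1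
        have h4 := CFC.sqrt_mul_sqrt_self S hS
        have h5 : CFC.sqrt S * S * CFC.sqrt S = S ^ 2 := by
          calc CFC.sqrt S * S * CFC.sqrt S
              = CFC.sqrt S * (CFC.sqrt S * CFC.sqrt S) * CFC.sqrt S := by rw [h4]
            _ = (CFC.sqrt S * CFC.sqrt S) * (CFC.sqrt S * CFC.sqrt S) := by noncomm_ring
            _ = S ^ 2 := by rw [h4, pow_two]
        rwa [h5, mul_one, h4] at h3
      exact h2.trans (le_add_of_nonneg_right hT)
    have := CFC.sqrt_le_sqrt _ _ h1
    rwa [CFC.sqrt_sq S hS] at this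
  have e1 : 1 - R * S * R = R * T * R := by
    rw [← hRR]; noncomm_ring
  rw [e1]
  have hR1 : IsSelfAdjoint (R - 1) := hRsa.sub (IsSelfAdjoint.one _)
  have h1 : R * T * R ≤ (2 : ℝ) • ((R - 1) * T * (R - 1)) + (2 : ℝ) • T := by
    have := conj_nonneg (hR1.sub (IsSelfAdjoint.one _)) hT
    rw [← sub_nonneg]
    convert this using 1
    simp only [two_smul]
    noncomm_ring
  have h2 : (R - 1) * T * (R - 1) ≤ (R - 1) * (S + T) * (R - 1) :=
    hR1.conjugate_le_conjugate (le_add_of_nonneg_left hS)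
  have h3 : (R - 1) * (S + T) * (R - 1) = 1 + (S + T) - (2 : ℝ) • q := by
    rw [← hqq]
    have : (R - 1) * (q * q) * (R - 1) = (R * q - q) * (q * R - q) := by noncomm_ring
    rw [this, hRq, hqR, two_smul]
    noncomm_ring
  rw [h3] at h2
  calc R * T * R ≤ (2 : ℝ) • (1 + (S + T) - (2 : ℝ) • q) + (2 : ℝ) • T :=
        h1.trans (by gcongr)
    _ ≤ (2 : ℝ) • (1 + (S + T) - (2 : ℝ) • S) + (2 : ℝ) • T := by gcongr
    _ = _ := by module

end Operators

/-! ### The square-root measurement -/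

section Measurement

variable {n : Type*} [Fintype n] [DecidableEq n]

/-- The real bilinear form `(X, A) ↦ Re Tr (X A)`. For an effect `X` and a state `A` it is the
probability of `X` in the state `A`. -/
def trRe : Matrix n n ℂ →ₗ[ℝ] Matrix n n ℂ →ₗ[ℝ] ℝ :=
  LinearMap.mk₂ ℝ (fun X A => (X * A).trace.re)
    (fun X Y A => by simp [add_mul]) (fun c X A => by simp)
    (fun X A B => by simp [mul_add]) (fun c X A => by simp)

lemma trRe_apply (X A : Matrix n n ℂ) : trRe X A = (X * A).trace.re := rfl

lemma trRe_comm (X A : Matrix n n ℂ) : trRe X A = trRe A X := by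
  rw [trRe_apply, trRe_apply, trace_mul_comm]

lemma trRe_conj (X A Q : Matrix n n ℂ) : trRe (Q * X * Q) A = trRe X (Q * A * Q) := by
  rw [trRe_apply, trRe_apply]
  have : Q * X * Q * A = Q * (X * Q * A) := by noncomm_ring
  rw [this, trace_mul_comm]
  congr 2; noncomm_ring

lemma trRe_one_left (A : Matrix n n ℂ) : trRe 1 A = A.trace.re := by simp [trRe_apply]

lemma trRe_nonneg {X A : Matrix n n ℂ} (hX : 0 ≤ X) (hA : 0 ≤ A) : 0 ≤ trRe X A := by
  have hr := CFC.sqrt_mul_sqrt_self A hA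
  have h := (conj_nonneg (IsSelfAdjoint.of_nonneg (CFC.sqrt_nonneg A)) hX)
  have h2 := (nonneg_iff_posSemidef.1 h).trace_nonneg
  have e : (X * A).trace = (CFC.sqrt A * X * CFC.sqrt A).trace := by
    conv_lhs => rw [← hr]
    rw [← mul_assoc, trace_mul_comm, ← mul_assoc]
  rw [trRe_apply, e]
  exact (Complex.nonneg_iff.1 h2).1

lemma trRe_mono_left {X Y A : Matrix n n ℂ} (h : X ≤ Y) (hA : 0 ≤ A) : trRe X A ≤ trRe Y A := by
  have := trRe_nonneg (sub_nonneg.2 h) hA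
  rw [map_sub, LinearMap.sub_apply] at this
  linarith

lemma trRe_mono_right {X A B : Matrix n n ℂ} (h : A ≤ B) (hX : 0 ≤ X) : trRe X A ≤ trRe X B := by
  rw [trRe_comm X A, trRe_comm X B]; exact trRe_mono_left h hX

lemma sum_le_one_of_normalized {J : Type*} [Fintype J] {R N : Matrix n n ℂ}
    {Γ : J → Matrix n n ℂ} {ε : ℝ} (hε : 0 ≤ ε) (hR : IsSelfAdjoint R)
    (hN : N = ε • (1 : Matrix n n ℂ) + ∑ j, Γ j) (hRR : R * N * R = 1) :
    ∑ j, R * Γ j * R ≤ 1 := by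
  have e : ∑ j, R * Γ j * R = R * (∑ j, Γ j) * R := by
    rw [Finset.mul_sum, Finset.sum_mul]
  rw [e]
  refine le_of_le_of_eq (hR.conjugate_le_conjugate ?_) hRR
  rw [hN]
  exact le_add_of_nonneg_left (smul_nonneg hε zero_le_one)

/-- The square-root measurement built from effects `Γ j`. The summand `ε` makes the sum of the
effects invertible; the outcome `j₀` absorbs what is missing for the resolution of the identity. -/
lemma exists_povm {J : Type*} [Fintype J] [DecidableEq J] (j₀ : J) (Γ : J → Matrix n n ℂ)
    (h0 : ∀ j, 0 ≤ Γ j) (h1 : ∀ j, Γ j ≤ 1) {ε : ℝ} (hε : 0 < ε) :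
    ∃ Λ : J → Matrix n n ℂ, IsPOVM Λ ∧ ∀ j, 0 ≤ 1 - Λ j ∧ 1 - Λ j ≤ (2 : ℝ) • (1 - Γ j) +
      (4 : ℝ) • (ε • (1 : Matrix n n ℂ) + ∑ i ∈ Finset.univ.erase j, Γ i) := by
  set N : Matrix n n ℂ := ε • (1 : Matrix n n ℂ) + ∑ j, Γ j with hN
  have hΓ : 0 ≤ ∑ j, Γ j := Finset.sum_nonneg fun j _ => h0 j
  have hNpos : N.PosDef := by
    have : (ε • (1 : Matrix n n ℂ)).PosDef := PosDef.one.smul hε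
    exact this.add_posSemidef (nonneg_iff_posSemidef.1 hΓ)
  set R := (CFC.sqrt N)⁻¹ with hR
  have hsplit : ∀ j, Γ j + (ε • (1 : Matrix n n ℂ) + ∑ i ∈ Finset.univ.erase j, Γ i) = N := by
    intro j
    rw [hN, ← Finset.add_sum_erase _ _ (Finset.mem_univ j)]
    abel
  have key : ∀ j, IsSelfAdjoint R ∧ R * N * R = 1 ∧ 1 - R * Γ j * R ≤ (2 : ℝ) • (1 - Γ j) +
      (4 : ℝ) • (ε • (1 : Matrix n n ℂ) + ∑ i ∈ Finset.univ.erase j, Γ i) := by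
    intro j
    have hT : 0 ≤ ε • (1 : Matrix n n ℂ) + ∑ i ∈ Finset.univ.erase j, Γ i :=
      add_nonneg (smul_nonneg hε.le zero_le_one) (Finset.sum_nonneg fun i _ => h0 i)
    have := hayashi_nagaoka (R := R) (h0 j) (h1 j) hT (by rw [hsplit]) (by
      rw [hsplit]; exact hNpos.isUnit)
    rwa [hsplit] at this
  have hRsa := (key j₀).1
  have hsum := sum_le_one_of_normalized hε.le hRsa hN (key j₀).2.1
  have hpos : ∀ j, 0 ≤ R * Γ j * R := fun j => conj_nonneg hRsa (h0 j)
  set D := 1 - ∑ j, R * Γ j * R with hD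
  have hD0 : 0 ≤ D := sub_nonneg.2 hsum
  have hpos' : ∀ j, 0 ≤ R * Γ j * R + if j = j₀ then D else 0 := by
    intro j
    refine add_nonneg (hpos j) ?_
    split_ifs <;> simp [hD0]
  have htot : ∑ j, (R * Γ j * R + if j = j₀ then D else 0) = 1 := by
    rw [Finset.sum_add_distrib]; simp [hD]
  refine ⟨fun j => R * Γ j * R + if j = j₀ then D else 0, ⟨fun j => ?_, htot⟩, fun j => ⟨?_, ?_⟩⟩
  · exact nonneg_iff_posSemidef.1 (hpos' j)
  · rw [sub_nonneg]
    refine le_of_le_of_eq ?_ htot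
    exact Finset.single_le_sum (f := fun j => R * Γ j * R + if j = j₀ then D else 0)
      (fun i _ => hpos' i) (Finset.mem_univ j)
  · refine le_trans ?_ (key j).2.2
    apply sub_le_sub_left
    refine le_add_of_nonneg_right ?_
    split_ifs <;> simp [hD0]

/-- The decoding effect for one message pair: the projection `P` of the channel output, sandwiched
between the projections of coarser and coarser averages of it. -/
def chainEffect (P₄ P₃ P₂ P : Matrix n n ℂ) : Matrix n n ℂ :=
  P₄ * (P₃ * (P₂ * P * P₂) * P₃) * P₄

variable {P₄ P₃ P₂ P Q : Matrix n n ℂ}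

lemma chainEffect_nonneg (h₄ : IsStarProjection P₄) (h₃ : IsStarProjection P₃)
    (h₂ : IsStarProjection P₂) (h : IsStarProjection P) : 0 ≤ chainEffect P₄ P₃ P₂ P :=
  conj_nonneg h₄.isSelfAdjoint <| conj_nonneg h₃.isSelfAdjoint <| conj_nonneg h₂.isSelfAdjoint
    h.nonneg

lemma chainEffect_le_one (h₄ : IsStarProjection P₄) (h₃ : IsStarProjection P₃)
    (h₂ : IsStarProjection P₂) (h : IsStarProjection P) : chainEffect P₄ P₃ P₂ P ≤ 1 :=
  conj_le_one h₄ <| conj_le_one h₃ <| conj_le_one h₂ h.le_one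

lemma one_sub_chainEffect_le (h₄ : IsStarProjection P₄) (h₃ : IsStarProjection P₃)
    (h₂ : IsStarProjection P₂) (h : IsStarProjection P) :
    1 - chainEffect P₄ P₃ P₂ P ≤
      (3 : ℝ) • (1 - P₄) + (6 : ℝ) • (1 - P₃) + (12 : ℝ) • (1 - P₂) + (8 : ℝ) • (1 - P) := by
  have a2 := conj_nonneg h₂.isSelfAdjoint h.nonneg
  have b2 := conj_le_one h₂ h.le_one
  have a3 := conj_nonneg h₃.isSelfAdjoint a2
  have b3 := conj_le_one h₃ b2
  have k4 := one_sub_conj_le h₄ a3 b3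
  have k3 := one_sub_conj_le h₃ a2 b2
  have k2 := one_sub_conj_le h₂ h.nonneg h.le_one
  calc _ ≤ (3 : ℝ) • (1 - P₄) + (2 : ℝ) • ((3 : ℝ) • (1 - P₃) + (2 : ℝ) •
        ((3 : ℝ) • (1 - P₂) + (2 : ℝ) • (1 - P))) := by
        refine k4.trans ?_
        gcongr
        refine k3.trans ?_
        gcongr
    _ = _ := by module

/-- The error operator of the square-root measurement. The projection `Q` acts on the state side:
the wrong effects `Γ' i` are tested against the state compressed by `Q`. -/
lemma error_operator_le {J : Type*} (s : Finset J) {Λ : Matrix n n ℂ} {Γ' : J → Matrix n n ℂ}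
    {ε : ℝ} (hε : 0 ≤ ε)
    (h₄ : IsStarProjection P₄) (h₃ : IsStarProjection P₃)
    (h₂ : IsStarProjection P₂) (h : IsStarProjection P) (hQ : IsStarProjection Q)
    (hΛ0 : 0 ≤ Λ) (hΛ : 0 ≤ 1 - Λ)
    (hHN : 1 - Λ ≤ (2 : ℝ) • (1 - chainEffect P₄ P₃ P₂ P) +
      (4 : ℝ) • (ε • (1 : Matrix n n ℂ) + ∑ i ∈ s, Γ' i)) :
    1 - Λ ≤ (96 : ℝ) • ((1 - Q) + (1 - P₄) + (1 - P₃) + (1 - P₂) + (1 - P)) +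
      (8 * ε) • (1 : Matrix n n ℂ) + (8 : ℝ) • ∑ i ∈ s, Q * Γ' i * Q := by
  have hc0 := chainEffect_nonneg h₄ h₃ h₂ h
  have hc1 := chainEffect_le_one h₄ h₃ h₂ h
  have hc := one_sub_chainEffect_le h₄ h₃ h₂ h
  set C := chainEffect P₄ P₃ P₂ P
  have s1 := le_two_smul_conj_add hQ hΛ (by simpa using hΛ0)
  have s2 := hQ.isSelfAdjoint.conjugate_le_conjugate hHN
  have s3 := conj_le_two_smul_add hQ (K := 1 - C) (sub_nonneg.2 hc1) (by simpa using hc0)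
  have e : Q * ((2 : ℝ) • (1 - C) + (4 : ℝ) • (ε • (1 : Matrix n n ℂ) + ∑ i ∈ s, Γ' i)) * Q
      = (2 : ℝ) • (Q * (1 - C) * Q) + (4 * ε) • Q + (4 : ℝ) • ∑ i ∈ s, Q * Γ' i * Q := by
    have : ∑ i ∈ s, Q * Γ' i * Q = Q * (∑ i ∈ s, Γ' i) * Q := by
      rw [Finset.mul_sum, Finset.sum_mul]
    rw [this]
    simp only [mul_add, add_mul, mul_smul_comm, smul_mul_assoc, mul_one, hQ.isIdempotentElem.eq]
    module
  rw [e] at s2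
  have p4 := compl_nonneg h₄
  have p3 := compl_nonneg h₃
  have p2 := compl_nonneg h₂
  have p1 := compl_nonneg h
  have pQ := compl_nonneg hQ
  calc 1 - Λ ≤ (2 : ℝ) • (Q * (1 - Λ) * Q) + (2 : ℝ) • (1 - Q) := s1
    _ ≤ (2 : ℝ) • ((2 : ℝ) • (Q * (1 - C) * Q) + (4 * ε) • Q + (4 : ℝ) • ∑ i ∈ s, Q * Γ' i * Q)
        + (2 : ℝ) • (1 - Q) := by gcongr
    _ ≤ (2 : ℝ) • ((2 : ℝ) • ((2 : ℝ) • ((3 : ℝ) • (1 - P₄) + (6 : ℝ) • (1 - P₃) +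
          (12 : ℝ) • (1 - P₂) + (8 : ℝ) • (1 - P)) + (2 : ℝ) • (1 - Q)) + (4 * ε) • 1 +
          (4 : ℝ) • ∑ i ∈ s, Q * Γ' i * Q) + (2 : ℝ) • (1 - Q) := by
        gcongr
        · exact s3.trans (by gcongr)
        · exact hQ.le_one
    _ ≤ _ := by
        rw [← sub_nonneg]
        have : 0 ≤ (86 : ℝ) • (1 - Q) + (72 : ℝ) • (1 - P₄) + (48 : ℝ) • (1 - P₃)
          + (32 : ℝ) • (1 - P) := by positivity
        refine this.trans (le_of_eq ?_)
        module

end Measurement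

/-! ### Averages over independent random families -/

section Averages

variable {I α : Type*} [Fintype I] [DecidableEq I] [Fintype α]

/-- The expectation of `F` over a family of independent random variables with distributions
`μ i`. -/
def piAvg (μ : I → α → ℝ) (F : (I → α) → ℝ) : ℝ := ∑ x, (∏ i, μ i (x i)) * F x

variable {μ : I → α → ℝ}

lemma piAvg_sum {K : Type*} (s : Finset K) (F : K → (I → α) → ℝ) :
    piAvg μ (fun x => ∑ k ∈ s, F k x) = ∑ k ∈ s, piAvg μ (F k) := by
  simp only [piAvg, Finset.mul_sum]
  exact Finset.sum_comm

lemma piAvg_add (F G : (I → α) → ℝ) :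
    piAvg μ (fun x => F x + G x) = piAvg μ F + piAvg μ G := by
  simp only [piAvg, mul_add, Finset.sum_add_distrib]

lemma piAvg_const_mul (c : ℝ) (F : (I → α) → ℝ) :
    piAvg μ (fun x => c * F x) = c * piAvg μ F := by
  simp only [piAvg, Finset.mul_sum]
  exact Finset.sum_congr rfl fun x _ => by ring

lemma piAvg_const (h : ∀ i, ∑ a, μ i a = 1) (c : ℝ) : piAvg μ (fun _ => c) = c := by
  rw [piAvg, ← Finset.sum_mul, ← Fintype.piFinset_univ, ← Finset.prod_univ_sum]
  simp [h]

lemma piAvg_mono (h : ∀ i a, 0 ≤ μ i a) {F G : (I → α) → ℝ} (hFG : ∀ x, F x ≤ G x) :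
    piAvg μ F ≤ piAvg μ G :=
  Finset.sum_le_sum fun x _ => mul_le_mul_of_nonneg_left (hFG x) (Finset.prod_nonneg fun i _ => h i _)

/-- An expectation does not change when one of the independent variables is averaged first. -/
lemma piAvg_resample (h : ∀ i, ∑ a, μ i a = 1) (j : I) (F : (I → α) → ℝ) :
    piAvg μ F = piAvg μ (fun x => ∑ a, μ j a * F (Function.update x j a)) := by
  classical
  simp only [piAvg]
  rw [← (Equiv.funSplitAt j α).symm.sum_comp, ← (Equiv.funSplitAt j α).symm.sum_comp,
    Fintype.sum_prod_type, Fintype.sum_prod_type, Finset.sum_comm, Finset.sum_comm (γ := α)]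
  refine Finset.sum_congr rfl fun y _ => ?_
  have hprod : ∀ a, ∏ i, μ i ((Equiv.funSplitAt j α).symm (a, y) i)
      = μ j a * ∏ i : {i // i ≠ j}, μ i (y i) := by
    intro a
    rw [← Finset.mul_prod_erase _ _ (Finset.mem_univ j)]
    congr 1
    · simp
    · rw [Finset.prod_subtype (p := fun i => i ≠ j) (Finset.univ.erase j) (by simp)]
      exact Finset.prod_congr rfl fun i _ => by simp [i.2]
  have hupd : ∀ a b, Function.update ((Equiv.funSplitAt j α).symm (a, y)) j b
      = (Equiv.funSplitAt j α).symm (b, y) := by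
    intro a b
    ext i
    by_cases hi : i = j
    · subst hi; simp
    · simp [hi]
  simp only [hprod, hupd]
  have : ∀ a, μ j a * (∏ i : {i // i ≠ j}, μ i (y i)) *
      ∑ b, μ j b * F ((Equiv.funSplitAt j α).symm (b, y))
      = μ j a * ((∏ i : {i // i ≠ j}, μ i (y i)) *
      ∑ b, μ j b * F ((Equiv.funSplitAt j α).symm (b, y))) := fun a => by ring
  simp only [this]
  rw [← Finset.sum_mul, h j, one_mul, Finset.mul_sum]
  exact Finset.sum_congr rfl fun a _ => by ring

lemma piAvg_eval (h : ∀ i, ∑ a, μ i a = 1) (j : I) (F : α → ℝ) :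
    piAvg μ (fun x => F (x j)) = ∑ a, μ j a * F a := by
  rw [piAvg_resample h j]
  simp only [Function.update_self]
  exact piAvg_const h _

lemma exists_le_piAvg (h0 : ∀ i a, 0 ≤ μ i a) (h : ∀ i, ∑ a, μ i a = 1) (F : (I → α) → ℝ) :
    ∃ x, F x ≤ piAvg μ F := by
  by_contra! hlt
  have hw : ∑ x : I → α, ∏ i, μ i (x i) = 1 := by
    have := piAvg_const h 1
    simpa [piAvg] using this
  have hx : ∃ x : I → α, 0 < ∏ i, μ i (x i) := by
    by_contra! hle
    have := Finset.sum_nonpos (s := Finset.univ) fun x _ => hle x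
    linarith
  obtain ⟨x₀, hx₀⟩ := hx
  have : piAvg μ (fun _ => piAvg μ F) < piAvg μ F := by
    refine Finset.sum_lt_sum (fun x _ => mul_le_mul_of_nonneg_left (hlt x).le
      (Finset.prod_nonneg fun i _ => h0 i _)) ⟨x₀, Finset.mem_univ _, ?_⟩
    exact mul_lt_mul_of_pos_left (hlt x₀) hx₀
  rw [piAvg_const h] at this
  exact lt_irrefl _ this

end Averages

/-! ### Random coding for one use of the channel -/

/-- The data of the random coding argument for a single use of a channel `ρ` and a source `p` with
common function `f(u) = g(v)`.

`t` is the indicator of the set of source outputs which the code takes care of. The conditional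
probabilities are `aU u = p(u | f u)`, `bU u v = p(v | u)`, `bV v u = p(u | v)`; `ρ₂`, `ρ₃`, `ρ₄`,
`ρ₁` are the averages of the channel output given `(x₁, u, s)`, given `(w, s)`, given nothing, and
given `(x₂, v, s)`. The projections `P`, `P₂`, `P₃`, `P₄`, `Q` stand for the typical subspaces of
`ρ`, `ρ₂`, `ρ₃`, `ρ₄`, `ρ₁`: the eigenvalues of `ρ` on `P` are at least `κ⁻¹`, those of `ρᵢ` on its
subspace at most `lᵢ`. On the support of `t`, the probabilities `p(u | v)`, `p(v | u)`, `p(u, v | w)`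
and `p(u, v)` are at least `N₁⁻¹`, …, `N₄⁻¹`. The probabilities of confusion of the four types are at most `β₁`,
…, `β₄`; a type that does not occur in the support of `t` is not subject to any condition. -/
structure CodeSetup (U V W S X₁ X₂ D : Type*) [Fintype U] [Fintype V] [Fintype W] [Fintype S]
    [Fintype X₁] [Fintype X₂] [Fintype D] [DecidableEq D] [DecidableEq W] where
  p : U → V → ℝ
  f : U → W
  g : V → W
  pS : S → ℝ
  q₁ : U → S → X₁ → ℝ
  q₂ : V → S → X₂ → ℝ
  ρ : X₁ → X₂ → Matrix D D ℂ
  t : U → V → ℝ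
  pV : V → ℝ
  pW : W → ℝ
  aU : U → ℝ
  bU : U → V → ℝ
  bV : V → U → ℝ
  ρ₁ : X₂ → V → S → Matrix D D ℂ
  ρ₂ : X₁ → U → S → Matrix D D ℂ
  ρ₃ : W → S → Matrix D D ℂ
  ρ₄ : Matrix D D ℂ
  P : X₁ → X₂ → Matrix D D ℂ
  P₂ : X₁ → U → S → Matrix D D ℂ
  P₃ : W → S → Matrix D D ℂ
  P₄ : Matrix D D ℂ
  Q : X₂ → V → S → Matrix D D ℂ
  (κ l₁ l₂ l₃ l₄ N₁ N₂ N₃ N₄ β₁ β₂ β₃ β₄ : ℝ)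
  p_nonneg : ∀ u v, 0 ≤ p u v
  p_sum : ∑ u, ∑ v, p u v = 1
  pS_nonneg : ∀ s, 0 ≤ pS s
  pS_sum : ∑ s, pS s = 1
  q₁_nonneg : ∀ u s x, 0 ≤ q₁ u s x
  q₁_sum : ∀ u s, ∑ x, q₁ u s x = 1
  q₂_nonneg : ∀ v s x, 0 ≤ q₂ v s x
  q₂_sum : ∀ v s, ∑ x, q₂ v s x = 1
  ρ_nonneg : ∀ x₁ x₂, 0 ≤ ρ x₁ x₂
  ρ_trace : ∀ x₁ x₂, (ρ x₁ x₂).trace = 1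
  t_zero_or_one : ∀ u v, t u v = 0 ∨ t u v = 1
  t_common : ∀ u v, t u v ≠ 0 → f u = g v
  pV_nonneg : ∀ v, 0 ≤ pV v
  pV_sum : ∑ v, pV v = 1
  pW_nonneg : ∀ w, 0 ≤ pW w
  aU_nonneg : ∀ u, 0 ≤ aU u
  bU_nonneg : ∀ u v, 0 ≤ bU u v
  bV_sum : ∀ v, ∑ u, bV v u ≤ 1
  p_eq : ∀ u v, p u v = pV v * bV v u
  ρ₁_eq : ∀ x₂ v s, ρ₁ x₂ v s = ∑ u, bV v u • ∑ x₁, q₁ u s x₁ • ρ x₁ x₂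
  ρ₂_eq : ∀ x₁ u s, ρ₂ x₁ u s = ∑ v, bU u v • ∑ x₂, q₂ v s x₂ • ρ x₁ x₂
  ρ₃_eq : ∀ w s, ρ₃ w s = ∑ u, if f u = w then aU u • ∑ x₁, q₁ u s x₁ • ρ₂ x₁ u s else 0
  ρ₄_eq : ρ₄ = ∑ w, pW w • ∑ s, pS s • ρ₃ w s
  P_proj : ∀ x₁ x₂, IsStarProjection (P x₁ x₂)
  P₂_proj : ∀ x₁ u s, IsStarProjection (P₂ x₁ u s)
  P₃_proj : ∀ w s, IsStarProjection (P₃ w s)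
  P₄_proj : IsStarProjection P₄
  Q_proj : ∀ x₂ v s, IsStarProjection (Q x₂ v s)
  P_le : ∀ x₁ x₂, P x₁ x₂ ≤ κ • ρ x₁ x₂
  Q_le : ∀ x₂ v s, Q x₂ v s * ρ₁ x₂ v s * Q x₂ v s ≤ l₁ • (1 : Matrix D D ℂ)
  P₂_le : ∀ x₁ u s, P₂ x₁ u s * ρ₂ x₁ u s * P₂ x₁ u s ≤ l₂ • (1 : Matrix D D ℂ)
  P₂_le' : ∀ x₁ u s, P₂ x₁ u s * ρ₂ x₁ u s * P₂ x₁ u s ≤ ρ₂ x₁ u s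
  P₃_le : ∀ w s, P₃ w s * ρ₃ w s * P₃ w s ≤ l₃ • (1 : Matrix D D ℂ)
  P₃_le' : ∀ w s, P₃ w s * ρ₃ w s * P₃ w s ≤ ρ₃ w s
  P₄_le : P₄ * ρ₄ * P₄ ≤ l₄ • (1 : Matrix D D ℂ)
  κ_nonneg : 0 ≤ κ
  l₁_nonneg : 0 ≤ l₁
  l₂_nonneg : 0 ≤ l₂
  l₃_nonneg : 0 ≤ l₃
  N₁_nonneg : 0 ≤ N₁
  N₂_nonneg : 0 ≤ N₂
  N₃_nonneg : 0 ≤ N₃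
  N₄_nonneg : 0 ≤ N₄
  t_le₁ : ∀ u v, t u v ≤ N₁ * bV v u
  t_le₂ : ∀ u v, t u v ≤ N₂ * bU u v
  t_le₃ : ∀ u v, t u v ≤ N₃ * (aU u * bU u v)
  t_le₄ : ∀ u v, t u v ≤ N₄ * (pW (f u) * aU u * bU u v)
  β₁_nonneg : 0 ≤ β₁
  β₂_nonneg : 0 ≤ β₂
  β₃_nonneg : 0 ≤ β₃
  β₄_nonneg : 0 ≤ β₄
  bound₁ : N₁ * l₁ * κ ≤ β₁ ∨ ∀ u u' v, t u v ≠ 0 → t u' v ≠ 0 → u' = u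
  bound₂ : N₂ * κ * l₂ ≤ β₂ ∨ ∀ u v v', t u v ≠ 0 → t u v' ≠ 0 → v' = v
  bound₃ : N₃ * κ * l₃ ≤ β₃ ∨ ∀ u v u' v', t u v ≠ 0 → t u' v' ≠ 0 → f u' = f u → u' = u
  bound₄ : N₄ * κ * l₄ ≤ β₄ ∨ ∀ u v u' v', t u v ≠ 0 → t u' v' ≠ 0 → f u' = f u

namespace CodeSetup

variable {U V W S X₁ X₂ D : Type*} [Fintype U] [Fintype V] [Fintype W] [Fintype S]
    [Fintype X₁] [Fintype X₂] [Fintype D] [DecidableEq D] [DecidableEq W]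
    (d : CodeSetup U V W S X₁ X₂ D)

lemma t_nonneg (u : U) (v : V) : 0 ≤ d.t u v := by
  rcases d.t_zero_or_one u v with h | h <;> simp [h]

/-- The decoding effect of a pair of codewords `(x₁, x₂)` for `(u, v)` and `s`. -/
def pairEffect (u : U) (s : S) (x₁ : X₁) (x₂ : X₂) : Matrix D D ℂ :=
  chainEffect d.P₄ (d.P₃ (d.f u) s) (d.P₂ x₁ u s) (d.P x₁ x₂)

lemma pairEffect_nonneg (u : U) (s : S) (x₁ : X₁) (x₂ : X₂) : 0 ≤ d.pairEffect u s x₁ x₂ :=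
  chainEffect_nonneg d.P₄_proj (d.P₃_proj _ _) (d.P₂_proj _ _ _) (d.P_proj _ _)

lemma pairEffect_le_one (u : U) (s : S) (x₁ : X₁) (x₂ : X₂) : d.pairEffect u s x₁ x₂ ≤ 1 :=
  chainEffect_le_one d.P₄_proj (d.P₃_proj _ _) (d.P₂_proj _ _ _) (d.P_proj _ _)

/-- The effects of all the continuations `v` of `u`, averaged over the codeword of `v`. -/
lemma sum_pairEffect_le (u : U) (s : S) (x₁ : X₁) {N : ℝ}
    (hN : ∀ v, d.t u v ≤ N * d.bU u v) :
    ∑ v, d.t u v • ∑ x₂, d.q₂ v s x₂ • d.pairEffect u s x₁ x₂ ≤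
      (N * d.κ) • (d.P₄ * (d.P₃ (d.f u) s * (d.P₂ x₁ u s * d.ρ₂ x₁ u s * d.P₂ x₁ u s) *
        d.P₃ (d.f u) s) * d.P₄) := by
  have e : ∑ v, d.t u v • ∑ x₂, d.q₂ v s x₂ • d.pairEffect u s x₁ x₂ =
      chainEffect d.P₄ (d.P₃ (d.f u) s) (d.P₂ x₁ u s)
        (∑ v, d.t u v • ∑ x₂, d.q₂ v s x₂ • d.P x₁ x₂) := by
    simp only [pairEffect, chainEffect, Finset.mul_sum, Finset.sum_mul, mul_smul_comm,
      smul_mul_assoc]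
  have h : ∑ v, d.t u v • ∑ x₂, d.q₂ v s x₂ • d.P x₁ x₂ ≤ (N * d.κ) • d.ρ₂ x₁ u s := by
    rw [d.ρ₂_eq, Finset.smul_sum]
    refine Finset.sum_le_sum fun v _ => ?_
    have h1 : ∑ x₂, d.q₂ v s x₂ • d.P x₁ x₂ ≤ d.κ • ∑ x₂, d.q₂ v s x₂ • d.ρ x₁ x₂ := by
      rw [Finset.smul_sum]
      refine Finset.sum_le_sum fun x _ => ?_
      rw [smul_comm]
      exact smul_le_smul_of_nonneg_left (d.P_le _ _) (d.q₂_nonneg _ _ _)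
    have h2 : (0 : Matrix D D ℂ) ≤ d.κ • ∑ x₂, d.q₂ v s x₂ • d.ρ x₁ x₂ :=
      smul_nonneg d.κ_nonneg <| Finset.sum_nonneg fun x _ =>
        smul_nonneg (d.q₂_nonneg _ _ _) (d.ρ_nonneg _ _)
    calc _ ≤ d.t u v • d.κ • ∑ x₂, d.q₂ v s x₂ • d.ρ x₁ x₂ :=
          smul_le_smul_of_nonneg_left h1 (d.t_nonneg _ _)
      _ ≤ (N * d.bU u v) • d.κ • ∑ x₂, d.q₂ v s x₂ • d.ρ x₁ x₂ :=
          smul_le_smul_of_nonneg_right (hN v) h2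
      _ = _ := by simp only [smul_smul]; ring_nf
  rw [e]
  have h3 := (d.P₂_proj x₁ u s).isSelfAdjoint.conjugate_le_conjugate h
  have h4 := (d.P₃_proj (d.f u) s).isSelfAdjoint.conjugate_le_conjugate h3
  have h5 := d.P₄_proj.isSelfAdjoint.conjugate_le_conjugate h4
  simpa only [chainEffect, mul_smul_comm, smul_mul_assoc] using h5

lemma conj_smul_one_le {P : Matrix D D ℂ} (hP : IsStarProjection P) {M : Matrix D D ℂ} {l : ℝ}
    (hl : 0 ≤ l) (h : M ≤ l • (1 : Matrix D D ℂ)) : P * M * P ≤ l • (1 : Matrix D D ℂ) := by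
  have := hP.isSelfAdjoint.conjugate_le_conjugate h
  rw [mul_smul_comm, smul_mul_assoc, mul_one, hP.isIdempotentElem.eq] at this
  exact this.trans (smul_le_smul_of_nonneg_left hP.le_one hl)

/-- The effects competing with `(u, v)` that have the same `u`. -/
lemma sum_pairEffect_same_u_le (u : U) (s : S) (x₁ : X₁) :
    ∑ v, d.t u v • ∑ x₂, d.q₂ v s x₂ • d.pairEffect u s x₁ x₂ ≤
      (d.N₂ * d.κ * d.l₂) • (1 : Matrix D D ℂ) := by
  refine (d.sum_pairEffect_le u s x₁ (d.t_le₂ u)).trans ?_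
  rw [mul_smul _ d.l₂]
  refine smul_le_smul_of_nonneg_left ?_ (mul_nonneg d.N₂_nonneg d.κ_nonneg)
  exact conj_smul_one_le d.P₄_proj d.l₂_nonneg <|
    conj_smul_one_le (d.P₃_proj _ _) d.l₂_nonneg (d.P₂_le _ _ _)

/-- The decoding effect of `(u, v)` averaged over both codewords. -/
def meanEffect (s : S) (u : U) (v : V) : Matrix D D ℂ :=
  d.t u v • ∑ x₁, d.q₁ u s x₁ • ∑ x₂, d.q₂ v s x₂ • d.pairEffect u s x₁ x₂

lemma meanEffect_nonneg (s : S) (u : U) (v : V) : 0 ≤ d.meanEffect s u v :=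
  smul_nonneg (d.t_nonneg _ _) <| Finset.sum_nonneg fun _ _ => smul_nonneg (d.q₁_nonneg _ _ _) <|
    Finset.sum_nonneg fun _ _ => smul_nonneg (d.q₂_nonneg _ _ _) (d.pairEffect_nonneg _ _ _ _)

/-- The effects of all the continuations `v` of `u`, averaged over both codewords. -/
lemma sum_meanEffect_le_conj (s : S) (u : U) {N : ℝ} (hN0 : 0 ≤ N)
    (hN : ∀ v, d.t u v ≤ N * d.bU u v) :
    ∑ v, d.meanEffect s u v ≤ (N * d.κ) • (d.P₄ * (d.P₃ (d.f u) s *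
      (∑ x₁, d.q₁ u s x₁ • d.ρ₂ x₁ u s) * d.P₃ (d.f u) s) * d.P₄) := by
  have e : ∑ v, d.meanEffect s u v = ∑ x₁, d.q₁ u s x₁ •
      ∑ v, d.t u v • ∑ x₂, d.q₂ v s x₂ • d.pairEffect u s x₁ x₂ := by
    simp only [meanEffect, Finset.smul_sum]
    rw [Finset.sum_comm]
    refine Finset.sum_congr rfl fun x _ => Finset.sum_congr rfl fun v _ =>
      Finset.sum_congr rfl fun y _ => ?_
    rw [smul_comm]
  have e' : (N * d.κ) • (d.P₄ * (d.P₃ (d.f u) s * (∑ x₁, d.q₁ u s x₁ • d.ρ₂ x₁ u s) *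
      d.P₃ (d.f u) s) * d.P₄) = ∑ x₁, d.q₁ u s x₁ • (N * d.κ) •
      (d.P₄ * (d.P₃ (d.f u) s * d.ρ₂ x₁ u s * d.P₃ (d.f u) s) * d.P₄) := by
    simp only [Finset.mul_sum, Finset.sum_mul, Finset.smul_sum, mul_smul_comm, smul_mul_assoc]
    exact Finset.sum_congr rfl fun x _ => smul_comm _ _ _
  rw [e, e']
  refine Finset.sum_le_sum fun x _ => ?_
  have h := d.sum_pairEffect_le u s x hN
  refine smul_le_smul_of_nonneg_left (h.trans ?_) (d.q₁_nonneg _ _ _)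
  refine smul_le_smul_of_nonneg_left ?_ (mul_nonneg hN0 d.κ_nonneg)
  exact d.P₄_proj.isSelfAdjoint.conjugate_le_conjugate <|
    (d.P₃_proj _ _).isSelfAdjoint.conjugate_le_conjugate (d.P₂_le' _ _ _)

/-- The effects with a given `w`, averaged over both codewords. -/
lemma sum_meanEffect_same_w_le (w : W) (s : S) :
    ∑ u, (if d.f u = w then ∑ v, d.meanEffect s u v else 0) ≤
      (d.N₃ * d.κ * d.l₃) • (1 : Matrix D D ℂ) := by
  have h : ∀ u, (if d.f u = w then ∑ v, d.meanEffect s u v else 0) ≤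
      (d.N₃ * d.κ) • (d.P₄ * (d.P₃ w s * (if d.f u = w then
        d.aU u • ∑ x₁, d.q₁ u s x₁ • d.ρ₂ x₁ u s else 0) * d.P₃ w s) * d.P₄) := by
    intro u
    split_ifs with hu
    · subst hu
      refine (d.sum_meanEffect_le_conj s u (N := d.N₃ * d.aU u)
        (mul_nonneg d.N₃_nonneg (d.aU_nonneg u)) fun v => ?_).trans (le_of_eq ?_)
      · rw [mul_assoc]; exact d.t_le₃ u v
      · simp only [mul_smul_comm, smul_mul_assoc, smul_smul]
        ring_nf
    · simp
  refine (Finset.sum_le_sum fun u _ => h u).trans ?_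
  rw [← Finset.smul_sum, ← Finset.sum_mul, ← Finset.mul_sum, ← Finset.sum_mul, ← Finset.mul_sum,
    ← d.ρ₃_eq, mul_smul _ d.l₃]
  refine smul_le_smul_of_nonneg_left ?_ (mul_nonneg d.N₃_nonneg d.κ_nonneg)
  exact conj_smul_one_le d.P₄_proj d.l₃_nonneg (d.P₃_le w s)

/-- All effects, averaged over `s` and both codewords. -/
lemma sum_meanEffect_le :
    ∑ u, ∑ v, ∑ s, d.pS s • d.meanEffect s u v ≤ (d.N₄ * d.κ * d.l₄) • (1 : Matrix D D ℂ) := by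
  have h : ∀ w s, ∑ u, (if d.f u = w then ∑ v, d.meanEffect s u v else 0) ≤
      (d.N₄ * d.κ * d.pW w) • (d.P₄ * d.ρ₃ w s * d.P₄) := by
    intro w s
    have h1 : ∀ u, (if d.f u = w then ∑ v, d.meanEffect s u v else 0) ≤
        (d.N₄ * d.κ * d.pW w) • (d.P₄ * (d.P₃ w s * (if d.f u = w then
          d.aU u • ∑ x₁, d.q₁ u s x₁ • d.ρ₂ x₁ u s else 0) * d.P₃ w s) * d.P₄) := by
      intro u
      split_ifs with hu
      · subst hu
        refine (d.sum_meanEffect_le_conj s u (N := d.N₄ * (d.pW (d.f u) * d.aU u))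
          (mul_nonneg d.N₄_nonneg (mul_nonneg (d.pW_nonneg _) (d.aU_nonneg u)))
          fun v => ?_).trans (le_of_eq ?_)
        · rw [mul_assoc]; exact d.t_le₄ u v
        · simp only [mul_smul_comm, smul_mul_assoc, smul_smul]
          ring_nf
      · simp
    refine (Finset.sum_le_sum fun u _ => h1 u).trans ?_
    rw [← Finset.smul_sum, ← Finset.sum_mul, ← Finset.mul_sum, ← Finset.sum_mul,
      ← Finset.mul_sum, ← d.ρ₃_eq]
    refine smul_le_smul_of_nonneg_left ?_
      (mul_nonneg (mul_nonneg d.N₄_nonneg d.κ_nonneg) (d.pW_nonneg w))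
    exact d.P₄_proj.isSelfAdjoint.conjugate_le_conjugate (d.P₃_le' w s)
  have e : ∑ u, ∑ v, ∑ s, d.pS s • d.meanEffect s u v =
      ∑ w, ∑ s, d.pS s • ∑ u, (if d.f u = w then ∑ v, d.meanEffect s u v else 0) := by
    have : ∀ s, ∑ w, ∑ u, (if d.f u = w then ∑ v, d.meanEffect s u v else 0) =
        ∑ u, ∑ v, d.meanEffect s u v := by
      intro s
      rw [Finset.sum_comm]
      simp
    rw [Finset.sum_comm (s := (Finset.univ : Finset W))]
    simp only [← Finset.smul_sum, this]
    simp only [Finset.smul_sum]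
    exact (Finset.sum_congr rfl fun u _ => Finset.sum_comm).trans Finset.sum_comm
  rw [e]
  calc _ ≤ ∑ w, ∑ s, d.pS s • (d.N₄ * d.κ * d.pW w) • (d.P₄ * d.ρ₃ w s * d.P₄) :=
        Finset.sum_le_sum fun w _ => Finset.sum_le_sum fun s _ =>
          smul_le_smul_of_nonneg_left (h w s) (d.pS_nonneg s)
    _ = (d.N₄ * d.κ) • (d.P₄ * d.ρ₄ * d.P₄) := by
        rw [d.ρ₄_eq]
        simp only [Finset.mul_sum, Finset.sum_mul, Finset.smul_sum, mul_smul_comm,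
          smul_mul_assoc, smul_smul]
        refine Finset.sum_congr rfl fun w _ => Finset.sum_congr rfl fun s _ => ?_
        ring_nf
    _ ≤ _ := by
        rw [mul_smul _ d.l₄]
        exact smul_le_smul_of_nonneg_left d.P₄_le (mul_nonneg d.N₄_nonneg d.κ_nonneg)

end CodeSetup

/-! ### The probabilities of confusion -/

namespace CodeSetup

variable {U V W S X₁ X₂ D : Type*} [Fintype U] [Fintype V] [Fintype W] [Fintype S]
    [Fintype X₁] [Fintype X₂] [Fintype D] [DecidableEq D] [DecidableEq W]
    [DecidableEq U] [DecidableEq V] [DecidableEq S]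
    (d : CodeSetup U V W S X₁ X₂ D)

/-- The expectation over the random code: a sequence `s w` for every `w`, and codewords
`c₁ (u, s)`, `c₂ (v, s)` for all pairs, all independent. The codewords in use are those for
`s = s (f u)` and `s = s (g v)`. -/
def codeAvg (F : (W → S) → (U × S → X₁) → (V × S → X₂) → ℝ) : ℝ :=
  piAvg (fun _ => d.pS) fun s => piAvg (fun i : U × S => d.q₁ i.1 i.2) fun c₁ =>
    piAvg (fun i : V × S => d.q₂ i.1 i.2) fun c₂ => F s c₁ c₂

lemma codeAvg_sum {K : Type*} (T : Finset K)
    (F : K → (W → S) → (U × S → X₁) → (V × S → X₂) → ℝ) :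
    d.codeAvg (fun s c₁ c₂ => ∑ k ∈ T, F k s c₁ c₂) = ∑ k ∈ T, d.codeAvg (F k) := by
  simp only [codeAvg, piAvg_sum]

lemma codeAvg_add (F G : (W → S) → (U × S → X₁) → (V × S → X₂) → ℝ) :
    d.codeAvg (fun s c₁ c₂ => F s c₁ c₂ + G s c₁ c₂) = d.codeAvg F + d.codeAvg G := by
  simp only [codeAvg, piAvg_add]

lemma codeAvg_const_mul (c : ℝ) (F : (W → S) → (U × S → X₁) → (V × S → X₂) → ℝ) :
    d.codeAvg (fun s c₁ c₂ => c * F s c₁ c₂) = c * d.codeAvg F := by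
  simp only [codeAvg, piAvg_const_mul]

lemma codeAvg_const (c : ℝ) : d.codeAvg (fun _ _ _ => c) = c := by
  simp only [codeAvg]
  rw [piAvg_const (fun _ => d.pS_sum), piAvg_const (fun i : U × S => d.q₁_sum i.1 i.2),
    piAvg_const (fun i : V × S => d.q₂_sum i.1 i.2)]

lemma codeAvg_mono {F G : (W → S) → (U × S → X₁) → (V × S → X₂) → ℝ}
    (h : ∀ s c₁ c₂, F s c₁ c₂ ≤ G s c₁ c₂) : d.codeAvg F ≤ d.codeAvg G :=
  piAvg_mono (fun _ => d.pS_nonneg) fun s => piAvg_mono (fun _ => d.q₁_nonneg _ _) fun c₁ =>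
    piAvg_mono (fun _ => d.q₂_nonneg _ _) fun c₂ => h s c₁ c₂

lemma codeAvg_le {F : (W → S) → (U × S → X₁) → (V × S → X₂) → ℝ} {c : ℝ}
    (h : ∀ s c₁ c₂, F s c₁ c₂ ≤ c) : d.codeAvg F ≤ c :=
  (d.codeAvg_mono h).trans_eq (d.codeAvg_const c)

lemma codeAvg_nonneg {F : (W → S) → (U × S → X₁) → (V × S → X₂) → ℝ}
    (h : ∀ s c₁ c₂, 0 ≤ F s c₁ c₂) : 0 ≤ d.codeAvg F :=
  (d.codeAvg_const 0).symm.le.trans (d.codeAvg_mono h)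

lemma exists_le_codeAvg (F : (W → S) → (U × S → X₁) → (V × S → X₂) → ℝ) :
    ∃ s c₁ c₂, F s c₁ c₂ ≤ d.codeAvg F := by
  obtain ⟨s, hs⟩ := exists_le_piAvg (μ := fun _ : W => d.pS) (fun _ => d.pS_nonneg)
    (fun _ => d.pS_sum) (fun s => piAvg (fun i : U × S => d.q₁ i.1 i.2) fun c₁ =>
    piAvg (fun i : V × S => d.q₂ i.1 i.2) fun c₂ => F s c₁ c₂)
  obtain ⟨c₁, hc₁⟩ := exists_le_piAvg (μ := fun i : U × S => d.q₁ i.1 i.2)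
    (fun _ => d.q₁_nonneg _ _) (fun _ => d.q₁_sum _ _) (fun c₁ =>
    piAvg (fun i : V × S => d.q₂ i.1 i.2) fun c₂ => F s c₁ c₂)
  obtain ⟨c₂, hc₂⟩ := exists_le_piAvg (μ := fun i : V × S => d.q₂ i.1 i.2)
    (fun _ => d.q₂_nonneg _ _) (fun _ => d.q₂_sum _ _) (fun c₂ => F s c₁ c₂)
  exact ⟨s, c₁, c₂, hc₂.trans (hc₁.trans hs)⟩

/-- The channel output for `(u, v)`. -/
def output (s : W → S) (c₁ : U × S → X₁) (c₂ : V × S → X₂) (u : U) (v : V) : Matrix D D ℂ :=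
  d.ρ (c₁ (u, s (d.f u))) (c₂ (v, s (d.g v)))

/-- The projection on the typical subspace given the codeword of `v`. -/
def proj (s : W → S) (c₂ : V × S → X₂) (v : V) : Matrix D D ℂ :=
  d.Q (c₂ (v, s (d.g v))) v (s (d.g v))

/-- The channel output for `(u, v)`, compressed to the typical subspace given the codeword
of `v`. -/
def state (s : W → S) (c₁ : U × S → X₁) (c₂ : V × S → X₂) (u : U) (v : V) : Matrix D D ℂ :=
  d.proj s c₂ v * d.output s c₁ c₂ u v * d.proj s c₂ v

/-- The decoding effect for `(u, v)`, zero if `t u v = 0`. -/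
def effect (s : W → S) (c₁ : U × S → X₁) (c₂ : V × S → X₂) (u : U) (v : V) : Matrix D D ℂ :=
  d.t u v • d.pairEffect u (s (d.f u)) (c₁ (u, s (d.f u))) (c₂ (v, s (d.g v)))

/-- The expected weight of the effect for `(u', v')` when `(u, v)` has been sent. -/
def confusion (u : U) (v : V) (u' : U) (v' : V) : ℝ :=
  d.codeAvg fun s c₁ c₂ => trRe (d.effect s c₁ c₂ u' v') (d.state s c₁ c₂ u v)

section

variable {d} {s : W → S} {c₁ : U × S → X₁} {c₂ : V × S → X₂} {u u' : U} {v v' : V}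

lemma proj_isStarProjection : IsStarProjection (d.proj s c₂ v) := d.Q_proj _ _ _

lemma state_nonneg : 0 ≤ d.state s c₁ c₂ u v :=
  conj_nonneg proj_isStarProjection.isSelfAdjoint (d.ρ_nonneg _ _)

lemma trRe_one_state_le : trRe 1 (d.state s c₁ c₂ u v) ≤ 1 := by
  have hQ := proj_isStarProjection (d := d) (s := s) (c₂ := c₂) (v := v)
  rw [state, ← trRe_conj, mul_one, hQ.isIdempotentElem.eq]
  refine (trRe_mono_left hQ.le_one (d.ρ_nonneg _ _)).trans (le_of_eq ?_)
  rw [trRe_one_left, d.ρ_trace, Complex.one_re]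

lemma trRe_state_le {M : Matrix D D ℂ} {β : ℝ} (hβ : 0 ≤ β) (h : M ≤ β • (1 : Matrix D D ℂ)) :
    trRe M (d.state s c₁ c₂ u v) ≤ β := by
  refine (trRe_mono_left h state_nonneg).trans ?_
  rw [map_smul, LinearMap.smul_apply, smul_eq_mul]
  exact mul_le_of_le_one_right hβ trRe_one_state_le

lemma effect_nonneg : 0 ≤ d.effect s c₁ c₂ u v :=
  smul_nonneg (d.t_nonneg _ _) (d.pairEffect_nonneg _ _ _ _)

lemma effect_eq_zero (h : d.t u v = 0) : d.effect s c₁ c₂ u v = 0 := by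
  simp [effect, h]

lemma confusion_eq_zero (h : d.t u' v' = 0) : d.confusion u v u' v' = 0 := by
  simp [confusion, effect_eq_zero h, d.codeAvg_const]

/-- Averaging the effect of `(u, v')`, `v' ≠ v`, over the codeword of `v'`. -/
lemma confusion_same_u_eq (hv : v' ≠ v) : d.confusion u v u v' = d.codeAvg fun s c₁ c₂ =>
    trRe (d.t u v' • ∑ x, d.q₂ v' (s (d.f u)) x • d.pairEffect u (s (d.f u))
      (c₁ (u, s (d.f u))) x) (d.state s c₁ c₂ u v) := by
  by_cases ht : d.t u v' = 0
  · rw [confusion_eq_zero ht]; simp [ht, d.codeAvg_const]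
  have hw := d.t_common u v' ht
  simp only [confusion, codeAvg]
  congr 1; funext s; congr 1; funext c₁
  rw [piAvg_resample (fun i : V × S => d.q₂_sum i.1 i.2) (v', s (d.g v'))]
  congr 1; funext c₂
  have hne : ∀ a, (v, a) ≠ (v', s (d.g v')) := fun a h => hv (Prod.ext_iff.1 h).1.symm
  simp only [effect, state, proj, output, Function.update_self, Function.update_of_ne (hne _),
    map_smul, map_sum, LinearMap.smul_apply, LinearMap.sum_apply, smul_eq_mul, Finset.mul_sum, hw]
  exact Finset.sum_congr rfl fun _ _ => by ring

/-- Averaging the effect of `(u', v')`, `u' ≠ u` and `v' ≠ v`, over the codewords of `u'`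
and `v'`. -/
lemma confusion_eq (hu : u' ≠ u) (hv : v' ≠ v) : d.confusion u v u' v' =
    d.codeAvg fun s c₁ c₂ => trRe (d.meanEffect (s (d.f u')) u' v') (d.state s c₁ c₂ u v) := by
  by_cases ht : d.t u' v' = 0
  · rw [confusion_eq_zero ht]; simp [ht, meanEffect, d.codeAvg_const]
  have hw := d.t_common u' v' ht
  simp only [confusion, codeAvg]
  congr 1; funext s
  have hne : ∀ a, (v, a) ≠ (v', s (d.f u')) := fun a h => hv (Prod.ext_iff.1 h).1.symm
  have hne' : ∀ a, (u, a) ≠ (u', s (d.f u')) := fun a h => hu (Prod.ext_iff.1 h).1.symm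
  have h2 : ∀ c₁ : U × S → X₁, (piAvg (fun i : V × S => d.q₂ i.1 i.2) fun c₂ =>
      trRe (d.effect s c₁ c₂ u' v') (d.state s c₁ c₂ u v)) =
      piAvg (fun i : V × S => d.q₂ i.1 i.2) fun c₂ => ∑ y, d.q₂ v' (s (d.f u')) y *
        (d.t u' v' * trRe (d.pairEffect u' (s (d.f u')) (c₁ (u', s (d.f u'))) y)
          (d.state s c₁ c₂ u v)) := by
    intro c₁
    rw [piAvg_resample (fun i : V × S => d.q₂_sum i.1 i.2) (v', s (d.f u'))]
    simp only [effect, state, proj, output, ← hw, Function.update_self,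
      Function.update_of_ne (hne _), map_smul, LinearMap.smul_apply, smul_eq_mul]
  simp only [h2]
  rw [piAvg_resample (fun i : U × S => d.q₁_sum i.1 i.2) (u', s (d.f u'))]
  congr 1; funext c₁
  simp only [← piAvg_const_mul]
  rw [← piAvg_sum]
  congr 1; funext c₂
  simp only [meanEffect, state, proj, output, Function.update_self,
    Function.update_of_ne (hne' _), map_smul, map_sum, LinearMap.smul_apply, LinearMap.sum_apply,
    smul_eq_mul, Finset.mul_sum]
  exact Finset.sum_congr rfl fun _ _ => Finset.sum_congr rfl fun _ _ => by ring

/-- If moreover `f u' ≠ f u`, the sequence `s (f u')` can be averaged as well. -/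
lemma confusion_eq_of_ne (hu : u' ≠ u) (hv : v' ≠ v) (ht : d.t u v ≠ 0) (hw : d.f u' ≠ d.f u) :
    d.confusion u v u' v' = d.codeAvg fun s c₁ c₂ =>
      trRe (∑ a, d.pS a • d.meanEffect a u' v') (d.state s c₁ c₂ u v) := by
  have hg := d.t_common u v ht
  rw [confusion_eq hu hv]
  simp only [codeAvg]
  rw [piAvg_resample (fun _ : W => d.pS_sum) (d.f u')]
  congr 1; funext s
  simp only [← piAvg_const_mul]
  rw [← piAvg_sum]
  congr 1; funext c₁
  rw [← piAvg_sum]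
  congr 1; funext c₂
  simp only [state, proj, output, ← hg, Function.update_self, Function.update_of_ne hw.symm,
    map_smul, map_sum, LinearMap.smul_apply, LinearMap.sum_apply, smul_eq_mul]

/-- Averaging the state for `(u, v)` over the codeword of `u`, which the effect of `(u', v)` does
not involve if `u' ≠ u`. -/
lemma confusion_same_v_eq (hu : u' ≠ u) (ht : d.t u v ≠ 0) :
    d.confusion u v u' v = d.codeAvg fun s c₁ c₂ => trRe (d.effect s c₁ c₂ u' v)
      (d.proj s c₂ v * (∑ x, d.q₁ u (s (d.g v)) x • d.ρ x (c₂ (v, s (d.g v)))) *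
        d.proj s c₂ v) := by
  have hg := d.t_common u v ht
  have hne : ∀ a b : S, (u', a) ≠ (u, b) := fun a b h => hu (Prod.ext_iff.1 h).1
  have hlin : ∀ (E K : Matrix D D ℂ) (s : S) (x₂ : X₂),
      trRe E (K * (∑ x, d.q₁ u s x • d.ρ x x₂) * K) =
        ∑ x, d.q₁ u s x * trRe E (K * d.ρ x x₂ * K) := by
    intro E K s x₂
    rw [Finset.mul_sum, Finset.sum_mul, map_sum]
    refine Finset.sum_congr rfl fun x _ => ?_
    rw [mul_smul_comm, smul_mul_assoc, map_smul, smul_eq_mul]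
  have hupd : ∀ s c₁ c₂ a,
      trRe (d.effect s (Function.update c₁ (u, s (d.g v)) a) c₂ u' v)
        (d.state s (Function.update c₁ (u, s (d.g v)) a) c₂ u v) =
      trRe (d.effect s c₁ c₂ u' v)
        (d.proj s c₂ v * d.ρ a (c₂ (v, s (d.g v))) * d.proj s c₂ v) := by
    intro s c₁ c₂ a
    rw [effect, effect, state, output, hg, Function.update_self, Function.update_of_ne (hne _ _)]
  simp only [hlin, ← hupd, confusion, codeAvg]
  congr 1; funext s
  rw [piAvg_resample (fun i : U × S => d.q₁_sum i.1 i.2) (u, s (d.g v))]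
  congr 1; funext c₁
  simp only [← piAvg_const_mul]
  rw [← piAvg_sum]

/-- The probability of a wrong `v'` together with the correct `u`. -/
lemma sum_confusion_same_u_le (ht : d.t u v ≠ 0) :
    ∑ v' ∈ Finset.univ.erase v, d.confusion u v u v' ≤ d.β₂ := by
  rcases d.bound₂ with hb | hb
  · rw [Finset.sum_congr rfl fun v' hv' => confusion_same_u_eq (Finset.ne_of_mem_erase hv'),
      ← codeAvg_sum]
    refine d.codeAvg_le fun s c₁ c₂ => ?_
    rw [← LinearMap.sum_apply, ← map_sum]
    refine trRe_state_le d.β₂_nonneg (le_trans ?_ ((d.sum_pairEffect_same_u_le u (s (d.f u))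
      (c₁ (u, s (d.f u)))).trans (smul_le_smul_of_nonneg_right hb zero_le_one)))
    exact Finset.sum_le_sum_of_subset_of_nonneg (Finset.subset_univ _) fun v' _ _ =>
      smul_nonneg (d.t_nonneg _ _) <| Finset.sum_nonneg fun _ _ =>
        smul_nonneg (d.q₂_nonneg _ _ _) (d.pairEffect_nonneg _ _ _ _)
  · refine le_of_eq_of_le (Finset.sum_eq_zero fun v' hv' => confusion_eq_zero ?_) d.β₂_nonneg
    by_contra h
    exact Finset.ne_of_mem_erase hv' (hb u v v' ht h)

/-- The probability of wrong `u'` and `v'` with the correct `w`. -/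
lemma sum_confusion_same_w_le (ht : d.t u v ≠ 0) :
    ∑ u' ∈ Finset.univ.erase u, (if d.f u' = d.f u then
      ∑ v' ∈ Finset.univ.erase v, d.confusion u v u' v' else 0) ≤ d.β₃ := by
  rcases d.bound₃ with hb | hb
  · have e : ∀ u' ∈ Finset.univ.erase u, (if d.f u' = d.f u then
        ∑ v' ∈ Finset.univ.erase v, d.confusion u v u' v' else 0) = d.codeAvg fun s c₁ c₂ =>
        trRe (if d.f u' = d.f u then
          ∑ v' ∈ Finset.univ.erase v, d.meanEffect (s (d.f u)) u' v' else 0)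
          (d.state s c₁ c₂ u v) := by
      intro u' hu'
      split_ifs with hw
      · rw [Finset.sum_congr rfl fun v' hv' => confusion_eq (Finset.ne_of_mem_erase hu')
          (Finset.ne_of_mem_erase hv'), ← codeAvg_sum]
        simp only [hw, map_sum, LinearMap.sum_apply]
      · simp [d.codeAvg_const]
    rw [Finset.sum_congr rfl e, ← codeAvg_sum]
    refine d.codeAvg_le fun s c₁ c₂ => ?_
    rw [← LinearMap.sum_apply, ← map_sum]
    refine trRe_state_le d.β₃_nonneg (le_trans ?_ ((d.sum_meanEffect_same_w_le (d.f u)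
      (s (d.f u))).trans (smul_le_smul_of_nonneg_right hb zero_le_one)))
    refine (Finset.sum_le_sum_of_subset_of_nonneg (Finset.subset_univ _) fun u' _ _ => ?_).trans
      (Finset.sum_le_sum fun u' _ => ?_)
    · split_ifs
      · exact Finset.sum_nonneg fun v' _ => d.meanEffect_nonneg _ _ _
      · exact le_rfl
    · split_ifs
      · exact Finset.sum_le_sum_of_subset_of_nonneg (Finset.subset_univ _) fun v' _ _ =>
          d.meanEffect_nonneg _ _ _
      · exact le_rfl
  · refine le_of_eq_of_le (Finset.sum_eq_zero fun u' hu' => ?_) d.β₃_nonneg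
    split_ifs with hw
    · refine Finset.sum_eq_zero fun v' hv' => confusion_eq_zero ?_
      by_contra h
      exact Finset.ne_of_mem_erase hu' (hb u v u' v' ht h hw)
    · rfl

/-- The probability of wrong `u'` and `v'` with a wrong `w`. -/
lemma sum_confusion_ne_w_le (ht : d.t u v ≠ 0) :
    ∑ u' ∈ Finset.univ.erase u, (if d.f u' = d.f u then 0 else
      ∑ v' ∈ Finset.univ.erase v, d.confusion u v u' v') ≤ d.β₄ := by
  rcases d.bound₄ with hb | hb
  · have e : ∀ u' ∈ Finset.univ.erase u, (if d.f u' = d.f u then 0 else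
        ∑ v' ∈ Finset.univ.erase v, d.confusion u v u' v') = d.codeAvg fun s c₁ c₂ =>
        trRe (if d.f u' = d.f u then 0 else
          ∑ v' ∈ Finset.univ.erase v, ∑ a, d.pS a • d.meanEffect a u' v')
          (d.state s c₁ c₂ u v) := by
      intro u' hu'
      split_ifs with hw
      · simp [d.codeAvg_const]
      · rw [Finset.sum_congr rfl fun v' hv' => confusion_eq_of_ne (Finset.ne_of_mem_erase hu')
          (Finset.ne_of_mem_erase hv') ht hw, ← codeAvg_sum]
        simp only [map_sum, LinearMap.sum_apply]
    have h0 : ∀ u' v', 0 ≤ ∑ a, d.pS a • d.meanEffect a u' v' := fun u' v' =>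
      Finset.sum_nonneg fun a _ => smul_nonneg (d.pS_nonneg a) (d.meanEffect_nonneg _ _ _)
    rw [Finset.sum_congr rfl e, ← codeAvg_sum]
    refine d.codeAvg_le fun s c₁ c₂ => ?_
    rw [← LinearMap.sum_apply, ← map_sum]
    refine trRe_state_le d.β₄_nonneg (le_trans ?_ (d.sum_meanEffect_le.trans
      (smul_le_smul_of_nonneg_right hb zero_le_one)))
    refine (Finset.sum_le_sum_of_subset_of_nonneg (Finset.subset_univ _) fun u' _ _ => ?_).trans
      (Finset.sum_le_sum fun u' _ => ?_)
    · split_ifs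
      · exact le_rfl
      · exact Finset.sum_nonneg fun v' _ => h0 _ _
    · split_ifs
      · exact Finset.sum_nonneg fun v' _ => h0 _ _
      · exact Finset.sum_le_sum_of_subset_of_nonneg (Finset.subset_univ _) fun v' _ _ => h0 _ _
  · refine le_of_eq_of_le (Finset.sum_eq_zero fun u' hu' => ?_) d.β₄_nonneg
    split_ifs with hw
    · rfl
    · refine Finset.sum_eq_zero fun v' hv' => confusion_eq_zero ?_
      by_contra h
      exact hw (hb u v u' v' ht h)

end

end CodeSetup

/-- The error probability in the state `A`, in the notation of `error_operator_le`. -/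
lemma trRe_error_le {D J : Type*} [Fintype D] [DecidableEq D] {P₄ P₃ P₂ P Q A : Matrix D D ℂ}
    (s : Finset J) {Λ : Matrix D D ℂ} {Γ' : J → Matrix D D ℂ} {ε : ℝ} (hε : 0 ≤ ε)
    (h₄ : IsStarProjection P₄) (h₃ : IsStarProjection P₃)
    (h₂ : IsStarProjection P₂) (h : IsStarProjection P) (hQ : IsStarProjection Q)
    (hΛ0 : 0 ≤ Λ) (hΛ : 0 ≤ 1 - Λ)
    (hHN : 1 - Λ ≤ (2 : ℝ) • (1 - chainEffect P₄ P₃ P₂ P) +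
      (4 : ℝ) • (ε • (1 : Matrix D D ℂ) + ∑ i ∈ s, Γ' i)) (hA : 0 ≤ A) (hA1 : trRe 1 A = 1) :
    trRe (1 - Λ) A ≤ 96 * trRe ((1 - Q) + (1 - P₄) + (1 - P₃) + (1 - P₂) + (1 - P)) A + 8 * ε +
      8 * ∑ i ∈ s, trRe (Γ' i) (Q * A * Q) := by
  have hop := trRe_mono_left (error_operator_le s hε h₄ h₃ h₂ h hQ hΛ0 hΛ hHN) hA
  rw [map_add, map_add, LinearMap.add_apply, LinearMap.add_apply, map_smul, map_smul, map_smul,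
    LinearMap.smul_apply, LinearMap.smul_apply, LinearMap.smul_apply, hA1, map_sum,
    LinearMap.sum_apply] at hop
  simpa only [trRe_conj, smul_eq_mul, mul_one] using hop

namespace CodeSetup

variable {U V W S X₁ X₂ D : Type*} [Fintype U] [Fintype V] [Fintype W] [Fintype S]
    [Fintype X₁] [Fintype X₂] [Fintype D] [DecidableEq D] [DecidableEq W]
    [DecidableEq U] [DecidableEq V] [DecidableEq S]
    (d : CodeSetup U V W S X₁ X₂ D)

lemma trRe_conj_one_le {P K : Matrix D D ℂ} (hP : IsStarProjection P) (hK : 0 ≤ K) :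
    trRe (P * K * P) 1 ≤ trRe K 1 := by
  rw [trRe_conj, mul_one, hP.isIdempotentElem.eq]
  exact trRe_mono_right hP.le_one hK

lemma trRe_pairEffect_one_le (u : U) (s : S) (x₁ : X₁) (x₂ : X₂) :
    trRe (d.pairEffect u s x₁ x₂) 1 ≤ d.κ := by
  have a2 := conj_nonneg (d.P₂_proj x₁ u s).isSelfAdjoint (d.P_proj x₁ x₂).nonneg
  have a3 := conj_nonneg (d.P₃_proj (d.f u) s).isSelfAdjoint a2
  refine (trRe_conj_one_le d.P₄_proj a3).trans <| (trRe_conj_one_le (d.P₃_proj _ _) a2).trans <|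
    (trRe_conj_one_le (d.P₂_proj _ _ _) (d.P_proj _ _).nonneg).trans ?_
  refine (trRe_mono_left (d.P_le x₁ x₂) zero_le_one).trans (le_of_eq ?_)
  rw [map_smul, LinearMap.smul_apply, trRe_apply, mul_one, d.ρ_trace]
  simp

/-- The probability of a wrong `u'` together with the correct `v`. Here the sum over the sent `u`
is essential: it turns the compressed state into `Q ρ₁ Q`. -/
lemma sum_confusion_same_v_le :
    ∑ u, ∑ v, d.p u v * (d.t u v * ∑ u' ∈ Finset.univ.erase u, d.confusion u v u' v) ≤ d.β₁ := by
  rcases d.bound₁ with hb | hb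
  · set G : U → U → V → (W → S) → (U × S → X₁) → (V × S → X₂) → ℝ := fun u u' v s c₁ c₂ =>
      trRe (d.effect s c₁ c₂ u' v) (d.proj s c₂ v *
        (d.p u v • ∑ x, d.q₁ u (s (d.g v)) x • d.ρ x (c₂ (v, s (d.g v)))) * d.proj s c₂ v)
    have hG : ∀ u u' v s c₁ c₂, 0 ≤ G u u' v s c₁ c₂ := fun u u' v s c₁ c₂ =>
      trRe_nonneg effect_nonneg <| conj_nonneg proj_isStarProjection.isSelfAdjoint <|
        smul_nonneg (d.p_nonneg _ _) <| Finset.sum_nonneg fun _ _ =>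
          smul_nonneg (d.q₁_nonneg _ _ _) (d.ρ_nonneg _ _)
    have h1 : ∀ u v, d.p u v * (d.t u v * ∑ u' ∈ Finset.univ.erase u, d.confusion u v u' v) ≤
        ∑ u', d.codeAvg (G u u' v) := by
      intro u v
      have hnn : ∀ u', 0 ≤ d.codeAvg (G u u' v) := fun u' => d.codeAvg_nonneg (hG u u' v)
      rcases d.t_zero_or_one u v with ht | ht
      · simpa [ht] using Finset.sum_nonneg fun u' _ => hnn u'
      · rw [ht, one_mul, Finset.mul_sum]
        refine le_trans (le_of_eq ?_) (Finset.sum_le_sum_of_subset_of_nonneg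
          (Finset.subset_univ (Finset.univ.erase u)) fun u' _ _ => hnn u')
        refine Finset.sum_congr rfl fun u' hu' => ?_
        rw [confusion_same_v_eq (Finset.ne_of_mem_erase hu') (by simp [ht]), ← codeAvg_const_mul]
        congr 1; funext s c₁ c₂
        simp only [G]
        rw [mul_smul_comm, smul_mul_assoc, map_smul, smul_eq_mul]
    have h2 : ∀ v, ∑ u, ∑ u', d.codeAvg (G u u' v) ≤ d.pV v * d.β₁ := by
      intro v
      rw [Finset.sum_comm]
      simp only [← codeAvg_sum]
      refine d.codeAvg_le fun s c₁ c₂ => ?_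
      have hsum : ∀ u', ∑ u, G u u' v s c₁ c₂ ≤ d.pV v * (d.l₁ * (d.t u' v * d.κ)) := by
        intro u'
        simp only [G]
        rw [← map_sum, ← Finset.sum_mul, ← Finset.mul_sum]
        have e : ∑ u, d.p u v • ∑ x, d.q₁ u (s (d.g v)) x • d.ρ x (c₂ (v, s (d.g v))) =
            d.pV v • d.ρ₁ (c₂ (v, s (d.g v))) v (s (d.g v)) := by
          rw [d.ρ₁_eq, Finset.smul_sum]
          exact Finset.sum_congr rfl fun u _ => by rw [d.p_eq, mul_smul]
        rw [e, mul_smul_comm, smul_mul_assoc, map_smul, smul_eq_mul]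
        refine mul_le_mul_of_nonneg_left ?_ (d.pV_nonneg v)
        refine (trRe_mono_right (d.Q_le _ _ _) effect_nonneg).trans ?_
        rw [map_smul, smul_eq_mul]
        refine mul_le_mul_of_nonneg_left ?_ d.l₁_nonneg
        rw [effect, map_smul, LinearMap.smul_apply, smul_eq_mul]
        exact mul_le_mul_of_nonneg_left (d.trRe_pairEffect_one_le _ _ _ _) (d.t_nonneg _ _)
      refine (Finset.sum_le_sum fun u' _ => hsum u').trans ?_
      rw [← Finset.mul_sum, ← Finset.mul_sum, ← Finset.sum_mul]
      refine mul_le_mul_of_nonneg_left (le_trans ?_ hb) (d.pV_nonneg v)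
      have h3 : ∑ u', d.t u' v ≤ d.N₁ := by
        calc ∑ u', d.t u' v ≤ ∑ u', d.N₁ * d.bV v u' := Finset.sum_le_sum fun u' _ => d.t_le₁ _ _
          _ = d.N₁ * ∑ u', d.bV v u' := by rw [Finset.mul_sum]
          _ ≤ d.N₁ := mul_le_of_le_one_right d.N₁_nonneg (d.bV_sum v)
      calc d.l₁ * ((∑ u', d.t u' v) * d.κ) ≤ d.l₁ * (d.N₁ * d.κ) :=
            mul_le_mul_of_nonneg_left (mul_le_mul_of_nonneg_right h3 d.κ_nonneg) d.l₁_nonneg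
        _ = _ := by ring
    calc _ ≤ ∑ u, ∑ v, ∑ u', d.codeAvg (G u u' v) :=
          Finset.sum_le_sum fun u _ => Finset.sum_le_sum fun v _ => h1 u v
      _ = ∑ v, ∑ u, ∑ u', d.codeAvg (G u u' v) := Finset.sum_comm
      _ ≤ ∑ v, d.pV v * d.β₁ := Finset.sum_le_sum fun v _ => h2 v
      _ = d.β₁ := by rw [← Finset.sum_mul, d.pV_sum, one_mul]
  · refine le_of_eq_of_le (Finset.sum_eq_zero fun u _ => Finset.sum_eq_zero fun v _ => ?_)
      d.β₁_nonneg
    rcases d.t_zero_or_one u v with ht | ht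
    · simp [ht]
    · rw [Finset.sum_eq_zero, mul_zero, mul_zero]
      intro u' hu'
      refine confusion_eq_zero ?_
      by_contra h
      exact Finset.ne_of_mem_erase hu' (hb u u' v (by simp [ht]) h)

/-- The competitors of `(u, v)` by type: `v' = v`, `u' = u`, both wrong with `f u' = f u`, and both
wrong with `f u' ≠ f u`. -/
lemma sum_erase_prod (F : U × V → ℝ) (u : U) (v : V) :
    ∑ j ∈ Finset.univ.erase (u, v), F j =
      ∑ u' ∈ Finset.univ.erase u, F (u', v) + ∑ v' ∈ Finset.univ.erase v, F (u, v') +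
      (∑ u' ∈ Finset.univ.erase u, (if d.f u' = d.f u then
        ∑ v' ∈ Finset.univ.erase v, F (u', v') else 0) +
      ∑ u' ∈ Finset.univ.erase u, (if d.f u' = d.f u then 0 else
        ∑ v' ∈ Finset.univ.erase v, F (u', v'))) := by
  have e : ∀ u', ∑ v', F (u', v') = F (u', v) + ∑ v' ∈ Finset.univ.erase v, F (u', v') :=
    fun u' => (Finset.add_sum_erase _ _ (Finset.mem_univ v)).symm
  have h1 := Finset.add_sum_erase Finset.univ F (Finset.mem_univ (u, v))
  rw [Fintype.sum_prod_type, ← Finset.add_sum_erase _ _ (Finset.mem_univ u), e u,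
    Finset.sum_congr rfl fun u' _ => e u', Finset.sum_add_distrib] at h1
  have h2 : ∑ u' ∈ Finset.univ.erase u, (if d.f u' = d.f u then
        ∑ v' ∈ Finset.univ.erase v, F (u', v') else 0) +
      ∑ u' ∈ Finset.univ.erase u, (if d.f u' = d.f u then 0 else
        ∑ v' ∈ Finset.univ.erase v, F (u', v')) =
      ∑ u' ∈ Finset.univ.erase u, ∑ v' ∈ Finset.univ.erase v, F (u', v') := by
    rw [← Finset.sum_add_distrib]
    exact Finset.sum_congr rfl fun u' _ => by split_ifs <;> simp
  rw [h2]
  linarith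

/-- The letters of the random code in use for `(u, v)` have the distribution
`p(s) p(x₁|u,s) p(x₂|v,s)`. -/
lemma codeAvg_joint {u : U} {v : V} (h : d.f u = d.g v) (F : S → X₁ → X₂ → ℝ) :
    d.codeAvg (fun s c₁ c₂ => F (s (d.f u)) (c₁ (u, s (d.f u))) (c₂ (v, s (d.g v)))) =
      ∑ s, d.pS s * ∑ x₁, d.q₁ u s x₁ * ∑ x₂, d.q₂ v s x₂ * F s x₁ x₂ := by
  rw [← piAvg_eval (μ := fun _ : W => d.pS) (fun _ => d.pS_sum) (d.f u)]
  simp only [codeAvg]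
  congr 1; funext s
  rw [← piAvg_eval (μ := fun i : U × S => d.q₁ i.1 i.2) (fun i => d.q₁_sum i.1 i.2)
    (u, s (d.f u))]
  congr 1; funext c₁
  rw [h, ← piAvg_eval (μ := fun i : V × S => d.q₂ i.1 i.2) (fun i => d.q₂_sum i.1 i.2)
    (v, s (d.g v))]

/-- How much the typical subspaces miss of the channel output. -/
def miss (u : U) (v : V) (s : S) (x₁ : X₁) (x₂ : X₂) : ℝ :=
  trRe ((1 - d.Q x₂ v s) + (1 - d.P₄) + (1 - d.P₃ (d.f u) s) + (1 - d.P₂ x₁ u s) +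
    (1 - d.P x₁ x₂)) (d.ρ x₁ x₂)

lemma miss_nonneg (u : U) (v : V) (s : S) (x₁ : X₁) (x₂ : X₂) : 0 ≤ d.miss u v s x₁ x₂ :=
  trRe_nonneg (add_nonneg (add_nonneg (add_nonneg (add_nonneg (compl_nonneg (d.Q_proj _ _ _))
    (compl_nonneg d.P₄_proj)) (compl_nonneg (d.P₃_proj _ _))) (compl_nonneg (d.P₂_proj _ _ _)))
    (compl_nonneg (d.P_proj _ _))) (d.ρ_nonneg _ _)

/-- The random coding bound: some code has an error probability of at most the probability of the
atypical source outputs, the weight missed by the typical subspaces, and the bounds on the four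
types of confusion. -/
theorem exists_code [Nonempty U] [Nonempty V] {η ε : ℝ} (hε : 0 < ε)
    (hη : ∑ u, ∑ v, d.p u v * ∑ s, d.pS s * ∑ x₁, d.q₁ u s x₁ * ∑ x₂, d.q₂ v s x₂ *
      d.miss u v s x₁ x₂ ≤ η) :
    ∃ (e₁ : U → X₁) (e₂ : V → X₂) (Λ : U × V → Matrix D D ℂ), IsPOVM Λ ∧
      ∑ u, ∑ v, d.p u v * trRe (1 - Λ (u, v)) (d.ρ (e₁ u) (e₂ v)) ≤
        ∑ u, ∑ v, d.p u v * (1 - d.t u v) +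
          (96 * η + 8 * ε + 8 * (d.β₁ + d.β₂ + d.β₃ + d.β₄)) := by
  -- the bound on the error of a fixed code, to be averaged
  set F : (W → S) → (U × S → X₁) → (V × S → X₂) → ℝ := fun s c₁ c₂ =>
    ∑ u, ∑ v, d.p u v * (d.t u v * (96 * d.miss u v (s (d.f u)) (c₁ (u, s (d.f u)))
      (c₂ (v, s (d.g v))) + 8 * ε + 8 * ∑ j ∈ Finset.univ.erase (u, v),
        trRe (d.effect s c₁ c₂ j.1 j.2) (d.state s c₁ c₂ u v))) with hF
  obtain ⟨s, c₁, c₂, hle⟩ := d.exists_le_codeAvg F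
  have hFavg : d.codeAvg F ≤ 96 * η + 8 * ε + 8 * (d.β₁ + d.β₂ + d.β₃ + d.β₄) := by
    have e : d.codeAvg F = ∑ u, ∑ v, d.p u v * (d.t u v * (96 * d.codeAvg (fun s c₁ c₂ =>
        d.miss u v (s (d.f u)) (c₁ (u, s (d.f u))) (c₂ (v, s (d.g v)))) + 8 * ε +
        8 * ∑ j ∈ Finset.univ.erase (u, v), d.confusion u v j.1 j.2)) := by
      simp only [hF, codeAvg_sum, codeAvg_const_mul, codeAvg_add, codeAvg_const, confusion]
    have hterm : ∀ u v, d.p u v * (d.t u v * (96 * d.codeAvg (fun s c₁ c₂ =>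
        d.miss u v (s (d.f u)) (c₁ (u, s (d.f u))) (c₂ (v, s (d.g v)))) + 8 * ε +
        8 * ∑ j ∈ Finset.univ.erase (u, v), d.confusion u v j.1 j.2)) ≤
        96 * (d.p u v * ∑ s, d.pS s * ∑ x₁, d.q₁ u s x₁ * ∑ x₂, d.q₂ v s x₂ *
          d.miss u v s x₁ x₂) + d.p u v * (8 * ε + 8 * (d.β₂ + d.β₃ + d.β₄)) +
        8 * (d.p u v * (d.t u v * ∑ u' ∈ Finset.univ.erase u, d.confusion u v u' v)) := by
      intro u v
      have hm : 0 ≤ ∑ s, d.pS s * ∑ x₁, d.q₁ u s x₁ * ∑ x₂, d.q₂ v s x₂ *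
          d.miss u v s x₁ x₂ :=
        Finset.sum_nonneg fun s _ => mul_nonneg (d.pS_nonneg s) <| Finset.sum_nonneg fun _ _ =>
          mul_nonneg (d.q₁_nonneg _ _ _) <| Finset.sum_nonneg fun _ _ =>
            mul_nonneg (d.q₂_nonneg _ _ _) (d.miss_nonneg _ _ _ _ _)
      rcases d.t_zero_or_one u v with ht | ht
      · simp only [ht, zero_mul, mul_zero, add_zero]
        exact add_nonneg (mul_nonneg (by norm_num) (mul_nonneg (d.p_nonneg _ _) hm))
          (mul_nonneg (d.p_nonneg _ _) (by
            linarith [d.β₂_nonneg, d.β₃_nonneg, d.β₄_nonneg]))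
      · have ht' : d.t u v ≠ 0 := by simp [ht]
        rw [d.codeAvg_joint (d.t_common u v ht') (d.miss u v), d.sum_erase_prod]
        have k2 := sum_confusion_same_u_le ht'
        have k3 := sum_confusion_same_w_le ht'
        have k4 := sum_confusion_ne_w_le ht'
        have := mul_le_mul_of_nonneg_left (add_le_add k2 (add_le_add k3 k4)) (d.p_nonneg u v)
        simp only [ht, one_mul]
        linarith
    rw [e]
    refine (Finset.sum_le_sum fun u _ => Finset.sum_le_sum fun v _ => hterm u v).trans ?_
    simp only [Finset.sum_add_distrib, ← Finset.mul_sum, ← Finset.sum_mul, d.p_sum, one_mul]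
    have := d.sum_confusion_same_v_le
    linarith
  obtain ⟨Λ, hΛ, herr⟩ := exists_povm (Classical.arbitrary (U × V))
    (fun j : U × V => d.effect s c₁ c₂ j.1 j.2) (fun j => effect_nonneg)
    (fun j => by
      rcases d.t_zero_or_one j.1 j.2 with ht | ht
      · simp [effect, ht]
      · simpa [effect, ht] using d.pairEffect_le_one _ _ _ _) hε
  refine ⟨fun u => c₁ (u, s (d.f u)), fun v => c₂ (v, s (d.g v)), Λ, hΛ, ?_⟩
  refine le_trans ?_ (add_le_add_right (hle.trans hFavg) _)
  rw [hF]
  simp only [← Finset.sum_add_distrib, ← mul_add]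
  refine Finset.sum_le_sum fun u _ => Finset.sum_le_sum fun v _ =>
    mul_le_mul_of_nonneg_left ?_ (d.p_nonneg u v)
  have hΛ0 : 0 ≤ Λ (u, v) := nonneg_iff_posSemidef.2 (hΛ.1 _)
  have hρ0 := d.ρ_nonneg (c₁ (u, s (d.f u))) (c₂ (v, s (d.g v)))
  have hρ1 : trRe 1 (d.ρ (c₁ (u, s (d.f u))) (c₂ (v, s (d.g v)))) = 1 := by
    rw [trRe_one_left, d.ρ_trace, Complex.one_re]
  rcases d.t_zero_or_one u v with ht | ht
  · rw [ht, zero_mul, add_zero, sub_zero, ← hρ1]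
    exact trRe_mono_left (sub_le_self _ hΛ0) hρ0
  · have hg := d.t_common u v (by simp [ht])
    have h2 := (herr (u, v)).2
    rw [show d.effect s c₁ c₂ (u, v).1 (u, v).2 = chainEffect d.P₄ (d.P₃ (d.f u) (s (d.f u)))
      (d.P₂ (c₁ (u, s (d.f u))) u (s (d.f u))) (d.P (c₁ (u, s (d.f u))) (c₂ (v, s (d.g v)))) by
        rw [effect, ht, one_smul, pairEffect]] at h2
    have hop := trRe_error_le _ hε.le d.P₄_proj (d.P₃_proj _ _) (d.P₂_proj _ _ _) (d.P_proj _ _)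
      (proj_isStarProjection (d := d) (s := s) (c₂ := c₂) (v := v)) hΛ0 (herr (u, v)).1 h2 hρ0 hρ1
    rw [ht, sub_self, zero_add, one_mul]
    refine hop.trans (le_of_eq ?_)
    simp only [miss, state, output, proj, hg]

end CodeSetup

/-! ### Tensor products and their spectral projections -/

section Tensor

variable {B : Type*} {n : ℕ}

/-- The tensor product of `n` matrices over `B`, in the product basis. -/
def tensor (A : Fin n → Matrix B B ℂ) : Matrix (Fin n → B) (Fin n → B) ℂ :=
  Matrix.of fun b b' => ∏ i, A i (b i) (b' i)

lemma tensor_apply (A : Fin n → Matrix B B ℂ) (b b' : Fin n → B) :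
    tensor A b b' = ∏ i, A i (b i) (b' i) := rfl

lemma tensor_conjTranspose (A : Fin n → Matrix B B ℂ) : (tensor A)ᴴ = tensor fun i => (A i)ᴴ := by
  ext b b'
  simp [tensor_apply, conjTranspose_apply]

lemma tensor_one [DecidableEq B] : (tensor fun _ : Fin n => (1 : Matrix B B ℂ)) = 1 := by
  ext b b'
  simp only [tensor_apply, one_apply]
  by_cases h : b = b'
  · simp [h]
  · obtain ⟨i, hi⟩ := Function.ne_iff.1 h
    rw [if_neg h]
    exact Finset.prod_eq_zero (Finset.mem_univ i) (if_neg hi)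

lemma tensor_diagonal [DecidableEq B] (d : Fin n → B → ℂ) :
    (tensor fun i => diagonal (d i)) = diagonal fun b => ∏ i, d i (b i) := by
  ext b b'
  simp only [tensor_apply, diagonal_apply]
  by_cases h : b = b'
  · simp [h]
  · obtain ⟨i, hi⟩ := Function.ne_iff.1 h
    rw [if_neg h]
    exact Finset.prod_eq_zero (Finset.mem_univ i) (if_neg hi)

lemma tensor_sum {α : Type*} [Fintype α] (w : Fin n → α → ℝ) (M : Fin n → α → Matrix B B ℂ) :
    (tensor fun i => ∑ a, w i a • M i a) =
      ∑ x : Fin n → α, (∏ i, w i (x i)) • tensor fun i => M i (x i) := by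
  ext b b'
  simp only [tensor_apply, Matrix.sum_apply, Matrix.smul_apply]
  rw [Finset.prod_univ_sum, Fintype.piFinset_univ]
  refine Finset.sum_congr rfl fun x _ => ?_
  simp [Finset.prod_mul_distrib]

variable [Fintype B]

lemma tensor_mul (A A' : Fin n → Matrix B B ℂ) :
    tensor A * tensor A' = tensor fun i => A i * A' i := by
  ext b b'
  simp only [mul_apply, tensor_apply]
  rw [Finset.prod_univ_sum, Fintype.piFinset_univ]
  simp [Finset.prod_mul_distrib]

lemma tensor_trace (A : Fin n → Matrix B B ℂ) : (tensor A).trace = ∏ i, (A i).trace := by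
  simp only [trace, diag, tensor_apply]
  rw [Finset.prod_univ_sum, Fintype.piFinset_univ]

variable [DecidableEq B]

lemma tensor_nonneg {A : Fin n → Matrix B B ℂ} (h : ∀ i, 0 ≤ A i) : 0 ≤ tensor A := by
  have e : A = fun i => (CFC.sqrt (A i))ᴴ * CFC.sqrt (A i) := by
    funext i
    have : IsSelfAdjoint (CFC.sqrt (A i)) := IsSelfAdjoint.of_nonneg (CFC.sqrt_nonneg _)
    rw [← star_eq_conjTranspose, this.star_eq, CFC.sqrt_mul_sqrt_self _ (h i)]
  rw [e, ← tensor_mul, ← tensor_conjTranspose]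
  exact nonneg_iff_posSemidef.2 (posSemidef_conjTranspose_mul_self _)

end Tensor

section DiagConj

variable {D : Type*} [Fintype D] [DecidableEq D]

/-- The operator with eigenvalues `x j` and eigenvectors the columns of `W`. -/
def diagConj (W : Matrix D D ℂ) (x : D → ℝ) : Matrix D D ℂ :=
  W * diagonal (fun j => (x j : ℂ)) * Wᴴ

variable {W : Matrix D D ℂ}

lemma diagConj_mul (hW : Wᴴ * W = 1) (x y : D → ℝ) :
    diagConj W x * diagConj W y = diagConj W (x * y) := by
  have : diagonal (fun j => (((x * y) j : ℝ) : ℂ)) =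
      diagonal (fun j => (x j : ℂ)) * diagonal (fun j => (y j : ℂ)) := by
    rw [diagonal_mul_diagonal]; simp
  rw [diagConj, diagConj, diagConj, this]
  calc _ = W * diagonal (fun j => (x j : ℂ)) * (Wᴴ * W) * diagonal (fun j => (y j : ℂ)) * Wᴴ := by
        noncomm_ring
    _ = _ := by rw [hW]; noncomm_ring

lemma diagConj_one (hW : W * Wᴴ = 1) : diagConj W 1 = 1 := by
  simp [diagConj, hW]

lemma diagConj_smul (c : ℝ) (x : D → ℝ) : diagConj W (c • x) = c • diagConj W x := by
  have : diagonal (fun j => (((c • x) j : ℝ) : ℂ)) = c • diagonal (fun j => (x j : ℂ)) := by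
    ext i j; by_cases h : i = j <;> simp [h]
  rw [diagConj, diagConj, this, mul_smul_comm, smul_mul_assoc]

lemma diagConj_sub (x y : D → ℝ) : diagConj W (x - y) = diagConj W x - diagConj W y := by
  have : diagonal (fun j => (((x - y) j : ℝ) : ℂ)) =
      diagonal (fun j => (x j : ℂ)) - diagonal (fun j => (y j : ℂ)) := by
    rw [diagonal_sub]; simp
  rw [diagConj, diagConj, diagConj, this]
  noncomm_ring

lemma diagConj_nonneg {x : D → ℝ} (h : ∀ j, 0 ≤ x j) : 0 ≤ diagConj W x :=
  nonneg_iff_posSemidef.2 <| (PosSemidef.diagonal fun j => by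
    simpa using h j).mul_mul_conjTranspose_same W

lemma diagConj_mono {x y : D → ℝ} (h : ∀ j, x j ≤ y j) : diagConj W x ≤ diagConj W y := by
  rw [← sub_nonneg, ← diagConj_sub]
  exact diagConj_nonneg fun j => sub_nonneg.2 (h j)

lemma diagConj_isStarProjection (hW : Wᴴ * W = 1) {x : D → ℝ} (h : ∀ j, x j = 0 ∨ x j = 1) :
    IsStarProjection (diagConj W x) := by
  refine ⟨?_, ?_⟩
  · rw [IsIdempotentElem, diagConj_mul hW]
    congr 1; funext j
    rcases h j with h | h <;> simp [h]
  · exact IsSelfAdjoint.of_nonneg (diagConj_nonneg fun j => by rcases h j with h | h <;> simp [h])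

lemma trRe_diagConj (x : D → ℝ) (A : Matrix D D ℂ) :
    trRe (diagConj W x) A = ∑ j, x j * ((Wᴴ * A * W) j j).re := by
  rw [trRe_apply, diagConj, mul_assoc, mul_assoc, trace_mul_comm, mul_assoc, trace]
  simp only [diag_apply, diagonal_mul, Complex.re_sum, Complex.re_ofReal_mul]

end DiagConj

section Spectral

variable {B : Type*} [Fintype B] [DecidableEq B]

/-- A unitary of eigenvectors of a Hermitian matrix (the identity for other matrices). -/
def eigU (A : Matrix B B ℂ) : Matrix B B ℂ :=
  if hA : A.IsHermitian then (hA.eigenvectorUnitary : Matrix B B ℂ) else 1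

/-- The eigenvalues of a Hermitian matrix (zero for other matrices). -/
def eigVal (A : Matrix B B ℂ) : B → ℝ :=
  if hA : A.IsHermitian then hA.eigenvalues else 0

lemma eigU_mul (A : Matrix B B ℂ) : eigU A * (eigU A)ᴴ = 1 := by
  unfold eigU; split_ifs with hA
  · exact Unitary.coe_mul_star_self hA.eigenvectorUnitary
  · simp

lemma eigU_mul' (A : Matrix B B ℂ) : (eigU A)ᴴ * eigU A = 1 := by
  unfold eigU; split_ifs with hA
  · exact Unitary.coe_star_mul_self hA.eigenvectorUnitary
  · simp

lemma diagConj_eig {A : Matrix B B ℂ} (hA : A.IsHermitian) : diagConj (eigU A) (eigVal A) = A := by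
  conv_rhs => rw [hA.spectral_theorem, Unitary.conjStarAlgAut_apply]
  simp [diagConj, eigU, eigVal, hA, Function.comp_def, star_eq_conjTranspose]

lemma eigVal_nonneg {A : Matrix B B ℂ} (hA : 0 ≤ A) (j : B) : 0 ≤ eigVal A j := by
  have h := nonneg_iff_posSemidef.1 hA
  rw [eigVal, dif_pos h.1]
  exact h.eigenvalues_nonneg j

lemma vnEntropy_eq {A : Matrix B B ℂ} (hA : A.IsHermitian) :
    vnEntropy A = ∑ j, Real.negMulLog (eigVal A j) := by
  rw [vnEntropy, hA.cfc_eq, IsHermitian.cfc, Unitary.conjStarAlgAut_apply, trace_mul_comm,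
    ← mul_assoc, Unitary.coe_star_mul_self, one_mul, trace_diagonal, Complex.re_sum]
  simp [eigVal, hA]

lemma conj_eigU {A : Matrix B B ℂ} (hA : A.IsHermitian) :
    (eigU A)ᴴ * A * eigU A = diagonal fun j => (eigVal A j : ℂ) := by
  calc _ = (eigU A)ᴴ * diagConj (eigU A) (eigVal A) * eigU A := by rw [diagConj_eig hA]
    _ = ((eigU A)ᴴ * eigU A) * diagonal (fun j => (eigVal A j : ℂ)) *
        ((eigU A)ᴴ * eigU A) := by simp only [diagConj, mul_assoc]
    _ = _ := by rw [eigU_mul', one_mul, mul_one]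

variable {n : ℕ}

/-- The spectral projection of a tensor product of Hermitian matrices on the joint eigenvectors
selected by `K`. -/
def specProj (A : Fin n → Matrix B B ℂ) (K : Set (Fin n → B)) :
    Matrix (Fin n → B) (Fin n → B) ℂ :=
  diagConj (tensor fun i => eigU (A i)) (K.indicator 1)

lemma tensorU_mul (A : Fin n → Matrix B B ℂ) :
    (tensor fun i => eigU (A i)) * (tensor fun i => eigU (A i))ᴴ = 1 := by
  rw [tensor_conjTranspose, tensor_mul]
  simp only [eigU_mul, tensor_one]

lemma tensorU_mul' (A : Fin n → Matrix B B ℂ) :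
    (tensor fun i => eigU (A i))ᴴ * (tensor fun i => eigU (A i)) = 1 := by
  rw [tensor_conjTranspose, tensor_mul]
  simp only [eigU_mul', tensor_one]

variable {A : Fin n → Matrix B B ℂ} {K : Set (Fin n → B)}

lemma specProj_isStarProjection : IsStarProjection (specProj A K) :=
  diagConj_isStarProjection (tensorU_mul' A) fun j => by
    by_cases h : j ∈ K <;> simp [h]

lemma tensor_eq_diagConj (hA : ∀ i, 0 ≤ A i) :
    tensor A = diagConj (tensor fun i => eigU (A i)) fun j => ∏ i, eigVal (A i) (j i) := by
  have e : A = fun i => eigU (A i) * diagonal (fun j => (eigVal (A i) j : ℂ)) * (eigU (A i))ᴴ := by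
    funext i
    exact (diagConj_eig (nonneg_iff_posSemidef.1 (hA i)).1).symm
  conv_lhs => rw [e]
  rw [← tensor_mul, ← tensor_mul, tensor_diagonal, diagConj, tensor_conjTranspose]
  simp

lemma specProj_le_smul (hA : ∀ i, 0 ≤ A i) {κ : ℝ} (hκ : 0 ≤ κ)
    (hK : ∀ j ∈ K, 1 ≤ κ * ∏ i, eigVal (A i) (j i)) : specProj A K ≤ κ • tensor A := by
  rw [tensor_eq_diagConj hA, ← diagConj_smul]
  refine diagConj_mono fun j => ?_
  by_cases h : j ∈ K
  · simpa [h] using hK j h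
  · simpa [h] using mul_nonneg hκ (Finset.prod_nonneg fun i _ => eigVal_nonneg (hA i) _)

lemma specProj_conj (hA : ∀ i, 0 ≤ A i) : specProj A K * tensor A * specProj A K =
    diagConj (tensor fun i => eigU (A i)) (K.indicator fun j => ∏ i, eigVal (A i) (j i)) := by
  rw [specProj, tensor_eq_diagConj hA, diagConj_mul (tensorU_mul' A),
    diagConj_mul (tensorU_mul' A)]
  congr 1; funext j
  by_cases h : j ∈ K <;> simp [h]

lemma specProj_conj_le (hA : ∀ i, 0 ≤ A i) : specProj A K * tensor A * specProj A K ≤ tensor A := by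
  rw [specProj_conj hA]
  conv_rhs => rw [tensor_eq_diagConj hA]
  refine diagConj_mono fun j => ?_
  by_cases h : j ∈ K
  · simp [h]
  · simpa [h] using Finset.prod_nonneg fun i _ => eigVal_nonneg (hA i) _

lemma specProj_conj_le_smul_one (hA : ∀ i, 0 ≤ A i) {l : ℝ} (hl : 0 ≤ l)
    (hK : ∀ j ∈ K, ∏ i, eigVal (A i) (j i) ≤ l) :
    specProj A K * tensor A * specProj A K ≤ l • (1 : Matrix (Fin n → B) (Fin n → B) ℂ) := by
  rw [specProj_conj hA, ← diagConj_one (tensorU_mul A), ← diagConj_smul]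
  refine diagConj_mono fun j => ?_
  by_cases h : j ∈ K
  · simpa [h] using hK j h
  · simpa [h] using hl

/-- The weight missed by a spectral projection, as a probability for the product of the distributions
that the states `σ i` induce on the eigenvectors. -/
lemma trRe_one_sub_specProj (σ : Fin n → Matrix B B ℂ) (hσ : ∀ i, 0 ≤ σ i) :
    trRe (1 - specProj A K) (tensor σ) = ∑ j, (Kᶜ).indicator
      (fun j => ∏ i, (((eigU (A i))ᴴ * σ i * eigU (A i)) (j i) (j i)).re) j := by
  have e : 1 - specProj A K = diagConj (tensor fun i => eigU (A i)) (Kᶜ.indicator 1) := by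
    rw [specProj, ← diagConj_one (tensorU_mul A), ← diagConj_sub]
    congr 1; funext j
    by_cases h : j ∈ K <;> simp [h]
  have hre : ∀ i b, (((eigU (A i))ᴴ * σ i * eigU (A i)) b b) =
      ((((eigU (A i))ᴴ * σ i * eigU (A i)) b b).re : ℂ) := by
    intro i b
    have := ((nonneg_iff_posSemidef.1 (hσ i)).conjTranspose_mul_mul_same (eigU (A i))).diag_nonneg
      (i := b)
    exact Complex.ext rfl (Complex.nonneg_iff.1 this).2.symm
  rw [e, trRe_diagConj]
  refine Finset.sum_congr rfl fun j _ => ?_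
  rw [tensor_conjTranspose, tensor_mul, tensor_mul, tensor_apply]
  rw [Finset.prod_congr rfl fun i _ => hre i (j i), ← Complex.ofReal_prod, Complex.ofReal_re]
  by_cases h : j ∈ K <;> simp [h]

end Spectral

/-! ### Large deviations -/

section Tails

/-- The Chernoff bound for finitely supported variables: a sum of independent copies of a variable
with negative mean is unlikely to be nonnegative. -/
lemma tendsto_chernoff {Z : Type*} [Fintype Z] {Q ψ : Z → ℝ} (h0 : ∀ z, 0 ≤ Q z)
    (h1 : ∑ z, Q z = 1) (hψ : ∑ z, Q z * ψ z < 0) :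
    Tendsto (fun n : ℕ => ∑ z : Fin n → Z,
      {z : Fin n → Z | 0 ≤ ∑ i, ψ (z i)}.indicator (fun z => ∏ i, Q (z i)) z) atTop (𝓝 0) := by
  have hder : HasDerivAt (fun t : ℝ => ∑ z, Q z * Real.exp (t * ψ z)) (∑ z, Q z * ψ z) 0 := by
    have : ∀ z ∈ Finset.univ, HasDerivAt (fun t : ℝ => Q z * Real.exp (t * ψ z)) (Q z * ψ z) 0 := by
      intro z _
      have h := ((hasDerivAt_id (0 : ℝ)).mul_const (ψ z)).exp.const_mul (Q z)
      simpa using h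
    simpa using HasDerivAt.fun_sum this
  -- the moment generating function is below `1` at some `t > 0`
  obtain ⟨t, ht0, ht⟩ : ∃ t : ℝ, 0 < t ∧ ∑ z, Q z * Real.exp (t * ψ z) < 1 := by
    have hs := (hasDerivAt_iff_tendsto_slope.1 hder).eventually_lt_const hψ
    have hs' : ∀ᶠ t in 𝓝[>] (0 : ℝ),
        slope (fun t : ℝ => ∑ z, Q z * Real.exp (t * ψ z)) 0 t < 0 :=
      hs.filter_mono (nhdsWithin_mono _ fun t (ht : 0 < t) => ht.ne')
    obtain ⟨t, ht, ht0⟩ := (hs'.and self_mem_nhdsWithin).exists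
    refine ⟨t, ht0, ?_⟩
    have ht0' : (0 : ℝ) < t := ht0
    rw [slope_def_field, sub_zero, div_neg_iff] at ht
    rcases ht with ht | ht
    · exact absurd ht.2 (not_lt.2 ht0'.le)
    · have := ht.1
      simp only [zero_mul, Real.exp_zero, mul_one, h1] at this
      linarith
  set r := ∑ z, Q z * Real.exp (t * ψ z) with hr
  have hr0 : 0 ≤ r := Finset.sum_nonneg fun z _ => mul_nonneg (h0 z) (Real.exp_nonneg _)
  refine squeeze_zero (fun n => ?_) (fun n => ?_) (tendsto_pow_atTop_nhds_zero_of_lt_one hr0 ht)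
  · exact Finset.sum_nonneg fun z _ => Set.indicator_nonneg
      (fun z _ => Finset.prod_nonneg fun i _ => h0 _) z
  · have e : r ^ n = ∑ z : Fin n → Z, ∏ i, (Q (z i) * Real.exp (t * ψ (z i))) := by
      rw [hr, Fintype.sum_pow]
    rw [e]
    refine Finset.sum_le_sum fun z _ => ?_
    have hp : 0 ≤ ∏ i, Q (z i) := Finset.prod_nonneg fun i _ => h0 _
    rw [Finset.prod_mul_distrib, ← Real.exp_sum, ← Finset.mul_sum]
    by_cases hz : z ∈ {z : Fin n → Z | 0 ≤ ∑ i, ψ (z i)}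
    · rw [Set.indicator_of_mem hz]
      exact le_mul_of_one_le_right hp (Real.one_le_exp (mul_nonneg ht0.le hz))
    · rw [Set.indicator_of_notMem hz]
      exact mul_nonneg hp (Real.exp_nonneg _)

variable {Ω B C : Type*} [Fintype Ω] [Fintype B] [DecidableEq B] [Fintype C] [DecidableEq C]

/-- The states `σ ω`, `ω` distributed according to `P`, average to `A a` given the label
`c ω = a`. -/
structure IsLabelAverage (P : Ω → ℝ) (σ : Ω → Matrix B B ℂ) (c : Ω → C)
    (A : C → Matrix B B ℂ) : Prop where
  prob_nonneg : ∀ ω, 0 ≤ P ω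
  prob_sum : ∑ ω, P ω = 1
  state_nonneg : ∀ ω, 0 ≤ σ ω
  state_trace : ∀ ω, (σ ω).trace = 1
  average_nonneg : ∀ a, 0 ≤ A a
  average_eq : ∀ a, (∑ ω, if c ω = a then P ω • σ ω else 0) = marginal P c a • A a

variable {P : Ω → ℝ} {σ : Ω → Matrix B B ℂ} {c : Ω → C} {A : C → Matrix B B ℂ}

/-- The probability of the eigenvector `j` of `A (c ω)` in the state `σ ω`. -/
def eigProb (A : C → Matrix B B ℂ) (c : Ω → C) (σ : Ω → Matrix B B ℂ) (ω : Ω) (j : B) : ℝ :=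
  (((eigU (A (c ω)))ᴴ * σ ω * eigU (A (c ω))) j j).re

namespace IsLabelAverage

lemma eigProb_nonneg (h : IsLabelAverage P σ c A) (ω : Ω) (j : B) : 0 ≤ eigProb A c σ ω j :=
  (Complex.nonneg_iff.1 (((nonneg_iff_posSemidef.1 (h.state_nonneg ω)).conjTranspose_mul_mul_same
    (eigU (A (c ω)))).diag_nonneg (i := j))).1

lemma eigProb_sum (h : IsLabelAverage P σ c A) (ω : Ω) : ∑ j, eigProb A c σ ω j = 1 := by
  have : (((eigU (A (c ω)))ᴴ * σ ω * eigU (A (c ω)))).trace = 1 := by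
    rw [trace_mul_comm, ← mul_assoc, eigU_mul, one_mul, h.state_trace]
  have h2 := congrArg Complex.re this
  simpa [trace, eigProb] using h2

/-- Given the label, the eigenvector distributions of the states average to the eigenvalues. -/
lemma sum_label (h : IsLabelAverage P σ c A) (a : C) (j : B) :
    (∑ ω, if c ω = a then P ω * eigProb A c σ ω j else 0) = marginal P c a * eigVal (A a) j := by
  have h1 := congrArg (fun M => (((eigU (A a))ᴴ * M * eigU (A a)) j j).re) (h.average_eq a)
  rw [mul_smul_comm, smul_mul_assoc, conj_eigU (nonneg_iff_posSemidef.1 (h.average_nonneg a)).1]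
    at h1
  simp only [Matrix.smul_apply, diagonal_apply_eq, Complex.real_smul, ← Complex.ofReal_mul,
    Complex.ofReal_re] at h1
  rw [← h1, Finset.mul_sum, Finset.sum_mul, Matrix.sum_apply, Complex.re_sum]
  refine Finset.sum_congr rfl fun ω _ => ?_
  split_ifs with hω
  · subst hω
    simp [eigProb]
  · simp

lemma sum_mul_label (h : IsLabelAverage P σ c A) (ψ : C → B → ℝ) :
    ∑ z : Ω × B, (P z.1 * eigProb A c σ z.1 z.2) * ψ (c z.1) z.2 =
      ∑ a, marginal P c a * ∑ j, eigVal (A a) j * ψ a j := by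
  have e : ∀ a j, marginal P c a * (eigVal (A a) j * ψ a j) =
      ∑ ω, if c ω = a then P ω * eigProb A c σ ω j * ψ (c ω) j else 0 := by
    intro a j
    rw [← mul_assoc, ← h.sum_label, Finset.sum_mul]
    refine Finset.sum_congr rfl fun ω _ => ?_
    split_ifs with hω
    · rw [hω]
    · simp
  simp only [Finset.mul_sum, e]
  symm
  calc _ = ∑ a, ∑ ω, ∑ j, (if c ω = a then P ω * eigProb A c σ ω j * ψ (c ω) j else 0) :=
        Finset.sum_congr rfl fun a _ => Finset.sum_comm
    _ = ∑ ω, ∑ a, ∑ j, (if c ω = a then P ω * eigProb A c σ ω j * ψ (c ω) j else 0) :=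
        Finset.sum_comm
    _ = ∑ ω, ∑ j, ∑ a, (if c ω = a then P ω * eigProb A c σ ω j * ψ (c ω) j else 0) :=
        Finset.sum_congr rfl fun a _ => Finset.sum_comm
    _ = _ := by simp [Fintype.sum_prod_type]

lemma marginal_sum (h : IsLabelAverage P σ c A) : ∑ a, marginal P c a = 1 := by
  simp only [marginal]
  rw [Finset.sum_comm]
  simp [h.prob_sum]

lemma marginal_mul_sum_eigVal (h : IsLabelAverage P σ c A) (a : C) :
    marginal P c a * ∑ j, eigVal (A a) j = marginal P c a := by
  rw [Finset.mul_sum]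
  simp only [← h.sum_label]
  rw [Finset.sum_comm, marginal]
  refine Finset.sum_congr rfl fun ω _ => ?_
  split_ifs
  · rw [← Finset.mul_sum, h.eigProb_sum, mul_one]
  · simp

/-- The probability that the eigenvalues of the tensor products of the averages `A` deviate from
their mean in the direction tested by `ψ` tends to zero. -/
lemma tendsto_tail (h : IsLabelAverage P σ c A) (ψ : C → B → ℝ)
    (hψ : ∑ a, marginal P c a * ∑ j, eigVal (A a) j * ψ a j < 0)
    (K : ∀ n, (Fin n → C) → Set (Fin n → B))
    (hK : ∀ n a j, j ∉ K n a → (∏ i, eigVal (A (a i)) (j i) = 0) ∨ 0 ≤ ∑ i, ψ (a i) (j i)) :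
    Tendsto (fun n => ∑ ω : Fin n → Ω, (∏ i, P (ω i)) *
      trRe (1 - specProj (fun i => A (c (ω i))) (K n fun i => c (ω i))) (tensor fun i => σ (ω i)))
      atTop (𝓝 0) := by
  have hQ0 : ∀ z : Ω × B, 0 ≤ P z.1 * eigProb A c σ z.1 z.2 := fun z =>
    mul_nonneg (h.prob_nonneg _) (h.eigProb_nonneg _ _)
  have hQ1 : ∑ z : Ω × B, P z.1 * eigProb A c σ z.1 z.2 = 1 := by
    rw [Fintype.sum_prod_type]
    simp only [← Finset.mul_sum, h.eigProb_sum, mul_one, h.prob_sum]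
  have hch := tendsto_chernoff (ψ := fun z : Ω × B => ψ (c z.1) z.2) hQ0 hQ1
    (by rw [h.sum_mul_label]; exact hψ)
  -- eigenvectors in the kernel of the mean state have probability zero
  have hzero : ∀ ω j, eigVal (A (c ω)) j = 0 → P ω * eigProb A c σ ω j = 0 := by
    intro ω j hj
    have h1 := h.sum_label (c ω) j
    rw [hj, mul_zero, Finset.sum_eq_zero_iff_of_nonneg] at h1
    · simpa using h1 ω (Finset.mem_univ _)
    · intro ω' _
      split_ifs
      · exact hQ0 (ω', j)
      · exact le_rfl
  refine squeeze_zero (fun n => ?_) (fun n => ?_) hch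
  · exact Finset.sum_nonneg fun ω _ => mul_nonneg (Finset.prod_nonneg fun i _ => h.prob_nonneg _) <|
      trRe_nonneg (compl_nonneg specProj_isStarProjection)
        (tensor_nonneg fun i => h.state_nonneg _)
  · rw [← (Equiv.arrowProdEquivProdArrow (Fin n) (fun _ => Ω) (fun _ => B)).symm.sum_comp,
      Fintype.sum_prod_type]
    refine Finset.sum_le_sum fun ω _ => ?_
    rw [trRe_one_sub_specProj _ fun i => h.state_nonneg _, Finset.mul_sum]
    refine Finset.sum_le_sum fun j _ => ?_
    have hp : 0 ≤ ∏ i, (P (ω i) * eigProb A c σ (ω i) (j i)) :=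
      Finset.prod_nonneg fun i _ => hQ0 (ω i, j i)
    have hrhs : 0 ≤ {z : Fin n → Ω × B | 0 ≤ ∑ i, ψ (c (z i).1) (z i).2}.indicator
        (fun z => ∏ i, P (z i).1 * eigProb A c σ (z i).1 (z i).2) fun i => (ω i, j i) :=
      Set.indicator_nonneg (fun z _ => Finset.prod_nonneg fun i _ => hQ0 _) _
    by_cases hj : j ∈ K n fun i => c (ω i)
    · rw [Set.indicator_of_notMem (s := (K n fun i => c (ω i))ᶜ) (fun hc => hc hj), mul_zero]
      exact hrhs
    · rw [Set.indicator_of_mem (s := (K n fun i => c (ω i))ᶜ) hj]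
      have e : (∏ i, P (ω i)) * ∏ i, (((eigU (A (c (ω i))))ᴴ * σ (ω i) *
          eigU (A (c (ω i)))) (j i) (j i)).re = ∏ i, (P (ω i) * eigProb A c σ (ω i) (j i)) := by
        rw [Finset.prod_mul_distrib]; rfl
      rw [e]
      rcases hK n _ j hj with h0 | h0
      · obtain ⟨i, _, hi⟩ := Finset.prod_eq_zero_iff.1 h0
        rw [Finset.prod_eq_zero (Finset.mem_univ i) (hzero _ _ hi)]
        exact hrhs
      · exact (Set.indicator_of_mem (s := {z : Fin n → Ω × B |
          0 ≤ ∑ i, ψ (c (z i).1) (z i).2}) (a := fun i => (ω i, j i)) h0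
          (fun z => ∏ i, P (z i).1 * eigProb A c σ (z i).1 (z i).2)).ge

/-- The mean log eigenvalue is minus the conditional entropy of `B` given the label. -/
lemma sum_eigVal_mul_log (h : IsLabelAverage P σ c A) :
    ∑ a, marginal P c a * ∑ j, eigVal (A a) j * Real.log (eigVal (A a) j) =
      - ∑ a, marginal P c a * vnEntropy (A a) := by
  rw [← Finset.sum_neg_distrib]
  refine Finset.sum_congr rfl fun a _ => ?_
  rw [vnEntropy_eq (nonneg_iff_posSemidef.1 (h.average_nonneg a)).1, ← mul_neg,
    ← Finset.sum_neg_distrib]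
  simp [Real.negMulLog]

/-- The eigenvectors whose eigenvalue is at most `l`. -/
def lowSet {n : ℕ} (A : Fin n → Matrix B B ℂ) (l : ℝ) : Set (Fin n → B) :=
  {j | ∏ i, eigVal (A i) (j i) ≤ l}

/-- The eigenvectors whose eigenvalue is at least `κ⁻¹`. -/
def highSet {n : ℕ} (A : Fin n → Matrix B B ℂ) (κ : ℝ) : Set (Fin n → B) :=
  {j | 1 ≤ κ * ∏ i, eigVal (A i) (j i)}

lemma log_prod_eigVal {n : ℕ} {a : Fin n → C} {j : Fin n → B}
    (hne : ∏ i, eigVal (A (a i)) (j i) ≠ 0) :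
    Real.log (∏ i, eigVal (A (a i)) (j i)) = ∑ i, Real.log (eigVal (A (a i)) (j i)) :=
  Real.log_prod fun i _ => Finset.prod_ne_zero_iff.1 hne i (Finset.mem_univ i)

/-- The eigenvalues of the mean states are at most `exp (-n (H - δ))` with high probability, where `H`
is the conditional entropy given the label. -/
lemma tendsto_low (h : IsLabelAverage P σ c A) {δ : ℝ} (hδ : 0 < δ) :
    Tendsto (fun n : ℕ => ∑ ω : Fin n → Ω, (∏ i, P (ω i)) *
      trRe (1 - specProj (fun i => A (c (ω i))) (lowSet (fun i => A (c (ω i)))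
        (Real.exp (-(n * ((∑ a, marginal P c a * vnEntropy (A a)) - δ))))))
        (tensor fun i => σ (ω i))) atTop (𝓝 0) := by
  set H := ∑ a, marginal P c a * vnEntropy (A a) with hH
  refine h.tendsto_tail (fun a j => Real.log (eigVal (A a) j) + (H - δ)) ?_
    (fun n a => lowSet (fun i => A (a i)) (Real.exp (-(n * (H - δ))))) ?_
  · simp only [mul_add, Finset.sum_add_distrib, ← Finset.sum_mul]
    rw [h.sum_eigVal_mul_log]
    simp only [← mul_assoc, h.marginal_mul_sum_eigVal, ← Finset.sum_mul, h.marginal_sum]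
    linarith
  · intro n a j hj
    by_cases h0 : ∏ i, eigVal (A (a i)) (j i) = 0
    · exact Or.inl h0
    · right
      have hj' : Real.exp (-(n * (H - δ))) < ∏ i, eigVal (A (a i)) (j i) := not_le.1 hj
      have := Real.log_lt_log (Real.exp_pos _) hj'
      rw [Real.log_exp, log_prod_eigVal h0] at this
      rw [Finset.sum_add_distrib]
      simp only [Finset.sum_const, Finset.card_univ, Fintype.card_fin, nsmul_eq_mul]
      linarith

/-- The eigenvalues of the mean states are at least `exp (-n (H + δ))` with high probability, where `H`
is the conditional entropy given the label. -/
lemma tendsto_high (h : IsLabelAverage P σ c A) {δ : ℝ} (hδ : 0 < δ) :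
    Tendsto (fun n : ℕ => ∑ ω : Fin n → Ω, (∏ i, P (ω i)) *
      trRe (1 - specProj (fun i => A (c (ω i))) (highSet (fun i => A (c (ω i)))
        (Real.exp (n * ((∑ a, marginal P c a * vnEntropy (A a)) + δ)))))
        (tensor fun i => σ (ω i))) atTop (𝓝 0) := by
  set H := ∑ a, marginal P c a * vnEntropy (A a) with hH
  refine h.tendsto_tail (fun a j => -Real.log (eigVal (A a) j) - (H + δ)) ?_
    (fun n a => highSet (fun i => A (a i)) (Real.exp (n * (H + δ)))) ?_
  · simp only [mul_sub, Finset.sum_sub_distrib, ← Finset.sum_mul, mul_neg, Finset.sum_neg_distrib]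
    rw [h.sum_eigVal_mul_log]
    simp only [← mul_assoc, h.marginal_mul_sum_eigVal, ← Finset.sum_mul, h.marginal_sum]
    linarith
  · intro n a j hj
    by_cases h0 : ∏ i, eigVal (A (a i)) (j i) = 0
    · exact Or.inl h0
    · right
      have hj' : Real.exp (n * (H + δ)) * ∏ i, eigVal (A (a i)) (j i) < 1 := not_le.1 hj
      have hpos : 0 < ∏ i, eigVal (A (a i)) (j i) :=
        lt_of_le_of_ne (Finset.prod_nonneg fun i _ => eigVal_nonneg (h.average_nonneg _) _)
          (Ne.symm h0)
      have := Real.log_lt_log (mul_pos (Real.exp_pos _) hpos) hj'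
      rw [Real.log_mul (Real.exp_pos _).ne' h0, Real.log_exp, Real.log_one,
        log_prod_eigVal h0] at this
      rw [Finset.sum_sub_distrib, Finset.sum_neg_distrib]
      simp only [Finset.sum_const, Finset.card_univ, Fintype.card_fin, nsmul_eq_mul]
      linarith

end IsLabelAverage

end Tails

/-! ### Entropies of classical-quantum states -/

section Entropy

variable {B : Type*} [Fintype B] [DecidableEq B]

lemma diagConj_isHermitian (W : Matrix B B ℂ) (x : B → ℝ) : (diagConj W x).IsHermitian := by
  rw [IsHermitian, diagConj, conjTranspose_mul, conjTranspose_mul, conjTranspose_conjTranspose,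
    diagonal_conjTranspose, mul_assoc]
  congr 3
  funext j
  simp

/-- The entropy may be computed in any orthonormal basis of eigenvectors. -/
lemma vnEntropy_diagConj {W : Matrix B B ℂ} (hW : Wᴴ * W = 1) (x : B → ℝ) :
    vnEntropy (diagConj W x) = ∑ j, Real.negMulLog (x j) := by
  have hA := diagConj_isHermitian W x
  have h1 := hA.roots_charpoly_eq_eigenvalues
  have hc : (diagConj W x).charpoly = (diagonal fun j => (x j : ℂ)).charpoly := by
    rw [diagConj, charpoly_mul_comm, ← mul_assoc, hW, one_mul]
  have h2 : (diagonal fun j => (x j : ℂ)).charpoly.roots =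
      Multiset.map (fun j => (x j : ℂ)) Finset.univ.val := by
    rw [charpoly_diagonal, Polynomial.roots_prod]
    · simp
    · simp [Finset.prod_ne_zero_iff, Polynomial.X_sub_C_ne_zero]
  rw [hc, h2] at h1
  have h3 := congrArg (fun m => (m.map fun z : ℂ => Real.negMulLog z.re).sum) h1
  simp only [Multiset.map_map] at h3
  rw [vnEntropy_eq hA]
  simpa [eigVal, hA, Function.comp_def] using h3.symm

lemma vnEntropy_smul {A : Matrix B B ℂ} (hA : A.IsHermitian) (t : ℝ) :
    vnEntropy (t • A) = t * vnEntropy A + Real.negMulLog t * A.trace.re := by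
  have htr : A.trace.re = ∑ j, eigVal A j := by
    rw [hA.trace_eq_sum_eigenvalues, Complex.re_sum]
    simp [eigVal, hA]
  have e : t • A = diagConj (eigU A) (t • eigVal A) := by rw [diagConj_smul, diagConj_eig hA]
  rw [e, vnEntropy_diagConj (eigU_mul' A), vnEntropy_eq hA, htr, Finset.mul_sum, Finset.mul_sum,
    ← Finset.sum_add_distrib]
  refine Finset.sum_congr rfl fun j _ => ?_
  rw [Pi.smul_apply, smul_eq_mul, Real.negMulLog_mul]
  ring

/-- The entropy of a classical-quantum state is the sum of the entropies of its blocks. -/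
lemma vnEntropy_blockDiagonal {C : Type*} [Fintype C] [DecidableEq C] {M : C → Matrix B B ℂ}
    (hM : ∀ a, (M a).IsHermitian) : vnEntropy (blockDiagonal M) = ∑ a, vnEntropy (M a) := by
  have e : blockDiagonal M = diagConj (blockDiagonal fun a => eigU (M a))
      (fun j : B × C => eigVal (M j.2) j.1) := by
    have : diagonal (fun j : B × C => (eigVal (M j.2) j.1 : ℂ)) =
        blockDiagonal fun a => diagonal fun j => (eigVal (M a) j : ℂ) := by
      rw [blockDiagonal_diagonal]
    rw [diagConj, this, blockDiagonal_conjTranspose, ← blockDiagonal_mul, ← blockDiagonal_mul]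
    congr 1; funext a
    exact (diagConj_eig (hM a)).symm
  have hW : (blockDiagonal fun a => eigU (M a))ᴴ * (blockDiagonal fun a => eigU (M a)) = 1 := by
    rw [blockDiagonal_conjTranspose, ← blockDiagonal_mul]
    simp only [eigU_mul']
    exact blockDiagonal_one
  rw [e, vnEntropy_diagConj hW, Fintype.sum_prod_type, Finset.sum_comm]
  exact Finset.sum_congr rfl fun a _ => (vnEntropy_eq (hM a)).symm

/-- The entropy of the normalized state `R / Tr R`, times `Tr R`: the contribution of an
unnormalized state `R` to a conditional entropy. -/
def weightedEntropy (R : Matrix B B ℂ) : ℝ := vnEntropy R - Real.negMulLog R.trace.re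

lemma weightedEntropy_smul {A : Matrix B B ℂ} (hA : A.IsHermitian) (t : ℝ) :
    weightedEntropy (t • A) = t * weightedEntropy A := by
  have : (t • A).trace.re = t * A.trace.re := by simp
  rw [weightedEntropy, weightedEntropy, vnEntropy_smul hA, this, Real.negMulLog_mul]
  ring

lemma weightedEntropy_of_trace_one {A : Matrix B B ℂ} (hA : A.trace = 1) :
    weightedEntropy A = vnEntropy A := by
  simp [weightedEntropy, hA]

variable {Ω C D : Type*} [Fintype Ω] [Fintype C] [DecidableEq C] [Fintype D] [DecidableEq D]

/-- The unnormalized state of `B` belonging to the value `a` of the label `c`. -/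
def labelSum (P : Ω → ℝ) (σ : Ω → Matrix B B ℂ) (c : Ω → C) (a : C) : Matrix B B ℂ :=
  ∑ ω, if c ω = a then P ω • σ ω else 0

/-- The conditional entropy `H(B | c)`. -/
def condEntropyB (P : Ω → ℝ) (σ : Ω → Matrix B B ℂ) (c : Ω → C) : ℝ :=
  ∑ a, weightedEntropy (labelSum P σ c a)

variable {P : Ω → ℝ} {σ : Ω → Matrix B B ℂ}

lemma labelSum_isHermitian (hσ : ∀ ω, 0 ≤ σ ω) (c : Ω → C) (a : C) :
    (labelSum P σ c a).IsHermitian := by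
  have : ∀ ω, IsSelfAdjoint (if c ω = a then P ω • σ ω else 0) := by
    intro ω
    split_ifs
    · exact (IsSelfAdjoint.all (P ω)).smul (IsSelfAdjoint.of_nonneg (hσ ω))
    · exact .zero _
  exact isSelfAdjoint_sum _ fun ω _ => this ω

lemma labelSum_trace (hσ1 : ∀ ω, (σ ω).trace = 1) (c : Ω → C) (a : C) :
    (labelSum P σ c a).trace.re = marginal P c a := by
  rw [labelSum, trace_sum, Complex.re_sum, marginal]
  refine Finset.sum_congr rfl fun ω _ => ?_
  split_ifs <;> simp [hσ1]

lemma cqReduced_eq (c : Ω → C) : cqReduced P σ c = blockDiagonal (labelSum P σ c) := by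
  unfold cqReduced labelSum
  congr 1

lemma vnEntropy_cqReduced (hσ : ∀ ω, 0 ≤ σ ω) (hσ1 : ∀ ω, (σ ω).trace = 1) (c : Ω → C) :
    vnEntropy (cqReduced P σ c) = entropy P c + condEntropyB P σ c := by
  rw [cqReduced_eq, vnEntropy_blockDiagonal (labelSum_isHermitian hσ c), entropy, condEntropyB,
    ← Finset.sum_add_distrib]
  refine Finset.sum_congr rfl fun a _ => ?_
  rw [weightedEntropy, labelSum_trace hσ1]
  ring

/-- `I(c; B | d) = H(B | d) - H(B | c d)` -/
lemma cqCondMutualInfo_eq (hσ : ∀ ω, 0 ≤ σ ω) (hσ1 : ∀ ω, (σ ω).trace = 1) (c : Ω → C)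
    (d : Ω → D) : cqCondMutualInfo P σ c d =
      condEntropyB P σ d - condEntropyB P σ fun ω => (c ω, d ω) := by
  rw [cqCondMutualInfo, vnEntropy_cqReduced hσ hσ1, vnEntropy_cqReduced hσ hσ1]
  ring

/-- `I(c; B) = H(B) - H(B | c)` -/
lemma cqMutualInfo_eq (hσ : ∀ ω, 0 ≤ σ ω) (hσ1 : ∀ ω, (σ ω).trace = 1) (c : Ω → C) :
    cqMutualInfo P σ c = vnEntropy (cqAverage P σ) - condEntropyB P σ c := by
  rw [cqMutualInfo, vnEntropy_cqReduced hσ hσ1]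
  ring

lemma IsLabelAverage.condEntropyB_eq {c : Ω → C} {A : C → Matrix B B ℂ}
    (h : IsLabelAverage P σ c A) :
    condEntropyB P σ c = ∑ a, marginal P c a * vnEntropy (A a) := by
  refine Finset.sum_congr rfl fun a _ => ?_
  have h1 : labelSum P σ c a = marginal P c a • A a := h.average_eq a
  have h2 := labelSum_trace (P := P) h.state_trace c a
  rw [h1, weightedEntropy_smul (nonneg_iff_posSemidef.1 (h.average_nonneg a)).1]
  by_cases h0 : marginal P c a = 0
  · simp [h0]
  · rw [h1] at h2
    have h3 : (A a).trace.re = 1 := by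
      have : marginal P c a * (A a).trace.re = marginal P c a * 1 := by
        rw [mul_one]; simpa using h2
      exact mul_left_cancel₀ h0 this
    simp [weightedEntropy, h3]

end Entropy

/-! ### The joint distribution of a single use of the channel -/

section Factor

variable {B Ω C : Type*} [Fintype B] [DecidableEq B] [Fintype Ω] [Fintype C] [DecidableEq C]

/-- If the label determines the state, conditioning on it leaves the average entropy of the
states. -/
lemma condEntropyB_of_factor {P : Ω → ℝ} {σ : Ω → Matrix B B ℂ} (hσ : ∀ ω, 0 ≤ σ ω)
    (hσ1 : ∀ ω, (σ ω).trace = 1) (c : Ω → C) (τ : C → Matrix B B ℂ) (h : ∀ ω, σ ω = τ (c ω)) :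
    condEntropyB P σ c = ∑ ω, P ω * vnEntropy (σ ω) := by
  have h1 : ∀ a, weightedEntropy (labelSum P σ c a) =
      ∑ ω, if c ω = a then P ω * vnEntropy (σ ω) else 0 := by
    intro a
    by_cases ha : ∃ ω, c ω = a
    · obtain ⟨ω₀, hω₀⟩ := ha
      have e : labelSum P σ c a = marginal P c a • σ ω₀ := by
        rw [labelSum, marginal, Finset.sum_smul]
        refine Finset.sum_congr rfl fun ω _ => ?_
        split_ifs with hω
        · rw [h ω, hω, h ω₀, hω₀]
        · simp
      rw [e, weightedEntropy_smul (nonneg_iff_posSemidef.1 (hσ ω₀)).1,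
        weightedEntropy_of_trace_one (hσ1 ω₀), marginal, Finset.sum_mul]
      refine Finset.sum_congr rfl fun ω _ => ?_
      split_ifs with hω
      · rw [h ω, hω, h ω₀, hω₀]
      · simp
    · push Not at ha
      simp [labelSum, ha, weightedEntropy, vnEntropy]
  rw [condEntropyB]
  simp only [h1]
  rw [Finset.sum_comm]
  simp

/-- The unnormalized mean states `m a • A a` determine an `IsLabelAverage`; the states `A a` need not
have trace one at labels of probability zero. -/
lemma isLabelAverage_of {P : Ω → ℝ} {σ : Ω → Matrix B B ℂ} {c : Ω → C}
    {A : C → Matrix B B ℂ} (hP : ∀ ω, 0 ≤ P ω) (hP1 : ∑ ω, P ω = 1) (hσ : ∀ ω, 0 ≤ σ ω)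
    (hσ1 : ∀ ω, (σ ω).trace = 1) (hA : ∀ a, 0 ≤ A a) (m : C → ℝ)
    (hm : ∀ a, labelSum P σ c a = m a • A a) (hA1 : ∀ a, m a ≠ 0 → (A a).trace.re = 1) :
    IsLabelAverage P σ c A := by
  refine ⟨hP, hP1, hσ, hσ1, hA, fun a => ?_⟩
  have h1 := labelSum_trace (P := P) hσ1 c a
  rw [hm a] at h1
  have h2 : m a = marginal P c a := by
    by_cases h0 : m a = 0
    · rw [← h1, h0]; simp
    · rw [← h1]; simp [hA1 a h0]
  rw [← h2]
  exact hm a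

end Factor

section Joint

variable {U V S X₁ X₂ B : Type*} {k : ℕ}

/-- The distribution of `(u, v, s, x₁, x₂)`. -/
def jointDist (p : U × V → ℝ) (pS : S → ℝ) (q₁ : U → S → X₁ → ℝ) (q₂ : V → S → X₂ → ℝ) :
    U × V × S × X₁ × X₂ → ℝ :=
  fun ω => p (ω.1, ω.2.1) * pS ω.2.2.1 * q₁ ω.1 ω.2.2.1 ω.2.2.2.1 * q₂ ω.2.1 ω.2.2.1 ω.2.2.2.2

/-- The channel output for `(u, v, s, x₁, x₂)`. -/
def jointState (ρ : X₁ → X₂ → Matrix B B ℂ) : U × V × S × X₁ × X₂ → Matrix B B ℂ :=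
  fun ω => ρ ω.2.2.2.1 ω.2.2.2.2

/-- The common part `w = f u` restored to the tuple. -/
def withCommon (f : U → Fin k) (ω : U × V × S × X₁ × X₂) : U × V × Fin k × S × X₁ × X₂ :=
  (ω.1, ω.2.1, f ω.1, ω.2.2.1, ω.2.2.2.1, ω.2.2.2.2)

variable [Fintype U] [Fintype V] [Fintype S] [Fintype X₁] [Fintype X₂]
  {p : U × V → ℝ} {f : U → Fin k} {g : V → Fin k} {pS : S → ℝ} {q₁ : U → S → X₁ → ℝ}
  {q₂ : V → S → X₂ → ℝ}

/-- The coordinate `w` is determined by the others almost surely and can be dropped. -/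
lemma sum_codeDist {M : Type*} [AddCommGroup M] [Module ℝ M]
    (hfg : ∀ u v, p (u, v) ≠ 0 → f u = g v) (F : U × V × Fin k × S × X₁ × X₂ → M) :
    ∑ ω, codeDist p f g pS q₁ q₂ ω • F ω =
      ∑ ω, jointDist p pS q₁ q₂ ω • F (withCommon f ω) := by
  rw [Fintype.sum_prod_type, Fintype.sum_prod_type]
  refine Finset.sum_congr rfl fun u _ => ?_
  rw [Fintype.sum_prod_type, Fintype.sum_prod_type]
  refine Finset.sum_congr rfl fun v _ => ?_
  rw [Fintype.sum_prod_type]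
  by_cases hp : p (u, v) = 0
  · simp [codeDist, jointDist, hp]
  · rw [Finset.sum_eq_single (f u)]
    · refine Finset.sum_congr rfl fun ω _ => ?_
      simp [codeDist, jointDist, withCommon, hfg u v hp]
    · intro w _ hw
      simp [codeDist, hw.symm]
    · simp

lemma marginal_eq_sum {Ω C : Type*} [Fintype Ω] [DecidableEq C] (P : Ω → ℝ) (c : Ω → C) (a : C) :
    marginal P c a = ∑ ω, P ω • (if c ω = a then (1 : ℝ) else 0) := by
  simp [marginal]

variable [Fintype B] [DecidableEq B]

lemma labelSum_eq_sum {Ω C : Type*} [Fintype Ω] [DecidableEq C] (P : Ω → ℝ)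
    (σ : Ω → Matrix B B ℂ) (c : Ω → C) (a : C) :
    labelSum P σ c a = ∑ ω, P ω • (if c ω = a then σ ω else 0) := by
  simp [labelSum]

variable {ρ : X₁ → X₂ → Matrix B B ℂ}

section

variable {C D : Type*} [Fintype C] [DecidableEq C] [Fintype D] [DecidableEq D]

lemma marginal_codeDist (hfg : ∀ u v, p (u, v) ≠ 0 → f u = g v)
    (c : U × V × Fin k × S × X₁ × X₂ → C) (a : C) :
    marginal (codeDist p f g pS q₁ q₂) c a =
      marginal (jointDist p pS q₁ q₂) (fun ω => c (withCommon f ω)) a := by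
  rw [marginal_eq_sum, marginal_eq_sum, sum_codeDist hfg]

lemma entropy_codeDist (hfg : ∀ u v, p (u, v) ≠ 0 → f u = g v)
    (c : U × V × Fin k × S × X₁ × X₂ → C) :
    entropy (codeDist p f g pS q₁ q₂) c =
      entropy (jointDist p pS q₁ q₂) (fun ω => c (withCommon f ω)) := by
  simp only [entropy, marginal_codeDist hfg]

lemma condEntropyB_codeDist (hfg : ∀ u v, p (u, v) ≠ 0 → f u = g v)
    (c : U × V × Fin k × S × X₁ × X₂ → C) :
    condEntropyB (codeDist p f g pS q₁ q₂) (codeState ρ) c =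
      condEntropyB (jointDist p pS q₁ q₂) (jointState ρ) (fun ω => c (withCommon f ω)) := by
  simp only [condEntropyB, labelSum_eq_sum]
  simp only [sum_codeDist hfg]
  rfl

lemma cqAverage_codeDist (hfg : ∀ u v, p (u, v) ≠ 0 → f u = g v) :
    cqAverage (codeDist p f g pS q₁ q₂) (codeState ρ) =
    ∑ ω, jointDist p pS q₁ q₂ ω • jointState ρ ω := by
  have : cqAverage (codeDist p f g pS q₁ q₂) (codeState ρ) =
      ∑ ω, codeDist p f g pS q₁ q₂ ω • codeState ρ ω := rfl
  rw [this, sum_codeDist hfg]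
  rfl

end

end Joint

/-! ### The information inequalities as functions of the distribution of `s` -/

section Reduction

variable {U V S X₁ X₂ B : Type*} [Fintype U] [Fintype V] [Fintype S] [Fintype X₁] [Fintype X₂]
  [Fintype B] [DecidableEq B] {k : ℕ}
  {p : U × V → ℝ} {f : U → Fin k} {g : V → Fin k} {pS : S → ℝ} {q₁ : U → S → X₁ → ℝ}
  {q₂ : V → S → X₂ → ℝ} {ρ : X₁ → X₂ → Matrix B B ℂ}

/-- The conditional entropy of a source output given a function `φ` of it. -/
def sourceEntropy {C : Type*} [Fintype C] [DecidableEq C] (p : U × V → ℝ) (φ : U × V → C) : ℝ :=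
  ∑ z, Real.negMulLog (p z) - entropy p φ

/-- The joint distribution of the codeword letters `(x₁, x₂)` for a fixed value of `s`. -/
def pairDist (p : U × V → ℝ) (r₁ : U → X₁ → ℝ) (r₂ : V → X₂ → ℝ) (x₁ : X₁) (x₂ : X₂) : ℝ :=
  ∑ u, ∑ v, p (u, v) * r₁ u x₁ * r₂ v x₂

/-- `H(B | X₂ V)` for a fixed value of `s`. -/
def entropyGivenX₂V (p : U × V → ℝ) (ρ : X₁ → X₂ → Matrix B B ℂ) (r₁ : U → X₁ → ℝ)
    (r₂ : V → X₂ → ℝ) : ℝ :=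
  ∑ x₂, ∑ v, weightedEntropy (∑ u, ∑ x₁, (p (u, v) * r₁ u x₁ * r₂ v x₂) • ρ x₁ x₂)

/-- `H(B | X₁ U)` for a fixed value of `s`. -/
def entropyGivenX₁U (p : U × V → ℝ) (ρ : X₁ → X₂ → Matrix B B ℂ) (r₁ : U → X₁ → ℝ)
    (r₂ : V → X₂ → ℝ) : ℝ :=
  ∑ x₁, ∑ u, weightedEntropy (∑ v, ∑ x₂, (p (u, v) * r₁ u x₁ * r₂ v x₂) • ρ x₁ x₂)

/-- `H(B | W)` for a fixed value of `s`. -/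
def entropyGivenW (p : U × V → ℝ) (f : U → Fin k) (ρ : X₁ → X₂ → Matrix B B ℂ)
    (r₁ : U → X₁ → ℝ) (r₂ : V → X₂ → ℝ) : ℝ :=
  ∑ w, weightedEntropy (∑ u, ∑ v, ∑ x₁, ∑ x₂,
    (if f u = w then p (u, v) * r₁ u x₁ * r₂ v x₂ else 0) • ρ x₁ x₂)

/-- `H(B | X₁ X₂)` for a fixed value of `s`. -/
def entropyGivenX₁X₂ (p : U × V → ℝ) (ρ : X₁ → X₂ → Matrix B B ℂ) (r₁ : U → X₁ → ℝ)
    (r₂ : V → X₂ → ℝ) : ℝ :=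
  ∑ x₁, ∑ x₂, pairDist p r₁ r₂ x₁ x₂ * vnEntropy (ρ x₁ x₂)

/-- The state of `B` for a fixed value of `s`. -/
def outputMean (p : U × V → ℝ) (ρ : X₁ → X₂ → Matrix B B ℂ) (r₁ : U → X₁ → ℝ)
    (r₂ : V → X₂ → ℝ) : Matrix B B ℂ :=
  ∑ x₁, ∑ x₂, pairDist p r₁ r₂ x₁ x₂ • ρ x₁ x₂

lemma sum_joint {M : Type*} [AddCommGroup M] [Module ℝ M] (F : U × V × S × X₁ × X₂ → M) :
    ∑ ω, jointDist p pS q₁ q₂ ω • F ω = ∑ u, ∑ v, ∑ s, ∑ x₁, ∑ x₂,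
      (p (u, v) * pS s * q₁ u s x₁ * q₂ v s x₂) • F (u, v, s, x₁, x₂) := by
  simp only [Fintype.sum_prod_type, jointDist]

variable [DecidableEq U] [DecidableEq V] [DecidableEq S] [DecidableEq X₁] [DecidableEq X₂]

/-- The unnormalized mean output given `x₂`, `v`, `s`. -/
lemma labelSum_x₂vs (x₂ : X₂) (v : V) (s : S) :
    labelSum (jointDist p pS q₁ q₂) (jointState ρ) (fun ω => (ω.2.2.2.2, ω.2.1, ω.2.2.1))
      (x₂, v, s) = pS s • ∑ u, ∑ x₁, (p (u, v) * q₁ u s x₁ * q₂ v s x₂) • ρ x₁ x₂ := by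
  rw [labelSum_eq_sum, sum_joint]
  simp only [jointState, Prod.mk.injEq, ite_and, smul_ite, smul_zero, Finset.sum_ite_eq',
    Finset.mem_univ, if_true, Finset.smul_sum, smul_smul, Finset.sum_const_zero,
    Finset.sum_ite_irrel]
  refine Finset.sum_congr rfl fun u _ => Finset.sum_congr rfl fun x _ => ?_
  ring_nf

/-- The unnormalized mean output given `x₁`, `u`, `s`. -/
lemma labelSum_x₁us (x₁ : X₁) (u : U) (s : S) :
    labelSum (jointDist p pS q₁ q₂) (jointState ρ) (fun ω => (ω.2.2.2.1, ω.1, ω.2.2.1))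
      (x₁, u, s) = pS s • ∑ v, ∑ x₂, (p (u, v) * q₁ u s x₁ * q₂ v s x₂) • ρ x₁ x₂ := by
  rw [labelSum_eq_sum, sum_joint]
  simp only [jointState, Prod.mk.injEq, ite_and, smul_ite, smul_zero, Finset.sum_ite_eq',
    Finset.mem_univ, if_true, Finset.smul_sum, smul_smul, Finset.sum_const_zero,
    Finset.sum_ite_irrel]
  refine Finset.sum_congr rfl fun u _ => Finset.sum_congr rfl fun x _ => ?_
  ring_nf

/-- The unnormalized mean output given `w`, `s`. -/
lemma labelSum_ws (w : Fin k) (s : S) :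
    labelSum (jointDist p pS q₁ q₂) (jointState ρ) (fun ω => (f ω.1, ω.2.2.1))
      (w, s) = pS s • ∑ u, ∑ v, ∑ x₁, ∑ x₂,
        (if f u = w then p (u, v) * q₁ u s x₁ * q₂ v s x₂ else 0) • ρ x₁ x₂ := by
  rw [labelSum_eq_sum, sum_joint]
  simp only [jointState, Prod.mk.injEq, ite_and, smul_ite, smul_zero, Finset.sum_ite_eq',
    Finset.mem_univ, if_true, Finset.smul_sum, smul_smul, Finset.sum_const_zero,
    Finset.sum_ite_irrel, ite_smul, zero_smul]
  refine Finset.sum_congr rfl fun u _ => ?_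
  split_ifs
  · refine Finset.sum_congr rfl fun v _ => Finset.sum_congr rfl fun x _ =>
      Finset.sum_congr rfl fun y _ => ?_
    ring_nf
  · rfl

section

lemma isHermitian_of_nonneg {A : Matrix B B ℂ} (h : 0 ≤ A) : A.IsHermitian :=
  (nonneg_iff_posSemidef.1 h).1

lemma condEntropyB_x₂vs (hp0 : ∀ z, 0 ≤ p z) (hq₁ : ∀ u s x, 0 ≤ q₁ u s x)
    (hq₂ : ∀ v s x, 0 ≤ q₂ v s x) (hρ : ∀ x₁ x₂, 0 ≤ ρ x₁ x₂) :
    condEntropyB (jointDist p pS q₁ q₂) (jointState ρ) (fun ω => (ω.2.2.2.2, ω.2.1, ω.2.2.1)) =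
      ∑ s, pS s * entropyGivenX₂V p ρ (fun u => q₁ u s) (fun v => q₂ v s) := by
  have h : ∀ x₂ v s, weightedEntropy (labelSum (jointDist p pS q₁ q₂) (jointState ρ)
      (fun ω => (ω.2.2.2.2, ω.2.1, ω.2.2.1)) (x₂, v, s)) = pS s *
      weightedEntropy (∑ u, ∑ x₁, (p (u, v) * q₁ u s x₁ * q₂ v s x₂) • ρ x₁ x₂) := by
    intro x₂ v s
    rw [labelSum_x₂vs, weightedEntropy_smul]
    exact isHermitian_of_nonneg <| Finset.sum_nonneg fun _ _ => Finset.sum_nonneg fun _ _ =>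
      smul_nonneg (mul_nonneg (mul_nonneg (hp0 _) (hq₁ _ _ _)) (hq₂ _ _ _)) (hρ _ _)
  simp only [condEntropyB, Fintype.sum_prod_type, h, entropyGivenX₂V, Finset.mul_sum]
  exact (Finset.sum_congr rfl fun _ _ => Finset.sum_comm).trans Finset.sum_comm

lemma condEntropyB_x₁us (hp0 : ∀ z, 0 ≤ p z) (hq₁ : ∀ u s x, 0 ≤ q₁ u s x)
    (hq₂ : ∀ v s x, 0 ≤ q₂ v s x) (hρ : ∀ x₁ x₂, 0 ≤ ρ x₁ x₂) :
    condEntropyB (jointDist p pS q₁ q₂) (jointState ρ) (fun ω => (ω.2.2.2.1, ω.1, ω.2.2.1)) =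
      ∑ s, pS s * entropyGivenX₁U p ρ (fun u => q₁ u s) (fun v => q₂ v s) := by
  have h : ∀ x₁ u s, weightedEntropy (labelSum (jointDist p pS q₁ q₂) (jointState ρ)
      (fun ω => (ω.2.2.2.1, ω.1, ω.2.2.1)) (x₁, u, s)) = pS s *
      weightedEntropy (∑ v, ∑ x₂, (p (u, v) * q₁ u s x₁ * q₂ v s x₂) • ρ x₁ x₂) := by
    intro x₁ u s
    rw [labelSum_x₁us, weightedEntropy_smul]
    exact isHermitian_of_nonneg <| Finset.sum_nonneg fun _ _ => Finset.sum_nonneg fun _ _ =>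
      smul_nonneg (mul_nonneg (mul_nonneg (hp0 _) (hq₁ _ _ _)) (hq₂ _ _ _)) (hρ _ _)
  simp only [condEntropyB, Fintype.sum_prod_type, h, entropyGivenX₁U, Finset.mul_sum]
  exact (Finset.sum_congr rfl fun _ _ => Finset.sum_comm).trans Finset.sum_comm

lemma condEntropyB_ws (hp0 : ∀ z, 0 ≤ p z) (hq₁ : ∀ u s x, 0 ≤ q₁ u s x)
    (hq₂ : ∀ v s x, 0 ≤ q₂ v s x) (hρ : ∀ x₁ x₂, 0 ≤ ρ x₁ x₂) :
    condEntropyB (jointDist p pS q₁ q₂) (jointState ρ) (fun ω => (f ω.1, ω.2.2.1)) =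
      ∑ s, pS s * entropyGivenW p f ρ (fun u => q₁ u s) (fun v => q₂ v s) := by
  have h : ∀ w s, weightedEntropy (labelSum (jointDist p pS q₁ q₂) (jointState ρ)
      (fun ω => (f ω.1, ω.2.2.1)) (w, s)) = pS s *
      weightedEntropy (∑ u, ∑ v, ∑ x₁, ∑ x₂,
        (if f u = w then p (u, v) * q₁ u s x₁ * q₂ v s x₂ else 0) • ρ x₁ x₂) := by
    intro w s
    rw [labelSum_ws, weightedEntropy_smul]
    exact isHermitian_of_nonneg <| Finset.sum_nonneg fun _ _ => Finset.sum_nonneg fun _ _ =>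
      Finset.sum_nonneg fun _ _ => Finset.sum_nonneg fun _ _ =>
      smul_nonneg (by
        split_ifs
        · exact mul_nonneg (mul_nonneg (hp0 _) (hq₁ _ _ _)) (hq₂ _ _ _)
        · exact le_rfl) (hρ _ _)
  simp only [condEntropyB, Fintype.sum_prod_type, h, entropyGivenW, Finset.mul_sum]
  exact Finset.sum_comm

end

/-- Moving the sums over the codeword letters and `s` outside. -/
lemma sum_joint_pair {M : Type*} [AddCommGroup M] [Module ℝ M] (F : X₁ → X₂ → M) :
    ∑ ω, jointDist p pS q₁ q₂ ω • F ω.2.2.2.1 ω.2.2.2.2 = ∑ s, pS s • ∑ x₁, ∑ x₂,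
      pairDist p (fun u => q₁ u s) (fun v => q₂ v s) x₁ x₂ • F x₁ x₂ := by
  rw [sum_joint]
  simp only [pairDist, Finset.sum_smul, Finset.smul_sum, smul_smul]
  calc _ = ∑ u, ∑ s, ∑ v, ∑ x₁, ∑ x₂, (p (u, v) * pS s * q₁ u s x₁ * q₂ v s x₂) • F x₁ x₂ :=
        Finset.sum_congr rfl fun _ _ => Finset.sum_comm
    _ = ∑ s, ∑ u, ∑ v, ∑ x₁, ∑ x₂, (p (u, v) * pS s * q₁ u s x₁ * q₂ v s x₂) • F x₁ x₂ :=
        Finset.sum_comm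
    _ = ∑ s, ∑ u, ∑ x₁, ∑ v, ∑ x₂, (p (u, v) * pS s * q₁ u s x₁ * q₂ v s x₂) • F x₁ x₂ :=
        Finset.sum_congr rfl fun _ _ => Finset.sum_congr rfl fun _ _ => Finset.sum_comm
    _ = ∑ s, ∑ x₁, ∑ u, ∑ v, ∑ x₂, (p (u, v) * pS s * q₁ u s x₁ * q₂ v s x₂) • F x₁ x₂ :=
        Finset.sum_congr rfl fun _ _ => Finset.sum_comm
    _ = ∑ s, ∑ x₁, ∑ u, ∑ x₂, ∑ v, (p (u, v) * pS s * q₁ u s x₁ * q₂ v s x₂) • F x₁ x₂ :=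
        Finset.sum_congr rfl fun _ _ => Finset.sum_congr rfl fun _ _ =>
          Finset.sum_congr rfl fun _ _ => Finset.sum_comm
    _ = ∑ s, ∑ x₁, ∑ x₂, ∑ u, ∑ v, (p (u, v) * pS s * q₁ u s x₁ * q₂ v s x₂) • F x₁ x₂ :=
        Finset.sum_congr rfl fun _ _ => Finset.sum_congr rfl fun _ _ => Finset.sum_comm
    _ = _ := by
        refine Finset.sum_congr rfl fun _ _ => Finset.sum_congr rfl fun _ _ =>
          Finset.sum_congr rfl fun _ _ => Finset.sum_congr rfl fun _ _ =>
          Finset.sum_congr rfl fun _ _ => ?_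
        ring_nf

lemma jointDist_nonneg (hp : p ∈ stdSimplex ℝ (U × V)) (hpS : pS ∈ stdSimplex ℝ S)
    (hq₁ : ∀ u s, q₁ u s ∈ stdSimplex ℝ X₁) (hq₂ : ∀ v s, q₂ v s ∈ stdSimplex ℝ X₂)
    (ω : U × V × S × X₁ × X₂) : 0 ≤ jointDist p pS q₁ q₂ ω :=
  mul_nonneg (mul_nonneg (mul_nonneg (hp.1 _) (hpS.1 _)) ((hq₁ _ _).1 _)) ((hq₂ _ _).1 _)

lemma sum_joint_source (hpS : pS ∈ stdSimplex ℝ S)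
    (hq₁ : ∀ u s, q₁ u s ∈ stdSimplex ℝ X₁) (hq₂ : ∀ v s, q₂ v s ∈ stdSimplex ℝ X₂)
    (F : U × V → ℝ) :
    ∑ ω, jointDist p pS q₁ q₂ ω * F (ω.1, ω.2.1) = ∑ z, p z * F z := by
  have h := sum_joint (p := p) (pS := pS) (q₁ := q₁) (q₂ := q₂) (M := ℝ)
    fun ω => F (ω.1, ω.2.1)
  simp only [smul_eq_mul] at h
  rw [h, Fintype.sum_prod_type]
  refine Finset.sum_congr rfl fun u _ => Finset.sum_congr rfl fun v _ => ?_
  have e : ∀ s x₁ x₂, p (u, v) * pS s * q₁ u s x₁ * q₂ v s x₂ * F (u, v) =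
      p (u, v) * F (u, v) * (pS s * (q₁ u s x₁ * q₂ v s x₂)) := fun s x₁ x₂ => by ring
  simp only [e, ← Finset.mul_sum, (hq₂ v _).2, (hq₁ u _).2, hpS.2, mul_one]

lemma jointDist_sum (hp : p ∈ stdSimplex ℝ (U × V)) (hpS : pS ∈ stdSimplex ℝ S)
    (hq₁ : ∀ u s, q₁ u s ∈ stdSimplex ℝ X₁) (hq₂ : ∀ v s, q₂ v s ∈ stdSimplex ℝ X₂) :
    ∑ ω, jointDist p pS q₁ q₂ ω = 1 := by
  have := sum_joint_source (p := p) hpS hq₁ hq₂ fun _ => 1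
  simpa [hp.2] using this

lemma marginal_joint_source {C : Type*} [DecidableEq C] (hpS : pS ∈ stdSimplex ℝ S)
    (hq₁ : ∀ u s, q₁ u s ∈ stdSimplex ℝ X₁) (hq₂ : ∀ v s, q₂ v s ∈ stdSimplex ℝ X₂)
    (φ : U × V → C) (a : C) :
    marginal (jointDist p pS q₁ q₂) (fun ω => φ (ω.1, ω.2.1)) a = marginal p φ a := by
  have := sum_joint_source (p := p) hpS hq₁ hq₂ fun z => if φ z = a then 1 else 0
  simpa [marginal] using this

lemma entropy_injective {Ω C : Type*} [Fintype Ω] [Fintype C] [DecidableEq C] (P : Ω → ℝ)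
    {c : Ω → C} (hc : Function.Injective c) : entropy P c = ∑ ω, Real.negMulLog (P ω) := by
  classical
  have h1 : ∀ ω, marginal P c (c ω) = P ω := by
    intro ω
    simp [marginal, hc.eq_iff]
  rw [entropy, ← Finset.sum_subset (Finset.subset_univ (Finset.univ.image c)),
    Finset.sum_image fun a _ b _ h => hc h]
  · exact Finset.sum_congr rfl fun ω _ => by rw [h1]
  · intro a _ ha
    have : marginal P c a = 0 := by
      refine Finset.sum_eq_zero fun ω _ => if_neg fun h => ha ?_
      exact Finset.mem_image.2 ⟨ω, Finset.mem_univ _, h⟩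
    rw [this, Real.negMulLog_zero]

lemma entropy_codeDist_source {C : Type*} [Fintype C] [DecidableEq C]
    (hfg : ∀ u v, p (u, v) ≠ 0 → f u = g v) (hpS : pS ∈ stdSimplex ℝ S)
    (hq₁ : ∀ u s, q₁ u s ∈ stdSimplex ℝ X₁) (hq₂ : ∀ v s, q₂ v s ∈ stdSimplex ℝ X₂)
    (c : U × V × Fin k × S × X₁ × X₂ → C) (φ : U × V → C)
    (h : ∀ ω, c (withCommon f ω) = φ (ω.1, ω.2.1)) :
    entropy (codeDist p f g pS q₁ q₂) c = entropy p φ := by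
  rw [entropy_codeDist hfg]
  simp only [h, entropy, marginal_joint_source hpS hq₁ hq₂]

/-- The information inequalities in terms of quantities that are linear in the distribution
of `s`. -/
lemma infoConditions_iff (hfg : ∀ u v, p (u, v) ≠ 0 → f u = g v)
    (hp : p ∈ stdSimplex ℝ (U × V)) (hρ : ∀ x₁ x₂, IsDensityMatrix (ρ x₁ x₂))
    (hpS : pS ∈ stdSimplex ℝ S)
    (hq₁ : ∀ u s, q₁ u s ∈ stdSimplex ℝ X₁) (hq₂ : ∀ v s, q₂ v s ∈ stdSimplex ℝ X₂) :
    InfoConditions p f g ρ pS q₁ q₂ ↔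
      Covered (sourceEntropy p fun z => z.2)
        (∑ s, pS s * entropyGivenX₂V p ρ (fun u => q₁ u s) (fun v => q₂ v s) -
          ∑ s, pS s * entropyGivenX₁X₂ p ρ (fun u => q₁ u s) (fun v => q₂ v s)) ∧
      Covered (sourceEntropy p fun z => z.1)
        (∑ s, pS s * entropyGivenX₁U p ρ (fun u => q₁ u s) (fun v => q₂ v s) -
          ∑ s, pS s * entropyGivenX₁X₂ p ρ (fun u => q₁ u s) (fun v => q₂ v s)) ∧
      Covered (sourceEntropy p fun z => f z.1)
        (∑ s, pS s * entropyGivenW p f ρ (fun u => q₁ u s) (fun v => q₂ v s) -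
          ∑ s, pS s * entropyGivenX₁X₂ p ρ (fun u => q₁ u s) (fun v => q₂ v s)) ∧
      Covered (sourceEntropy p fun _ => ())
        (vnEntropy (∑ s, pS s • outputMean p ρ (fun u => q₁ u s) (fun v => q₂ v s)) -
          ∑ s, pS s * entropyGivenX₁X₂ p ρ (fun u => q₁ u s) (fun v => q₂ v s)) := by
  have hρ0 : ∀ x₁ x₂, 0 ≤ ρ x₁ x₂ := fun x₁ x₂ => nonneg_iff_posSemidef.2 (hρ x₁ x₂).1
  have hσ : ∀ ω : U × V × Fin k × S × X₁ × X₂, 0 ≤ codeState ρ ω := fun ω => hρ0 _ _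
  have hσ1 : ∀ ω : U × V × Fin k × S × X₁ × X₂, (codeState ρ ω).trace = 1 :=
    fun ω => (hρ _ _).2
  have hj : ∀ ω : U × V × S × X₁ × X₂, 0 ≤ jointState ρ ω := fun ω => hρ0 _ _
  have hj1 : ∀ ω : U × V × S × X₁ × X₂, (jointState ρ ω).trace = 1 :=
    fun ω => (hρ _ _).2
  have q0₁ : ∀ u s x, 0 ≤ q₁ u s x := fun u s => (hq₁ u s).1
  have q0₂ : ∀ v s x, 0 ≤ q₂ v s x := fun u s => (hq₂ u s).1
  have hX : ∑ ω, jointDist p pS q₁ q₂ ω * vnEntropy (jointState ρ ω) =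
      ∑ s, pS s * entropyGivenX₁X₂ p ρ (fun u => q₁ u s) (fun v => q₂ v s) := by
    simpa [entropyGivenX₁X₂, jointState] using sum_joint_pair (p := p) (pS := pS) (q₁ := q₁)
      (q₂ := q₂) fun x₁ x₂ => vnEntropy (ρ x₁ x₂)
  have hA : ∑ ω, jointDist p pS q₁ q₂ ω • jointState ρ ω =
      ∑ s, pS s • outputMean p ρ (fun u => q₁ u s) (fun v => q₂ v s) :=
    sum_joint_pair ρ
  have s1 : condEntropy (codeDist p f g pS q₁ q₂) (fun (u, _, _, _, _, _) => u)
      (fun (_, v, _, _, _, _) => v) = sourceEntropy p fun z => z.2 := by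
    rw [condEntropy, entropy_codeDist_source hfg hpS hq₁ hq₂ _ (fun z => z) (fun _ => rfl),
      entropy_codeDist_source hfg hpS hq₁ hq₂ _ (fun z => z.2) (fun _ => rfl),
      entropy_injective p fun _ _ h => h, sourceEntropy]
  have s2 : condEntropy (codeDist p f g pS q₁ q₂) (fun (_, v, _, _, _, _) => v)
      (fun (u, _, _, _, _, _) => u) = sourceEntropy p fun z => z.1 := by
    rw [condEntropy, entropy_codeDist_source hfg hpS hq₁ hq₂ _ (fun z => (z.2, z.1))
      (fun _ => rfl), entropy_codeDist_source hfg hpS hq₁ hq₂ _ (fun z => z.1) (fun _ => rfl),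
      entropy_injective p (c := fun z : U × V => (z.2, z.1)) (fun _ _ h => Prod.swap_injective h),
      sourceEntropy]
  have s3 : condEntropy (codeDist p f g pS q₁ q₂) (fun (u, v, _, _, _, _) => (u, v))
      (fun (_, _, w, _, _, _) => w) = sourceEntropy p fun z => f z.1 := by
    rw [condEntropy, entropy_codeDist_source hfg hpS hq₁ hq₂ _ (fun z => (z, f z.1))
      (fun _ => rfl), entropy_codeDist_source hfg hpS hq₁ hq₂ _ (fun z => f z.1) (fun _ => rfl),
      entropy_injective p fun _ _ h => (Prod.ext_iff.1 h).1, sourceEntropy]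
  have s4 : entropy (codeDist p f g pS q₁ q₂) (fun (u, v, _, _, _, _) => (u, v)) =
      sourceEntropy p fun _ => () := by
    rw [entropy_codeDist_source hfg hpS hq₁ hq₂ _ (fun z => z) (fun _ => rfl),
      entropy_injective p fun _ _ h => h, sourceEntropy]
    simp [entropy, marginal, hp.2]
  have i1 : cqCondMutualInfo (codeDist p f g pS q₁ q₂) (codeState ρ)
      (fun (_, _, _, _, x₁, _) => x₁) (fun (_, v, _, s, _, x₂) => (x₂, v, s)) =
      ∑ s, pS s * entropyGivenX₂V p ρ (fun u => q₁ u s) (fun v => q₂ v s) -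
          ∑ s, pS s * entropyGivenX₁X₂ p ρ (fun u => q₁ u s) (fun v => q₂ v s) := by
    have h := condEntropyB_of_factor (P := jointDist p pS q₁ q₂) hj hj1
      (fun ω => (ω.2.2.2.1, ω.2.2.2.2, ω.2.1, ω.2.2.1)) (fun a => ρ a.1 a.2.1) (fun _ => rfl)
    rw [cqCondMutualInfo_eq hσ hσ1, condEntropyB_codeDist hfg, condEntropyB_codeDist hfg]
    exact congrArg₂ (· - ·) (condEntropyB_x₂vs hp.1 q0₁ q0₂ hρ0) (h.trans hX)
  have i2 : cqCondMutualInfo (codeDist p f g pS q₁ q₂) (codeState ρ)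
      (fun (_, _, _, _, _, x₂) => x₂) (fun (u, _, _, s, x₁, _) => (x₁, u, s)) =
      ∑ s, pS s * entropyGivenX₁U p ρ (fun u => q₁ u s) (fun v => q₂ v s) -
          ∑ s, pS s * entropyGivenX₁X₂ p ρ (fun u => q₁ u s) (fun v => q₂ v s) := by
    have h := condEntropyB_of_factor (P := jointDist p pS q₁ q₂) hj hj1
      (fun ω => (ω.2.2.2.2, ω.2.2.2.1, ω.1, ω.2.2.1)) (fun a => ρ a.2.1 a.1) (fun _ => rfl)
    rw [cqCondMutualInfo_eq hσ hσ1, condEntropyB_codeDist hfg, condEntropyB_codeDist hfg]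
    exact congrArg₂ (· - ·) (condEntropyB_x₁us hp.1 q0₁ q0₂ hρ0) (h.trans hX)
  have i3 : cqCondMutualInfo (codeDist p f g pS q₁ q₂) (codeState ρ)
      (fun (_, _, _, _, x₁, x₂) => (x₁, x₂)) (fun (_, _, w, s, _, _) => (w, s)) =
      ∑ s, pS s * entropyGivenW p f ρ (fun u => q₁ u s) (fun v => q₂ v s) -
          ∑ s, pS s * entropyGivenX₁X₂ p ρ (fun u => q₁ u s) (fun v => q₂ v s) := by
    have h := condEntropyB_of_factor (P := jointDist p pS q₁ q₂) hj hj1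
      (fun ω => ((ω.2.2.2.1, ω.2.2.2.2), f ω.1, ω.2.2.1)) (fun a => ρ a.1.1 a.1.2) (fun _ => rfl)
    rw [cqCondMutualInfo_eq hσ hσ1, condEntropyB_codeDist hfg, condEntropyB_codeDist hfg]
    exact congrArg₂ (· - ·) (condEntropyB_ws hp.1 q0₁ q0₂ hρ0) (h.trans hX)
  have i4 : cqMutualInfo (codeDist p f g pS q₁ q₂) (codeState ρ)
      (fun (_, _, _, _, x₁, x₂) => (x₁, x₂)) =
      vnEntropy (∑ s, pS s • outputMean p ρ (fun u => q₁ u s) (fun v => q₂ v s)) -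
          ∑ s, pS s * entropyGivenX₁X₂ p ρ (fun u => q₁ u s) (fun v => q₂ v s) := by
    rw [cqMutualInfo_eq hσ hσ1, condEntropyB_codeDist hfg, cqAverage_codeDist hfg, hA,
      condEntropyB_of_factor hj hj1 _ (fun a => ρ a.1 a.2) (fun _ => rfl), hX]
  rw [← s1, ← s2, ← s3, ← s4, ← i1, ← i2, ← i3, ← i4]
  exact ⟨fun h => ⟨h.ineq₁, h.ineq₂, h.ineq₃, h.ineq₄⟩,
    fun h => ⟨hpS, hq₁, hq₂, h.1, h.2.1, h.2.2.1, h.2.2.2⟩⟩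

end Reduction

/-! ### Typical source sequences -/

section Source

variable {U V C : Type*} [Fintype U] [Fintype V] [Fintype C] [DecidableEq C] {p : U × V → ℝ}

lemma le_marginal (hp : ∀ z, 0 ≤ p z) (φ : U × V → C) (z : U × V) :
    p z ≤ marginal p φ (φ z) := by
  have := Finset.single_le_sum (f := fun z' => if φ z' = φ z then p z' else 0)
    (fun z' _ => by split_ifs <;> simp [hp]) (Finset.mem_univ z)
  simpa [marginal] using this

lemma marginal_source_nonneg (hp : ∀ z, 0 ≤ p z) (φ : U × V → C) (a : C) :
    0 ≤ marginal p φ a :=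
  Finset.sum_nonneg fun z _ => by split_ifs <;> simp [hp]

lemma sum_marginal (φ : U × V → C) : ∑ a, marginal p φ a = ∑ z, p z := by
  simp only [marginal]
  rw [Finset.sum_comm]
  simp

lemma sum_marginal_mul (φ : U × V → C) (F : C → ℝ) :
    ∑ a, marginal p φ a * F a = ∑ z, p z * F (φ z) := by
  simp only [marginal, Finset.sum_mul, ite_mul, zero_mul]
  rw [Finset.sum_comm]
  simp

lemma sourceEntropy_eq (φ : U × V → C) : sourceEntropy p φ =
    ∑ z, p z * (Real.log (marginal p φ (φ z)) - Real.log (p z)) := by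
  have h : entropy p φ = - ∑ z, p z * Real.log (marginal p φ (φ z)) := by
    rw [entropy, ← sum_marginal_mul φ fun a => Real.log (marginal p φ a),
      ← Finset.sum_neg_distrib]
    simp [Real.negMulLog]
  rw [sourceEntropy, h]
  simp only [mul_sub, Finset.sum_sub_distrib, Real.negMulLog, neg_mul, Finset.sum_neg_distrib]
  ring

/-- If the label `φ` leaves no uncertainty, it determines the source output. -/
lemma eq_of_sourceEntropy_eq_zero (hp : ∀ z, 0 ≤ p z) {φ : U × V → C}
    (h : sourceEntropy p φ = 0) {z z' : U × V} (hz : p z ≠ 0) (hz' : p z' ≠ 0)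
    (hφ : φ z = φ z') : z = z' := by
  have hpos : ∀ {z}, p z ≠ 0 → 0 < p z := fun h => lt_of_le_of_ne (hp _) h.symm
  have hterm : ∀ z ∈ Finset.univ, 0 ≤ p z * (Real.log (marginal p φ (φ z)) - Real.log (p z)) := by
    intro z _
    by_cases h0 : p z = 0
    · simp [h0]
    · exact mul_nonneg (hp z) <| sub_nonneg.2 <| Real.log_le_log (hpos h0) (le_marginal hp φ z)
  rw [sourceEntropy_eq, Finset.sum_eq_zero_iff_of_nonneg hterm] at h
  have h1 := h z (Finset.mem_univ _)
  have h2 : marginal p φ (φ z) = p z := by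
    have h3 := (mul_eq_zero.1 h1).resolve_left hz
    exact Real.log_injOn_pos ((hpos hz).trans_le (le_marginal hp φ z)) (hpos hz)
      (sub_eq_zero.1 h3)
  by_contra hne
  classical
  have h4 : p z + p z' ≤ marginal p φ (φ z) := by
    have := Finset.sum_le_sum_of_subset_of_nonneg (Finset.subset_univ {z, z'})
      (f := fun x => if φ x = φ z then p x else 0)
      (fun x _ _ => by split_ifs <;> simp [hp])
    rw [Finset.sum_pair hne] at this
    simpa [marginal, hφ] using this
  linarith [hpos hz']

/-- The source sequences whose probability is not much less than expected given the label. -/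
def likelySet (p : U × V → ℝ) (φ : U × V → C) (N : ℝ) (n : ℕ) : Set (Fin n → U × V) :=
  {z | ∏ i, marginal p φ (φ (z i)) ≤ N * ∏ i, p (z i)}

/-- Asymptotic equipartition, one-sided: with high probability, the probability of the source sequence
given the label is at least `exp (-n (H + δ))`. -/
lemma tendsto_likely (hp : p ∈ stdSimplex ℝ (U × V)) (φ : U × V → C) {δ : ℝ} (hδ : 0 < δ) :
    Tendsto (fun n : ℕ => ∑ z : Fin n → U × V,
      (likelySet p φ (Real.exp (n * (sourceEntropy p φ + δ))) n)ᶜ.indicator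
        (fun z => ∏ i, p (z i)) z) atTop (𝓝 0) := by
  set H := sourceEntropy p φ with hH
  have hc := tendsto_chernoff (Q := p)
    (ψ := fun z => Real.log (marginal p φ (φ z)) - Real.log (p z) - (H + δ)) hp.1 hp.2 (by
      simp only [mul_sub (p _) _ (H + δ), Finset.sum_sub_distrib, ← Finset.sum_mul, hp.2]
      rw [← sourceEntropy_eq]
      linarith)
  refine squeeze_zero (fun n => Finset.sum_nonneg fun z _ =>
    Set.indicator_nonneg (fun z _ => Finset.prod_nonneg fun i _ => hp.1 _) z)
    (fun n => Finset.sum_le_sum fun z _ => ?_) hc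
  have hnn : 0 ≤ ∏ i, p (z i) := Finset.prod_nonneg fun i _ => hp.1 _
  by_cases hz : z ∈ likelySet p φ (Real.exp (n * (H + δ))) n
  · rw [Set.indicator_of_notMem (Set.notMem_compl_iff.2 hz)]
    exact Set.indicator_apply_nonneg fun _ => hnn
  have key : ∀ T : Set (Fin n → U × V), ∏ i, p (z i) = 0 ∨ z ∈ T →
      T.indicator (fun z => ∏ i, p (z i)) z = ∏ i, p (z i) := fun T hT => by
    classical
    rw [Set.indicator_apply]
    split_ifs with h
    · rfl
    · exact (hT.resolve_right h).symm
  rw [key _ (Or.inr hz)]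
  refine (key _ ?_).ge
  by_cases h0 : ∏ i, p (z i) = 0
  · exact Or.inl h0
  right
  have hz' : Real.exp (n * (H + δ)) * ∏ i, p (z i) < ∏ i, marginal p φ (φ (z i)) := not_le.1 hz
  have hpos : 0 < ∏ i, p (z i) := lt_of_le_of_ne hnn (Ne.symm h0)
  have hm : ∀ i, marginal p φ (φ (z i)) ≠ 0 := fun i h => h0 <|
    Finset.prod_eq_zero (Finset.mem_univ i) (le_antisymm (h ▸ le_marginal hp.1 φ (z i)) (hp.1 _))
  have := Real.log_lt_log (mul_pos (Real.exp_pos _) hpos) hz'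
  rw [Real.log_mul (Real.exp_pos _).ne' h0, Real.log_exp, Real.log_prod fun i _ => hm i,
    Real.log_prod fun i _ => Finset.prod_ne_zero_iff.1 h0 i (Finset.mem_univ i)] at this
  simp only [Set.mem_ofPred_eq, Finset.sum_sub_distrib]
  simp only [Finset.sum_const, Finset.card_univ, Fintype.card_fin, nsmul_eq_mul]
  linarith

end Source

/-- Summing over blocks of pairs is summing over pairs of blocks. -/
lemma sum_pi_prod {α β M : Type*} [Fintype α] [Fintype β] [AddCommMonoid M] {n : ℕ}
    (F : (Fin n → α) → (Fin n → β) → M) :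
    ∑ ω : Fin n → α × β, F (fun i => (ω i).1) (fun i => (ω i).2) = ∑ a, ∑ b, F a b := by
  rw [← Fintype.sum_prod_type' (f := F)]
  exact Fintype.sum_equiv (Equiv.arrowProdEquivProdArrow _ _ _) _ _ fun ω => rfl

/-! ### Conditional channel outputs of a single use of the channel -/

section Cond

variable {U V S X₁ X₂ B : Type*} [Fintype U] [Fintype V] [Fintype S] [Fintype X₁] [Fintype X₂]
  [Fintype B] [DecidableEq B] [DecidableEq U] [DecidableEq V] [DecidableEq S] [DecidableEq X₁]
  [DecidableEq X₂] {k : ℕ}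

/-- `p(u | v)` -/
def condU (p : U × V → ℝ) (v : V) (u : U) : ℝ := p (u, v) / marginal p (fun z => z.2) v

/-- `p(v | u)` -/
def condV (p : U × V → ℝ) (u : U) (v : V) : ℝ := p (u, v) / marginal p (fun z => z.1) u

/-- `p(u | w)` for `w = f u` -/
def condUW (p : U × V → ℝ) (f : U → Fin k) (u : U) : ℝ :=
  marginal p (fun z => z.1) u / marginal p (fun z => f z.1) (f u)

/-- The mean channel output given `x₂`, `v`, `s`. -/
def meanX₂VS (p : U × V → ℝ) (q₁ : U → S → X₁ → ℝ) (ρ : X₁ → X₂ → Matrix B B ℂ)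
    (x₂ : X₂) (v : V) (s : S) : Matrix B B ℂ :=
  ∑ u, condU p v u • ∑ x₁, q₁ u s x₁ • ρ x₁ x₂

/-- The mean channel output given `x₁`, `u`, `s`. -/
def meanX₁US (p : U × V → ℝ) (q₂ : V → S → X₂ → ℝ) (ρ : X₁ → X₂ → Matrix B B ℂ)
    (x₁ : X₁) (u : U) (s : S) : Matrix B B ℂ :=
  ∑ v, condV p u v • ∑ x₂, q₂ v s x₂ • ρ x₁ x₂

/-- The mean channel output given `w`, `s`. -/
def meanWS (p : U × V → ℝ) (f : U → Fin k) (q₁ : U → S → X₁ → ℝ) (q₂ : V → S → X₂ → ℝ)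
    (ρ : X₁ → X₂ → Matrix B B ℂ) (w : Fin k) (s : S) : Matrix B B ℂ :=
  ∑ u, (if f u = w then condUW p f u else 0) • ∑ x₁, q₁ u s x₁ • meanX₁US p q₂ ρ x₁ u s

/-- The mean channel output. -/
def meanB (p : U × V → ℝ) (f : U → Fin k) (pS : S → ℝ) (q₁ : U → S → X₁ → ℝ)
    (q₂ : V → S → X₂ → ℝ) (ρ : X₁ → X₂ → Matrix B B ℂ) : Matrix B B ℂ :=
  ∑ w, marginal p (fun z => f z.1) w • ∑ s, pS s • meanWS p f q₁ q₂ ρ w s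

variable {p : U × V → ℝ} {f : U → Fin k} {pS : S → ℝ} {q₁ : U → S → X₁ → ℝ}
  {q₂ : V → S → X₂ → ℝ} {ρ : X₁ → X₂ → Matrix B B ℂ}

lemma condU_nonneg (hp : ∀ z, 0 ≤ p z) (v : V) (u : U) : 0 ≤ condU p v u :=
  div_nonneg (hp _) (marginal_source_nonneg hp _ _)

lemma condV_nonneg (hp : ∀ z, 0 ≤ p z) (u : U) (v : V) : 0 ≤ condV p u v :=
  div_nonneg (hp _) (marginal_source_nonneg hp _ _)

lemma condUW_nonneg (hp : ∀ z, 0 ≤ p z) (u : U) : 0 ≤ condUW p f u :=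
  div_nonneg (marginal_source_nonneg hp _ _) (marginal_source_nonneg hp _ _)

lemma marginal_snd (v : V) : marginal p (fun z => z.2) v = ∑ u, p (u, v) := by
  simp [marginal, Fintype.sum_prod_type]

lemma marginal_fst (u : U) : marginal p (fun z => z.1) u = ∑ v, p (u, v) := by
  rw [marginal, Fintype.sum_prod_type, Finset.sum_comm]
  simp

lemma marginal_common (w : Fin k) : marginal p (fun z => f z.1) w =
    ∑ u, if f u = w then marginal p (fun z => z.1) u else 0 := by
  rw [marginal, Fintype.sum_prod_type]
  refine Finset.sum_congr rfl fun u _ => ?_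
  rw [marginal_fst]
  split_ifs <;> simp

lemma marginal_mul_condU (hp : ∀ z, 0 ≤ p z) (u : U) (v : V) :
    marginal p (fun z => z.2) v * condU p v u = p (u, v) :=
  mul_div_cancel_of_imp' fun h =>
    le_antisymm (h ▸ le_marginal hp (fun z : U × V => z.2) (u, v)) (hp _)

lemma marginal_mul_condV (hp : ∀ z, 0 ≤ p z) (u : U) (v : V) :
    marginal p (fun z => z.1) u * condV p u v = p (u, v) :=
  mul_div_cancel_of_imp' fun h =>
    le_antisymm (h ▸ le_marginal hp (fun z : U × V => z.1) (u, v)) (hp _)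

lemma marginal_mul_condUW (hp : ∀ z, 0 ≤ p z) (u : U) :
    marginal p (fun z => f z.1) (f u) * condUW p f u = marginal p (fun z => z.1) u := by
  refine mul_div_cancel_of_imp' fun h => le_antisymm ?_ (marginal_source_nonneg hp _ _)
  rw [← h, marginal_common]
  have := Finset.single_le_sum
    (f := fun u' => if f u' = f u then marginal p (fun z => z.1) u' else 0)
    (fun z' _ => by split_ifs <;> simp [marginal_source_nonneg hp]) (Finset.mem_univ u)
  simpa using this

lemma sum_condU {v : V} (h : marginal p (fun z => z.2) v ≠ 0) : ∑ u, condU p v u = 1 := by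
  simp only [condU, ← Finset.sum_div]
  rw [← marginal_snd, div_self h]

lemma sum_condU_le (v : V) : ∑ u, condU p v u ≤ 1 := by
  simp only [condU, ← Finset.sum_div]
  rw [← marginal_snd]
  exact div_self_le_one _

lemma sum_condV {u : U} (h : marginal p (fun z => z.1) u ≠ 0) : ∑ v, condV p u v = 1 := by
  simp only [condV, ← Finset.sum_div]
  rw [← marginal_fst, div_self h]

lemma meanX₂VS_nonneg (hp : ∀ z, 0 ≤ p z) (hq₁ : ∀ u s x, 0 ≤ q₁ u s x)
    (hρ : ∀ x₁ x₂, 0 ≤ ρ x₁ x₂) (x₂ : X₂) (v : V) (s : S) : 0 ≤ meanX₂VS p q₁ ρ x₂ v s :=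
  Finset.sum_nonneg fun _ _ => smul_nonneg (condU_nonneg hp _ _) <| Finset.sum_nonneg fun _ _ =>
    smul_nonneg (hq₁ _ _ _) (hρ _ _)

lemma meanX₁US_nonneg (hp : ∀ z, 0 ≤ p z) (hq₂ : ∀ v s x, 0 ≤ q₂ v s x)
    (hρ : ∀ x₁ x₂, 0 ≤ ρ x₁ x₂) (x₁ : X₁) (u : U) (s : S) : 0 ≤ meanX₁US p q₂ ρ x₁ u s :=
  Finset.sum_nonneg fun _ _ => smul_nonneg (condV_nonneg hp _ _) <| Finset.sum_nonneg fun _ _ =>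
    smul_nonneg (hq₂ _ _ _) (hρ _ _)

lemma meanWS_nonneg (hp : ∀ z, 0 ≤ p z) (hq₁ : ∀ u s x, 0 ≤ q₁ u s x)
    (hq₂ : ∀ v s x, 0 ≤ q₂ v s x) (hρ : ∀ x₁ x₂, 0 ≤ ρ x₁ x₂) (w : Fin k) (s : S) :
    0 ≤ meanWS p f q₁ q₂ ρ w s :=
  Finset.sum_nonneg fun u _ => smul_nonneg (by
      split_ifs
      · exact condUW_nonneg hp u
      · exact le_rfl) <| Finset.sum_nonneg fun _ _ =>
    smul_nonneg (hq₁ _ _ _) (meanX₁US_nonneg hp hq₂ hρ _ _ _)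

lemma meanB_nonneg (hp : ∀ z, 0 ≤ p z) (hpS : ∀ s, 0 ≤ pS s) (hq₁ : ∀ u s x, 0 ≤ q₁ u s x)
    (hq₂ : ∀ v s x, 0 ≤ q₂ v s x) (hρ : ∀ x₁ x₂, 0 ≤ ρ x₁ x₂) :
    0 ≤ meanB p f pS q₁ q₂ ρ :=
  Finset.sum_nonneg fun _ _ => smul_nonneg (marginal_source_nonneg hp _ _) <|
    Finset.sum_nonneg fun _ _ => smul_nonneg (hpS _) (meanWS_nonneg hp hq₁ hq₂ hρ _ _)

/-- The unnormalized mean output given `x₁`, `u`, `s`. -/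
lemma marginal_smul_meanX₁US (hp : ∀ z, 0 ≤ p z) (x₁ : X₁) (u : U) (s : S) :
    marginal p (fun z => z.1) u • meanX₁US p q₂ ρ x₁ u s =
      ∑ v, ∑ x₂, (p (u, v) * q₂ v s x₂) • ρ x₁ x₂ := by
  simp only [meanX₁US, Finset.smul_sum, smul_smul]
  refine Finset.sum_congr rfl fun v _ => Finset.sum_congr rfl fun x _ => ?_
  rw [← mul_assoc, marginal_mul_condV hp]

/-- The unnormalized mean output given `w`, `s`. -/
lemma marginal_smul_meanWS (hp : ∀ z, 0 ≤ p z) (w : Fin k) (s : S) :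
    marginal p (fun z => f z.1) w • meanWS p f q₁ q₂ ρ w s =
      ∑ u, ∑ v, ∑ x₁, ∑ x₂,
        (if f u = w then p (u, v) * q₁ u s x₁ * q₂ v s x₂ else 0) • ρ x₁ x₂ := by
  rw [meanWS, Finset.smul_sum]
  refine Finset.sum_congr rfl fun u _ => ?_
  by_cases hw : f u = w
  · subst hw
    simp only [if_true]
    rw [smul_smul, marginal_mul_condUW hp, Finset.smul_sum, Finset.sum_comm]
    refine Finset.sum_congr rfl fun x₁ _ => ?_
    rw [smul_comm, marginal_smul_meanX₁US hp, Finset.smul_sum]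
    refine Finset.sum_congr rfl fun v _ => ?_
    rw [Finset.smul_sum]
    refine Finset.sum_congr rfl fun x₂ _ => ?_
    rw [smul_smul]
    ring_nf
  · simp [hw]

lemma density_nonneg {A : Matrix B B ℂ} (h : IsDensityMatrix A) : 0 ≤ A :=
  nonneg_iff_posSemidef.2 h.1

lemma trace_re_mix {α : Type*} [Fintype α] (w : α → ℝ) (M : α → Matrix B B ℂ) :
    (∑ a, w a • M a).trace.re = ∑ a, w a * (M a).trace.re := by
  simp [trace_sum, Complex.re_sum]

lemma isLabelAverage_x₁x₂
    (hp : p ∈ stdSimplex ℝ (U × V)) (hρ : ∀ x₁ x₂, IsDensityMatrix (ρ x₁ x₂))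
    (hpS : pS ∈ stdSimplex ℝ S) (hq₁ : ∀ u s, q₁ u s ∈ stdSimplex ℝ X₁)
    (hq₂ : ∀ v s, q₂ v s ∈ stdSimplex ℝ X₂) :
    IsLabelAverage (jointDist p pS q₁ q₂) (jointState ρ) (fun ω => (ω.2.2.2.1, ω.2.2.2.2))
      (fun a => ρ a.1 a.2) := by
  refine ⟨jointDist_nonneg hp hpS hq₁ hq₂, jointDist_sum hp hpS hq₁ hq₂,
    fun ω => density_nonneg (hρ _ _), fun ω => (hρ _ _).2, fun a => density_nonneg (hρ _ _), fun a => ?_⟩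
  rw [marginal, Finset.sum_smul]
  refine Finset.sum_congr rfl fun ω _ => ?_
  split_ifs with h
  · rw [← h]; rfl
  · simp

lemma isLabelAverage_x₂vs
    (hp : p ∈ stdSimplex ℝ (U × V)) (hρ : ∀ x₁ x₂, IsDensityMatrix (ρ x₁ x₂))
    (hpS : pS ∈ stdSimplex ℝ S) (hq₁ : ∀ u s, q₁ u s ∈ stdSimplex ℝ X₁)
    (hq₂ : ∀ v s, q₂ v s ∈ stdSimplex ℝ X₂) :
    IsLabelAverage (jointDist p pS q₁ q₂) (jointState ρ) (fun ω => (ω.2.2.2.2, ω.2.1, ω.2.2.1))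
      (fun a => meanX₂VS p q₁ ρ a.1 a.2.1 a.2.2) := by
  refine isLabelAverage_of (jointDist_nonneg hp hpS hq₁ hq₂) (jointDist_sum hp hpS hq₁ hq₂)
    (fun ω => density_nonneg (hρ _ _)) (fun ω => (hρ _ _).2)
    (fun a => meanX₂VS_nonneg hp.1 (fun u s => (hq₁ u s).1) (fun _ _ => density_nonneg (hρ _ _)) _ _ _)
    (fun a => pS a.2.2 * (q₂ a.2.1 a.2.2 a.1 * marginal p (fun z => z.2) a.2.1)) ?_ ?_
  · rintro ⟨x₂, v, s⟩
    rw [labelSum_x₂vs, mul_smul]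
    congr 1
    simp only [meanX₂VS, Finset.smul_sum, smul_smul]
    refine Finset.sum_congr rfl fun u _ => Finset.sum_congr rfl fun x _ => ?_
    rw [← marginal_mul_condU hp.1 u v]
    ring_nf
  · rintro ⟨x₂, v, s⟩ h
    simp only [meanX₂VS, trace_re_mix, (hρ _ _).2, Complex.one_re, mul_one, (hq₁ _ _).2]
    exact sum_condU (right_ne_zero_of_mul (right_ne_zero_of_mul h))

lemma isLabelAverage_x₁us
    (hp : p ∈ stdSimplex ℝ (U × V)) (hρ : ∀ x₁ x₂, IsDensityMatrix (ρ x₁ x₂))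
    (hpS : pS ∈ stdSimplex ℝ S) (hq₁ : ∀ u s, q₁ u s ∈ stdSimplex ℝ X₁)
    (hq₂ : ∀ v s, q₂ v s ∈ stdSimplex ℝ X₂) :
    IsLabelAverage (jointDist p pS q₁ q₂) (jointState ρ) (fun ω => (ω.2.2.2.1, ω.1, ω.2.2.1))
      (fun a => meanX₁US p q₂ ρ a.1 a.2.1 a.2.2) := by
  refine isLabelAverage_of (jointDist_nonneg hp hpS hq₁ hq₂) (jointDist_sum hp hpS hq₁ hq₂)
    (fun ω => density_nonneg (hρ _ _)) (fun ω => (hρ _ _).2)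
    (fun a => meanX₁US_nonneg hp.1 (fun u s => (hq₂ u s).1) (fun _ _ => density_nonneg (hρ _ _)) _ _ _)
    (fun a => pS a.2.2 * (q₁ a.2.1 a.2.2 a.1 * marginal p (fun z => z.1) a.2.1)) ?_ ?_
  · rintro ⟨x₁, u, s⟩
    rw [labelSum_x₁us, mul_smul]
    congr 1
    simp only [meanX₁US, Finset.smul_sum, smul_smul]
    refine Finset.sum_congr rfl fun v _ => Finset.sum_congr rfl fun x _ => ?_
    rw [← marginal_mul_condV hp.1 u v]
    ring_nf
  · rintro ⟨x₁, u, s⟩ h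
    simp only [meanX₁US, trace_re_mix, (hρ _ _).2, Complex.one_re, mul_one, (hq₂ _ _).2]
    exact sum_condV (right_ne_zero_of_mul (right_ne_zero_of_mul h))

lemma isLabelAverage_ws
    (hp : p ∈ stdSimplex ℝ (U × V)) (hρ : ∀ x₁ x₂, IsDensityMatrix (ρ x₁ x₂))
    (hpS : pS ∈ stdSimplex ℝ S) (hq₁ : ∀ u s, q₁ u s ∈ stdSimplex ℝ X₁)
    (hq₂ : ∀ v s, q₂ v s ∈ stdSimplex ℝ X₂) :
    IsLabelAverage (jointDist p pS q₁ q₂) (jointState ρ) (fun ω => (f ω.1, ω.2.2.1))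
      (fun a => meanWS p f q₁ q₂ ρ a.1 a.2) := by
  refine isLabelAverage_of (jointDist_nonneg hp hpS hq₁ hq₂) (jointDist_sum hp hpS hq₁ hq₂)
    (fun ω => density_nonneg (hρ _ _)) (fun ω => (hρ _ _).2)
    (fun a => meanWS_nonneg hp.1 (fun u s => (hq₁ u s).1) (fun u s => (hq₂ u s).1)
      (fun _ _ => density_nonneg (hρ _ _)) _ _)
    (fun a => pS a.2 * marginal p (fun z => f z.1) a.1) ?_ ?_
  · rintro ⟨w, s⟩
    rw [labelSum_ws, mul_smul, marginal_smul_meanWS hp.1]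
  · rintro ⟨w, s⟩ h
    have hw : marginal p (fun z => f z.1) w ≠ 0 := right_ne_zero_of_mul h
    have e : marginal p (fun z => f z.1) w * (meanWS p f q₁ q₂ ρ w s).trace.re =
        marginal p (fun z => f z.1) w * 1 := by
      have h1 := congrArg (fun M => M.trace.re) (marginal_smul_meanWS (f := f) (q₁ := q₁)
        (q₂ := q₂) (ρ := ρ) hp.1 w s)
      simp only [trace_smul, trace_sum, Complex.re_sum, (hρ _ _).2, Complex.real_smul,
        Complex.re_ofReal_mul, mul_one] at h1
      rw [h1, mul_one, marginal_common]
      refine Finset.sum_congr rfl fun u _ => ?_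
      split_ifs with hu
      · simp only [Complex.ofReal_re, ← Finset.mul_sum, (hq₂ _ _).2, mul_one, (hq₁ _ _).2,
          marginal_fst]
      · simp
    exact mul_left_cancel₀ hw e

lemma meanB_eq (hp : p ∈ stdSimplex ℝ (U × V)) :
    meanB p f pS q₁ q₂ ρ = ∑ ω, jointDist p pS q₁ q₂ ω • jointState ρ ω := by
  have h : ∀ w s, labelSum (jointDist p pS q₁ q₂) (jointState ρ) (fun ω => (f ω.1, ω.2.2.1))
      (w, s) = marginal p (fun z => f z.1) w • pS s • meanWS p f q₁ q₂ ρ w s := by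
    intro w s
    rw [labelSum_ws, smul_comm, marginal_smul_meanWS hp.1]
  simp only [meanB, Finset.smul_sum, ← h]
  rw [← Fintype.sum_prod_type']
  simp only [labelSum]
  rw [Finset.sum_comm]
  simp

lemma trace_meanB
    (hp : p ∈ stdSimplex ℝ (U × V)) (hρ : ∀ x₁ x₂, IsDensityMatrix (ρ x₁ x₂))
    (hpS : pS ∈ stdSimplex ℝ S) (hq₁ : ∀ u s, q₁ u s ∈ stdSimplex ℝ X₁)
    (hq₂ : ∀ v s, q₂ v s ∈ stdSimplex ℝ X₂) :
     (meanB p f pS q₁ q₂ ρ).trace = 1 := by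
  rw [meanB_eq hp, trace_sum]
  have : ∀ ω, (jointDist p pS q₁ q₂ ω • jointState ρ ω).trace = (jointDist p pS q₁ q₂ ω : ℂ) := by
    intro ω
    rw [trace_smul, jointState, (hρ _ _).2]
    simp
  simp only [this]
  rw [← Complex.ofReal_sum, jointDist_sum hp hpS hq₁ hq₂, Complex.ofReal_one]

lemma isLabelAverage_unit
    (hp : p ∈ stdSimplex ℝ (U × V)) (hρ : ∀ x₁ x₂, IsDensityMatrix (ρ x₁ x₂))
    (hpS : pS ∈ stdSimplex ℝ S) (hq₁ : ∀ u s, q₁ u s ∈ stdSimplex ℝ X₁)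
    (hq₂ : ∀ v s, q₂ v s ∈ stdSimplex ℝ X₂) :
    IsLabelAverage (jointDist p pS q₁ q₂) (jointState ρ) (fun _ => ())
      (fun _ => meanB p f pS q₁ q₂ ρ) := by
  refine isLabelAverage_of (jointDist_nonneg hp hpS hq₁ hq₂) (jointDist_sum hp hpS hq₁ hq₂)
    (fun ω => density_nonneg (hρ _ _)) (fun ω => (hρ _ _).2)
    (fun a => meanB_nonneg hp.1 hpS.1 (fun u s => (hq₁ u s).1) (fun u s => (hq₂ u s).1)
      (fun _ _ => density_nonneg (hρ _ _)))
    (fun _ => 1) (fun _ => ?_) fun _ _ => ?_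
  · rw [one_smul, meanB_eq hp]
    simp [labelSum]
  · rw [trace_meanB hp hρ hpS hq₁ hq₂, Complex.one_re]

end Cond

/-! ### The code for blocks of length `n` -/

section Block

lemma sum_pi_prod_eq_one {α : Type*} [Fintype α] {n : ℕ} {w : Fin n → α → ℝ}
    (h : ∀ i, ∑ a, w i a = 1) : ∑ x : Fin n → α, ∏ i, w i (x i) = 1 := by
  have := Finset.prod_univ_sum (fun _ : Fin n => (Finset.univ : Finset α)) w
  rw [Fintype.piFinset_univ] at this
  rw [← this, Finset.prod_eq_one fun i _ => h i]

lemma sum_pi_prod_le_one {α : Type*} [Fintype α] {n : ℕ} {w : Fin n → α → ℝ}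
    (h0 : ∀ i a, 0 ≤ w i a) (h : ∀ i, ∑ a, w i a ≤ 1) :
    ∑ x : Fin n → α, ∏ i, w i (x i) ≤ 1 := by
  have := Finset.prod_univ_sum (fun _ : Fin n => (Finset.univ : Finset α)) w
  rw [Fintype.piFinset_univ] at this
  rw [← this]
  exact Finset.prod_le_one (fun i _ => Finset.sum_nonneg fun a _ => h0 i a) fun i _ => h i

variable {U V S X₁ X₂ B : Type*} [Fintype U] [Fintype V] [Fintype S] [Fintype X₁] [Fintype X₂]
  [Fintype B] [DecidableEq B] [DecidableEq U] [DecidableEq V] [DecidableEq S] [DecidableEq X₁]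
  [DecidableEq X₂] {k : ℕ}

/-- The source sequences which the block code takes care of: those of positive probability that
are likely with respect to each of the labels `v`, `u`, `w` and the trivial one. -/
def typicalSet (p : U × V → ℝ) (f : U → Fin k) (N₁ N₂ N₃ N₄ : ℝ) (n : ℕ) :
    Set (Fin n → U × V) :=
  {z | (∀ i, p (z i) ≠ 0) ∧ z ∈ likelySet p (fun z => z.2) N₁ n ∧
    z ∈ likelySet p (fun z => z.1) N₂ n ∧ z ∈ likelySet p (fun z => f z.1) N₃ n ∧
    z ∈ likelySet p (fun _ => ()) N₄ n}

variable {p : U × V → ℝ} {f : U → Fin k} {g : V → Fin k} {pS : S → ℝ} {q₁ : U → S → X₁ → ℝ}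
  {q₂ : V → S → X₂ → ℝ} {ρ : X₁ → X₂ → Matrix B B ℂ}

lemma indicator_ne_zero {α : Type*} {T : Set α} {z : α} (h : T.indicator (1 : α → ℝ) z ≠ 0) :
    z ∈ T := by
  by_contra hz
  exact h (Set.indicator_of_notMem hz _)

/-- The conditional probability, given the label `φ`, of a likely sequence is at least `N⁻¹`. -/
lemma one_le_mul_prod_of_likely {C : Type*} [Fintype C] [DecidableEq C] {φ : U × V → C}
    (hp : ∀ z, 0 ≤ p z) {N : ℝ} {n : ℕ} {z : Fin n → U × V} (hpos : ∀ i, p (z i) ≠ 0)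
    (hz : z ∈ likelySet p φ N n) {c : Fin n → ℝ}
    (hc : ∀ i, marginal p φ (φ (z i)) * c i = p (z i)) : 1 ≤ N * ∏ i, c i := by
  have hm : 0 < ∏ i, marginal p φ (φ (z i)) := Finset.prod_pos fun i _ =>
    (lt_of_le_of_ne (hp _) (hpos i).symm).trans_le (le_marginal hp φ (z i))
  have h : ∏ i, marginal p φ (φ (z i)) ≤ N * ∏ i, p (z i) := hz
  simp only [← hc, Finset.prod_mul_distrib] at h
  have h' : ∏ i, marginal p φ (φ (z i)) * 1 ≤
      (∏ i, marginal p φ (φ (z i))) * (N * ∏ i, c i) := by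
    simp only [mul_one]
    linarith
  simp only [mul_one] at h'
  exact le_of_mul_le_mul_left (by linarith) hm

lemma indicator_le_mul_prod {α : Type*} {T : Set α} {z : α} {N c : ℝ} (hN : 0 ≤ N) (hc : 0 ≤ c)
    (h : z ∈ T → 1 ≤ N * c) : T.indicator (1 : α → ℝ) z ≤ N * c := by
  by_cases hz : z ∈ T
  · simpa [hz] using h hz
  · simpa [hz] using mul_nonneg hN hc

/-- If an inequality is waived, typical sequences are determined by the corresponding label. -/
lemma eq_of_typical {C : Type*} [Fintype C] [DecidableEq C] {φ : U × V → C}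
    (hp : ∀ z, 0 ≤ p z) (hφ : sourceEntropy p φ = 0) {N₁ N₂ N₃ N₄ : ℝ} {n : ℕ}
    {z z' : Fin n → U × V} (hz : (typicalSet p f N₁ N₂ N₃ N₄ n).indicator (1 : (Fin n → U × V) → ℝ) z ≠ 0)
    (hz' : (typicalSet p f N₁ N₂ N₃ N₄ n).indicator (1 : (Fin n → U × V) → ℝ) z' ≠ 0)
    (h : ∀ i, φ (z i) = φ (z' i)) (i : Fin n) : z i = z' i :=
  eq_of_sourceEntropy_eq_zero hp hφ ((indicator_ne_zero hz).1 i) ((indicator_ne_zero hz').1 i) (h i)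

lemma marginal_mul_condUW_mul_condV (hp : ∀ z, 0 ≤ p z) (u : U) (v : V) :
    marginal p (fun z => f z.1) (f u) * (condUW p f u * condV p u v) = p (u, v) := by
  rw [← mul_assoc, marginal_mul_condUW hp, marginal_mul_condV hp]

open IsLabelAverage in
/-- The random coding setup for `n` uses of the channel. -/
def blockSetup (hp : p ∈ stdSimplex ℝ (U × V)) (hρ : ∀ x₁ x₂, IsDensityMatrix (ρ x₁ x₂))
    (hpS : pS ∈ stdSimplex ℝ S) (hq₁ : ∀ u s, q₁ u s ∈ stdSimplex ℝ X₁)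
    (hq₂ : ∀ v s, q₂ v s ∈ stdSimplex ℝ X₂) (hfg : ∀ u v, p (u, v) ≠ 0 → f u = g v)
    (n : ℕ) {κ l₁ l₂ l₃ l₄ N₁ N₂ N₃ N₄ β : ℝ} (hκ : 0 ≤ κ) (hl₁ : 0 ≤ l₁) (hl₂ : 0 ≤ l₂)
    (hl₃ : 0 ≤ l₃) (hl₄ : 0 ≤ l₄) (hN₁ : 0 ≤ N₁) (hN₂ : 0 ≤ N₂) (hN₃ : 0 ≤ N₃) (hN₄ : 0 ≤ N₄)
    (hβ : 0 ≤ β)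
    (b₁ : N₁ * l₁ * κ ≤ β ∨ sourceEntropy p (fun z => z.2) = 0)
    (b₂ : N₂ * κ * l₂ ≤ β ∨ sourceEntropy p (fun z => z.1) = 0)
    (b₃ : N₃ * κ * l₃ ≤ β ∨ sourceEntropy p (fun z => f z.1) = 0)
    (b₄ : N₄ * κ * l₄ ≤ β ∨ sourceEntropy p (fun _ => ()) = 0) :
    CodeSetup (Fin n → U) (Fin n → V) (Fin n → Fin k) (Fin n → S) (Fin n → X₁) (Fin n → X₂)
      (Fin n → B) where
  p u v := ∏ i, p (u i, v i)
  f u i := f (u i)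
  g v i := g (v i)
  pS s := ∏ i, pS (s i)
  q₁ u s x := ∏ i, q₁ (u i) (s i) (x i)
  q₂ v s x := ∏ i, q₂ (v i) (s i) (x i)
  ρ x₁ x₂ := tensor fun i => ρ (x₁ i) (x₂ i)
  t u v := (typicalSet p f N₁ N₂ N₃ N₄ n).indicator 1 fun i => (u i, v i)
  pV v := ∏ i, marginal p (fun z => z.2) (v i)
  pW w := ∏ i, marginal p (fun z => f z.1) (w i)
  aU u := ∏ i, condUW p f (u i)
  bU u v := ∏ i, condV p (u i) (v i)
  bV v u := ∏ i, condU p (v i) (u i)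
  ρ₁ x₂ v s := tensor fun i => meanX₂VS p q₁ ρ (x₂ i) (v i) (s i)
  ρ₂ x₁ u s := tensor fun i => meanX₁US p q₂ ρ (x₁ i) (u i) (s i)
  ρ₃ w s := tensor fun i => meanWS p f q₁ q₂ ρ (w i) (s i)
  ρ₄ := tensor fun _ => meanB p f pS q₁ q₂ ρ
  P x₁ x₂ := specProj (fun i => ρ (x₁ i) (x₂ i)) (highSet (fun i => ρ (x₁ i) (x₂ i)) κ)
  P₂ x₁ u s := specProj (fun i => meanX₁US p q₂ ρ (x₁ i) (u i) (s i))
    (lowSet (fun i => meanX₁US p q₂ ρ (x₁ i) (u i) (s i)) l₂)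
  P₃ w s := specProj (fun i => meanWS p f q₁ q₂ ρ (w i) (s i))
    (lowSet (fun i => meanWS p f q₁ q₂ ρ (w i) (s i)) l₃)
  P₄ := specProj (fun _ => meanB p f pS q₁ q₂ ρ) (lowSet (fun _ => meanB p f pS q₁ q₂ ρ) l₄)
  Q x₂ v s := specProj (fun i => meanX₂VS p q₁ ρ (x₂ i) (v i) (s i))
    (lowSet (fun i => meanX₂VS p q₁ ρ (x₂ i) (v i) (s i)) l₁)
  κ := κ
  l₁ := l₁
  l₂ := l₂
  l₃ := l₃
  l₄ := l₄
  N₁ := N₁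
  N₂ := N₂
  N₃ := N₃
  N₄ := N₄
  β₁ := β
  β₂ := β
  β₃ := β
  β₄ := β
  p_nonneg u v := Finset.prod_nonneg fun i _ => hp.1 _
  p_sum := by
    rw [← sum_pi_prod (fun u v => ∏ i, p (u i, v i))]
    exact sum_pi_prod_eq_one (w := fun _ => p) fun _ => hp.2
  pS_nonneg s := Finset.prod_nonneg fun i _ => hpS.1 _
  pS_sum := sum_pi_prod_eq_one fun _ => hpS.2
  q₁_nonneg u s x := Finset.prod_nonneg fun i _ => (hq₁ _ _).1 _
  q₁_sum u s := sum_pi_prod_eq_one fun _ => (hq₁ _ _).2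
  q₂_nonneg v s x := Finset.prod_nonneg fun i _ => (hq₂ _ _).1 _
  q₂_sum v s := sum_pi_prod_eq_one fun _ => (hq₂ _ _).2
  ρ_nonneg x₁ x₂ := tensor_nonneg fun i => density_nonneg (hρ _ _)
  ρ_trace x₁ x₂ := by
    rw [tensor_trace]
    exact Finset.prod_eq_one fun i _ => (hρ _ _).2
  t_zero_or_one u v := by
    by_cases h : (fun i => (u i, v i)) ∈ typicalSet p f N₁ N₂ N₃ N₄ n <;> simp [h]
  t_common u v h := funext fun i => hfg _ _ ((indicator_ne_zero h).1 i)
  pV_nonneg v := Finset.prod_nonneg fun i _ => marginal_source_nonneg hp.1 _ _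
  pV_sum := sum_pi_prod_eq_one fun _ => by rw [sum_marginal, hp.2]
  pW_nonneg w := Finset.prod_nonneg fun i _ => marginal_source_nonneg hp.1 _ _
  aU_nonneg u := Finset.prod_nonneg fun i _ => condUW_nonneg hp.1 _
  bU_nonneg u v := Finset.prod_nonneg fun i _ => condV_nonneg hp.1 _ _
  bV_sum v := sum_pi_prod_le_one (fun _ _ => condU_nonneg hp.1 _ _) fun _ => sum_condU_le _
  p_eq u v := by
    rw [← Finset.prod_mul_distrib]
    exact Finset.prod_congr rfl fun i _ => (marginal_mul_condU hp.1 _ _).symm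
  ρ₁_eq x₂ v s := by
    simp only [meanX₂VS, tensor_sum]
  ρ₂_eq x₁ u s := by
    simp only [meanX₁US, tensor_sum]
  ρ₃_eq w s := by
    simp only [meanWS, tensor_sum]
    refine Finset.sum_congr rfl fun u _ => ?_
    rw [Finset.prod_ite_zero]
    simp only [Finset.mem_univ, true_imp_iff, funext_iff, ite_smul, zero_smul]
  ρ₄_eq := by
    simp only [meanB, tensor_sum]
  P_proj _ _ := specProj_isStarProjection
  P₂_proj _ _ _ := specProj_isStarProjection
  P₃_proj _ _ := specProj_isStarProjection
  P₄_proj := specProj_isStarProjection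
  Q_proj _ _ _ := specProj_isStarProjection
  P_le x₁ x₂ := specProj_le_smul (fun i => density_nonneg (hρ _ _)) hκ fun j hj => hj
  Q_le x₂ v s := specProj_conj_le_smul_one
    (fun i => meanX₂VS_nonneg hp.1 (fun u s => (hq₁ u s).1) (fun _ _ => density_nonneg (hρ _ _))
      _ _ _) hl₁ fun j hj => hj
  P₂_le x₁ u s := specProj_conj_le_smul_one
    (fun i => meanX₁US_nonneg hp.1 (fun u s => (hq₂ u s).1) (fun _ _ => density_nonneg (hρ _ _))
      _ _ _) hl₂ fun j hj => hj
  P₂_le' x₁ u s := specProj_conj_le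
    (fun i => meanX₁US_nonneg hp.1 (fun u s => (hq₂ u s).1) (fun _ _ => density_nonneg (hρ _ _))
      _ _ _)
  P₃_le w s := specProj_conj_le_smul_one
    (fun i => meanWS_nonneg hp.1 (fun u s => (hq₁ u s).1) (fun u s => (hq₂ u s).1)
      (fun _ _ => density_nonneg (hρ _ _)) _ _) hl₃ fun j hj => hj
  P₃_le' w s := specProj_conj_le
    (fun i => meanWS_nonneg hp.1 (fun u s => (hq₁ u s).1) (fun u s => (hq₂ u s).1)
      (fun _ _ => density_nonneg (hρ _ _)) _ _)
  P₄_le := specProj_conj_le_smul_one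
    (fun i => meanB_nonneg hp.1 hpS.1 (fun u s => (hq₁ u s).1) (fun u s => (hq₂ u s).1)
      (fun _ _ => density_nonneg (hρ _ _))) hl₄ fun j hj => hj
  κ_nonneg := hκ
  l₁_nonneg := hl₁
  l₂_nonneg := hl₂
  l₃_nonneg := hl₃
  N₁_nonneg := hN₁
  N₂_nonneg := hN₂
  N₃_nonneg := hN₃
  N₄_nonneg := hN₄
  t_le₁ u v := indicator_le_mul_prod hN₁ (Finset.prod_nonneg fun i _ => condU_nonneg hp.1 _ _)
    fun h => one_le_mul_prod_of_likely hp.1 h.1 h.2.1 fun i => marginal_mul_condU hp.1 _ _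
  t_le₂ u v := indicator_le_mul_prod hN₂ (Finset.prod_nonneg fun i _ => condV_nonneg hp.1 _ _)
    fun h => one_le_mul_prod_of_likely hp.1 h.1 h.2.2.1 fun i => marginal_mul_condV hp.1 _ _
  t_le₃ u v := by
    rw [← Finset.prod_mul_distrib]
    exact indicator_le_mul_prod hN₃ (Finset.prod_nonneg fun i _ =>
      mul_nonneg (condUW_nonneg hp.1 _) (condV_nonneg hp.1 _ _))
      fun h => one_le_mul_prod_of_likely hp.1 h.1 h.2.2.2.1
        fun i => marginal_mul_condUW_mul_condV hp.1 _ _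
  t_le₄ u v := by
    rw [← Finset.prod_mul_distrib, ← Finset.prod_mul_distrib]
    refine indicator_le_mul_prod hN₄ (Finset.prod_nonneg fun i _ =>
      mul_nonneg (mul_nonneg (marginal_source_nonneg hp.1 _ _) (condUW_nonneg hp.1 _))
        (condV_nonneg hp.1 _ _))
      fun h => one_le_mul_prod_of_likely hp.1 h.1 h.2.2.2.2 fun i => ?_
    rw [mul_assoc, marginal_mul_condUW_mul_condV hp.1]
    simp [marginal, hp.2]
  β₁_nonneg := hβ
  β₂_nonneg := hβ
  β₃_nonneg := hβ
  β₄_nonneg := hβ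
  bound₁ := b₁.imp_right fun h u u' v hz hz' => funext fun i =>
    (Prod.ext_iff.1 (eq_of_typical hp.1 h hz' hz (fun _ => rfl) i)).1
  bound₂ := b₂.imp_right fun h u v v' hz hz' => funext fun i =>
    (Prod.ext_iff.1 (eq_of_typical hp.1 h hz' hz (fun _ => rfl) i)).2
  bound₃ := b₃.imp_right fun h u v u' v' hz hz' hf => funext fun i =>
    (Prod.ext_iff.1 (eq_of_typical hp.1 h hz' hz (fun i => congrFun hf i) i)).1
  bound₄ := b₄.imp_right fun h u v u' v' hz hz' => funext fun i =>
    congrArg (fun z : U × V => f z.1) (eq_of_typical (z := fun i => (u' i, v' i))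
      (z' := fun i => (u i, v i)) hp.1 h hz' hz (fun _ => rfl) i)

end Block

/-! ### Reliable transmission -/

section Reliable

variable {U V S X₁ X₂ B : Type*} [Fintype U] [Fintype V] [Fintype S] [Fintype X₁] [Fintype X₂]
  [Fintype B] [DecidableEq B] [DecidableEq U] [DecidableEq V] [DecidableEq S] [DecidableEq X₁]
  [DecidableEq X₂] {k : ℕ}
  {p : U × V → ℝ} {f : U → Fin k} {g : V → Fin k} {pS : S → ℝ} {q₁ : U → S → X₁ → ℝ}
  {q₂ : V → S → X₂ → ℝ} {ρ : X₁ → X₂ → Matrix B B ℂ}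

/-- Averages over a block of the random variables `u`, `v`, `s`, `x₁`, `x₂`. -/
lemma sum_block {n : ℕ}
    (F : (Fin n → U) → (Fin n → V) → (Fin n → S) → (Fin n → X₁) → (Fin n → X₂) → ℝ) :
    ∑ u : Fin n → U, ∑ v : Fin n → V, (∏ i, p (u i, v i)) * ∑ s : Fin n → S, (∏ i, pS (s i)) *
      ∑ x₁ : Fin n → X₁, (∏ i, q₁ (u i) (s i) (x₁ i)) *
      ∑ x₂ : Fin n → X₂, (∏ i, q₂ (v i) (s i) (x₂ i)) * F u v s x₁ x₂ =
    ∑ ω : Fin n → U × V × S × X₁ × X₂, (∏ i, jointDist p pS q₁ q₂ (ω i)) *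
      F (fun i => (ω i).1) (fun i => (ω i).2.1) (fun i => (ω i).2.2.1) (fun i => (ω i).2.2.2.1)
        (fun i => (ω i).2.2.2.2) := by
  refine Eq.trans ?_ (sum_pi_prod fun u (r : Fin n → V × S × X₁ × X₂) =>
    (∏ i, jointDist p pS q₁ q₂ (u i, r i)) * F u (fun i => (r i).1) (fun i => (r i).2.1)
      (fun i => (r i).2.2.1) (fun i => (r i).2.2.2)).symm
  refine Finset.sum_congr rfl fun u _ => Eq.trans ?_
    (sum_pi_prod fun v (r : Fin n → S × X₁ × X₂) =>
    (∏ i, jointDist p pS q₁ q₂ (u i, v i, r i)) * F u v (fun i => (r i).1) (fun i => (r i).2.1)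
      (fun i => (r i).2.2)).symm
  refine Finset.sum_congr rfl fun v _ => ?_
  rw [Finset.mul_sum]
  refine Eq.trans ?_ (sum_pi_prod fun s (r : Fin n → X₁ × X₂) =>
    (∏ i, jointDist p pS q₁ q₂ (u i, v i, s i, r i)) * F u v s (fun i => (r i).1)
      (fun i => (r i).2)).symm
  refine Finset.sum_congr rfl fun s _ => ?_
  rw [Finset.mul_sum, Finset.mul_sum]
  refine Eq.trans ?_ (sum_pi_prod fun x₁ x₂ =>
    (∏ i, jointDist p pS q₁ q₂ (u i, v i, s i, x₁ i, x₂ i)) * F u v s x₁ x₂).symm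
  refine Finset.sum_congr rfl fun x₁ _ => ?_
  rw [Finset.mul_sum, Finset.mul_sum, Finset.mul_sum]
  refine Finset.sum_congr rfl fun x₂ _ => ?_
  simp only [jointDist, Finset.prod_mul_distrib]
  ring

/-- The probability of an atypical source sequence. -/
lemma tendsto_atypical (hp : p ∈ stdSimplex ℝ (U × V)) {δ : ℝ} (hδ : 0 < δ) :
    Tendsto (fun n : ℕ => ∑ u : Fin n → U, ∑ v : Fin n → V, (∏ i, p (u i, v i)) *
      (1 - (typicalSet p f (Real.exp (n * (sourceEntropy p (fun z => z.2) + δ)))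
        (Real.exp (n * (sourceEntropy p (fun z => z.1) + δ)))
        (Real.exp (n * (sourceEntropy p (fun z => f z.1) + δ)))
        (Real.exp (n * (sourceEntropy p (fun _ => ()) + δ))) n).indicator 1
          fun i => (u i, v i))) atTop (𝓝 0) := by
  have hlim := (((tendsto_likely hp (fun z => z.2) hδ).add
    (tendsto_likely hp (fun z => z.1) hδ)).add (tendsto_likely hp (fun z => f z.1) hδ)).add
    (tendsto_likely hp (fun _ => ()) hδ)
  simp only [add_zero] at hlim
  refine squeeze_zero (fun n => Finset.sum_nonneg fun u _ => Finset.sum_nonneg fun v _ =>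
    mul_nonneg (Finset.prod_nonneg fun i _ => hp.1 _) (sub_nonneg.2 ?_)) (fun n => ?_) hlim
  · exact Set.indicator_apply_le' (fun _ => le_rfl) fun _ => zero_le_one
  rw [← sum_pi_prod (fun u v => (∏ i, p (u i, v i)) * (1 - Set.indicator _ _ _)),
    ← Finset.sum_add_distrib, ← Finset.sum_add_distrib, ← Finset.sum_add_distrib]
  refine Finset.sum_le_sum fun z _ => ?_
  have hnn : 0 ≤ ∏ i, p (z i) := Finset.prod_nonneg fun i _ => hp.1 _
  have hind : ∀ T : Set (Fin n → U × V), 0 ≤ Tᶜ.indicator (fun z => ∏ i, p (z i)) z :=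
    fun T => Set.indicator_apply_nonneg fun _ => hnn
  have hind' : ∀ T : Set (Fin n → U × V), z ∉ T →
      Tᶜ.indicator (fun z => ∏ i, p (z i)) z = ∏ i, p (z i) :=
    fun T hT => Set.indicator_of_mem (Set.mem_compl hT) _
  by_cases h0 : ∀ i, p (z i) ≠ 0
  swap
  · push Not at h0
    obtain ⟨i, hi⟩ := h0
    have hz : ∏ i, p (z i) = 0 := Finset.prod_eq_zero (Finset.mem_univ i) hi
    change (∏ i, p (z i)) * _ ≤ _
    rw [hz, zero_mul]
    exact add_nonneg (add_nonneg (add_nonneg (hind _) (hind _)) (hind _)) (hind _)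
  change (∏ i, p (z i)) * (1 - Set.indicator _ _ z) ≤ _
  by_cases hz : z ∈ typicalSet p f (Real.exp (n * (sourceEntropy p (fun z => z.2) + δ)))
        (Real.exp (n * (sourceEntropy p (fun z => z.1) + δ)))
        (Real.exp (n * (sourceEntropy p (fun z => f z.1) + δ)))
        (Real.exp (n * (sourceEntropy p (fun _ => ()) + δ))) n
  · rw [Set.indicator_of_mem hz, Pi.one_apply, sub_self, mul_zero]
    exact add_nonneg (add_nonneg (add_nonneg (hind _) (hind _)) (hind _)) (hind _)
  rw [Set.indicator_of_notMem hz, sub_zero, mul_one]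
  have hsome := not_and.1 hz h0
  simp only [not_and_or] at hsome
  rcases hsome with h | h | h | h
  · linarith [hind' _ h, hind (likelySet p (fun z => z.1)
      (Real.exp (n * (sourceEntropy p (fun z => z.1) + δ))) n), hind (likelySet p (fun z => f z.1)
      (Real.exp (n * (sourceEntropy p (fun z => f z.1) + δ))) n), hind (likelySet p (fun _ => ())
      (Real.exp (n * (sourceEntropy p (fun _ => ()) + δ))) n)]
  · linarith [hind' _ h, hind (likelySet p (fun z => z.2)
      (Real.exp (n * (sourceEntropy p (fun z => z.2) + δ))) n), hind (likelySet p (fun z => f z.1)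
      (Real.exp (n * (sourceEntropy p (fun z => f z.1) + δ))) n), hind (likelySet p (fun _ => ())
      (Real.exp (n * (sourceEntropy p (fun _ => ()) + δ))) n)]
  · linarith [hind' _ h, hind (likelySet p (fun z => z.2)
      (Real.exp (n * (sourceEntropy p (fun z => z.2) + δ))) n), hind (likelySet p (fun z => z.1)
      (Real.exp (n * (sourceEntropy p (fun z => z.1) + δ))) n), hind (likelySet p (fun _ => ())
      (Real.exp (n * (sourceEntropy p (fun _ => ()) + δ))) n)]
  · linarith [hind' _ h, hind (likelySet p (fun z => z.2)
      (Real.exp (n * (sourceEntropy p (fun z => z.2) + δ))) n), hind (likelySet p (fun z => z.1)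
      (Real.exp (n * (sourceEntropy p (fun z => z.1) + δ))) n), hind (likelySet p (fun z => f z.1)
      (Real.exp (n * (sourceEntropy p (fun z => f z.1) + δ))) n)]

lemma errorProb_nonneg (hp : p ∈ stdSimplex ℝ (U × V)) (hρ : ∀ x₁ x₂, IsDensityMatrix (ρ x₁ x₂))
    {n : ℕ} {e₁ : (Fin n → U) → (Fin n → X₁)} {e₂ : (Fin n → V) → (Fin n → X₂)}
    {Λ : (Fin n → U) × (Fin n → V) → Matrix (Fin n → B) (Fin n → B) ℂ} (hΛ : IsPOVM Λ) :
    0 ≤ errorProb p ρ e₁ e₂ Λ := by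
  refine Finset.sum_nonneg fun uv _ => mul_nonneg (Finset.prod_nonneg fun i _ => hp.1 _) ?_
  refine trRe_nonneg (sub_nonneg.2 ?_) (tensor_nonneg fun i => density_nonneg (hρ _ _))
  rw [← hΛ.2]
  exact Finset.single_le_sum (fun j _ => nonneg_iff_posSemidef.2 (hΛ.1 j)) (Finset.mem_univ uv)

/-- The exponential decay of the bound for one type of confusion: the three factors are the number
of competitors, the operator norm of the mean output, and the inverse eigenvalue of the output. -/
lemma exp_rate_le {n : ℕ} {H I h h₀ δ : ℝ} (hI : I = h - h₀) (hH : H + 4 * δ ≤ I) :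
    Real.exp (n * (H + δ)) * Real.exp (-(n * (h - δ))) * Real.exp (n * (h₀ + δ)) ≤
      Real.exp (-(n * δ)) := by
  rw [← Real.exp_add, ← Real.exp_add, Real.exp_le_exp]
  have := mul_le_mul_of_nonneg_left hH (Nat.cast_nonneg n)
  rw [hI] at this
  linarith

/-- A strict inequality leaves room for a multiple of `δ`; a waived one needs none. -/
lemma exists_slack_of_covered {H I : ℝ} (h : Covered H I) :
    ∃ δ > 0, ∀ δ' ≤ δ, H + 4 * δ' ≤ I ∨ H = 0 := by
  rcases h with h | h
  · exact ⟨(I - H) / 4, by linarith, fun δ' h' => Or.inl (by linarith)⟩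
  · exact ⟨1, one_pos, fun _ _ => Or.inr h⟩

open IsLabelAverage in
/-- Codes of all block lengths under the rate conditions; `h₀`, …, `h₄` are the entropies of the
channel output given `x₁ x₂`, given `x₂ v s`, given `x₁ u s`, given `w s`, and given nothing. -/
theorem reliablyTransmissible_of_covered (hp : p ∈ stdSimplex ℝ (U × V))
    (hρ : ∀ x₁ x₂, IsDensityMatrix (ρ x₁ x₂))
    (hpS : pS ∈ stdSimplex ℝ S) (hq₁ : ∀ u s, q₁ u s ∈ stdSimplex ℝ X₁)
    (hq₂ : ∀ v s, q₂ v s ∈ stdSimplex ℝ X₂) (hfg : ∀ u v, p (u, v) ≠ 0 → f u = g v)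
    {h₀ h₁ h₂ h₃ h₄ : ℝ}
    (e₀ : h₀ = condEntropyB (jointDist p pS q₁ q₂) (jointState ρ)
      (fun ω => (ω.2.2.2.1, ω.2.2.2.2)))
    (e₁ : h₁ = condEntropyB (jointDist p pS q₁ q₂) (jointState ρ)
      (fun ω => (ω.2.2.2.2, ω.2.1, ω.2.2.1)))
    (e₂ : h₂ = condEntropyB (jointDist p pS q₁ q₂) (jointState ρ)
      (fun ω => (ω.2.2.2.1, ω.1, ω.2.2.1)))
    (e₃ : h₃ = condEntropyB (jointDist p pS q₁ q₂) (jointState ρ) (fun ω => (f ω.1, ω.2.2.1)))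
    (e₄ : h₄ = condEntropyB (jointDist p pS q₁ q₂) (jointState ρ) (fun _ => ()))
    (c₁ : Covered (sourceEntropy p fun z => z.2) (h₁ - h₀))
    (c₂ : Covered (sourceEntropy p fun z => z.1) (h₂ - h₀))
    (c₃ : Covered (sourceEntropy p fun z => f z.1) (h₃ - h₀))
    (c₄ : Covered (sourceEntropy p fun _ => ()) (h₄ - h₀)) :
    ReliablyTransmissible p ρ := by
  obtain ⟨δ₁, hδ₁, s₁⟩ := exists_slack_of_covered c₁
  obtain ⟨δ₂, hδ₂, s₂⟩ := exists_slack_of_covered c₂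
  obtain ⟨δ₃, hδ₃, s₃⟩ := exists_slack_of_covered c₃
  obtain ⟨δ₄, hδ₄, s₄⟩ := exists_slack_of_covered c₄
  obtain ⟨δ, hδ, d₁, d₂, d₃, d₄⟩ : ∃ δ > 0, δ ≤ δ₁ ∧ δ ≤ δ₂ ∧ δ ≤ δ₃ ∧ δ ≤ δ₄ :=
    ⟨min (min δ₁ δ₂) (min δ₃ δ₄), by positivity, by simp, by simp, by simp, by simp⟩
  have a₀ := isLabelAverage_x₁x₂ hp hρ hpS hq₁ hq₂
  have a₁ := isLabelAverage_x₂vs hp hρ hpS hq₁ hq₂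
  have a₂ := isLabelAverage_x₁us hp hρ hpS hq₁ hq₂
  have a₃ := isLabelAverage_ws (f := f) hp hρ hpS hq₁ hq₂
  have a₄ := isLabelAverage_unit (f := f) hp hρ hpS hq₁ hq₂
  have t₀ := a₀.tendsto_high hδ
  have t₁ := a₁.tendsto_low hδ
  have t₂ := a₂.tendsto_low hδ
  have t₃ := a₃.tendsto_low hδ
  have t₄ := a₄.tendsto_low hδ
  rw [← a₀.condEntropyB_eq, ← e₀] at t₀
  rw [← a₁.condEntropyB_eq, ← e₁] at t₁
  rw [← a₂.condEntropyB_eq, ← e₂] at t₂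
  rw [← a₃.condEntropyB_eq, ← e₃] at t₃
  rw [← a₄.condEntropyB_eq, ← e₄] at t₄
  set d : ∀ n : ℕ, CodeSetup (Fin n → U) (Fin n → V) (Fin n → Fin k) (Fin n → S) (Fin n → X₁)
      (Fin n → X₂) (Fin n → B) := fun n => blockSetup (κ := Real.exp (n * (h₀ + δ)))
    (l₁ := Real.exp (-(n * (h₁ - δ)))) (l₂ := Real.exp (-(n * (h₂ - δ))))
    (l₃ := Real.exp (-(n * (h₃ - δ)))) (l₄ := Real.exp (-(n * (h₄ - δ))))
    (N₁ := Real.exp (n * (sourceEntropy p (fun z => z.2) + δ)))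
    (N₂ := Real.exp (n * (sourceEntropy p (fun z => z.1) + δ)))
    (N₃ := Real.exp (n * (sourceEntropy p (fun z => f z.1) + δ)))
    (N₄ := Real.exp (n * (sourceEntropy p (fun _ => ()) + δ))) (β := Real.exp (-(n * δ)))
    hp hρ hpS hq₁ hq₂ hfg n (Real.exp_nonneg _) (Real.exp_nonneg _) (Real.exp_nonneg _)
    (Real.exp_nonneg _) (Real.exp_nonneg _) (Real.exp_nonneg _) (Real.exp_nonneg _)
    (Real.exp_nonneg _) (Real.exp_nonneg _) (Real.exp_nonneg _)
    ((s₁ δ d₁).imp_left fun h => exp_rate_le rfl h)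
    ((s₂ δ d₂).imp_left fun h => (mul_right_comm _ _ _).trans_le (exp_rate_le rfl h))
    ((s₃ δ d₃).imp_left fun h => (mul_right_comm _ _ _).trans_le (exp_rate_le rfl h))
    ((s₄ δ d₄).imp_left fun h => (mul_right_comm _ _ _).trans_le (exp_rate_le rfl h)) with hd
  set η : ℕ → ℝ := fun n => ∑ u, ∑ v, (d n).p u v * ∑ s, (d n).pS s * ∑ x₁, (d n).q₁ u s x₁ *
    ∑ x₂, (d n).q₂ v s x₂ * (d n).miss u v s x₁ x₂ with hη
  have hη0 : Tendsto η atTop (𝓝 0) := by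
    have ht := (((t₁.add t₄).add t₃).add t₂).add t₀
    simp only [add_zero] at ht
    refine ht.congr fun n => Eq.symm ?_
    refine (sum_block (n := n) (p := p) (pS := pS) (q₁ := q₁) (q₂ := q₂) (d n).miss).trans ?_
    rw [← Finset.sum_add_distrib, ← Finset.sum_add_distrib, ← Finset.sum_add_distrib,
      ← Finset.sum_add_distrib]
    refine Finset.sum_congr rfl fun ω _ => ?_
    rw [CodeSetup.miss, map_add, map_add, map_add, map_add]
    have hdist : ∀ a b₁ b₂ b₃ b₄ b₅ : ℝ,
        a * (b₁ + b₂ + b₃ + b₄ + b₅) = a * b₁ + a * b₂ + a * b₃ + a * b₄ + a * b₅ := by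
      intros; ring
    simp only [LinearMap.add_apply]
    rw [hdist]
    rfl
  have hne : Nonempty (U × V) := by
    by_contra h
    rw [not_nonempty_iff] at h
    simpa using hp.2
  obtain ⟨⟨u₀, v₀⟩⟩ := hne
  have hU : ∀ n, Nonempty (Fin n → U) := fun n => ⟨fun _ => u₀⟩
  have hV : ∀ n, Nonempty (Fin n → V) := fun n => ⟨fun _ => v₀⟩
  have hcode := fun n => (d n).exists_code (η := η n) (ε := 1 / ((n : ℝ) + 1)) (by positivity)
    le_rfl
  choose E₁ E₂ Λ hΛ hle using hcode
  have hA : Tendsto (fun n => ∑ u, ∑ v, (d n).p u v * (1 - (d n).t u v)) atTop (𝓝 0) :=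
    tendsto_atypical (f := f) hp hδ
  have herr : ∀ n, errorProb p ρ (E₁ n) (E₂ n) (Λ n) ≤
      ∑ u, ∑ v, (d n).p u v * (1 - (d n).t u v) + (96 * η n + 8 * (1 / ((n : ℝ) + 1)) +
        8 * (Real.exp (-(n * δ)) + Real.exp (-(n * δ)) + Real.exp (-(n * δ)) +
          Real.exp (-(n * δ)))) := by
    intro n
    refine le_trans (le_of_eq ?_) (hle n)
    rw [errorProb, Fintype.sum_prod_type]
    rfl
  refine ⟨E₁, E₂, Λ, hΛ, squeeze_zero (fun n => errorProb_nonneg hp hρ (hΛ n)) herr ?_⟩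
  · have hexp : Tendsto (fun n : ℕ => Real.exp (-((n : ℝ) * δ))) atTop (𝓝 0) :=
      Real.tendsto_exp_neg_atTop_nhds_zero.comp
        (tendsto_natCast_atTop_atTop.atTop_mul_const hδ)
    have h := hA.add (((hη0.const_mul 96).add
      (tendsto_one_div_add_atTop_nhds_zero_nat.const_mul (8 : ℝ))).add
      ((((hexp.add hexp).add hexp).add hexp).const_mul 8))
    simpa using h

end Reliable

/-! ### Reducing the support of the auxiliary variable -/

/-- A nonnegative weight can be moved to at most `finrank E` points without changing the mean of
`a : S → E` and without decreasing the mean of `c`, provided that `a` has its values in an affine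
hyperplane off the origin. -/
lemma exists_weight_card_support_le {S E : Type*} [Fintype S] [DecidableEq S] [AddCommGroup E]
    [Module ℝ E] [Module.Finite ℝ E] (a : S → E) (ℓ : E →ₗ[ℝ] ℝ) (hℓ : ∀ s, ℓ (a s) = 1)
    (c : S → ℝ) (w : S → ℝ) (hw : ∀ s, 0 ≤ w s) :
    ∃ w' : S → ℝ, (∀ s, 0 ≤ w' s) ∧ ∑ s, w' s • a s = ∑ s, w s • a s ∧
      ∑ s, w s * c s ≤ ∑ s, w' s * c s ∧
      (Finset.univ.filter fun s => w' s ≠ 0).card ≤ Module.finrank ℝ E := by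
  induction h : (Finset.univ.filter fun s => w s ≠ 0).card using Nat.strong_induction_on
    generalizing w with
  | _ N ih =>
  by_cases hN : N ≤ Module.finrank ℝ E
  · exact ⟨w, hw, rfl, le_rfl, h.trans_le hN⟩
  set T := Finset.univ.filter fun s => w s ≠ 0 with hT
  have hdep : ¬ LinearIndepOn ℝ a (T : Set S) := by
    intro hli
    have := LinearIndependent.fintype_card_le_finrank (R := ℝ) (b := fun s : T => a s) hli
    rw [Fintype.card_coe, h] at this
    exact hN this
  obtain ⟨r, hr, s₁, hs₁, hrs₁⟩ := not_linearIndepOn_finset_iff.1 hdep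
  -- a direction supported on `T` that keeps the mean of `a` and does not decrease that of `c`
  obtain ⟨y, hyT, hya, hyc, s₂, hys₂⟩ : ∃ y : S → ℝ, (∀ s, w s = 0 → y s = 0) ∧
      ∑ s, y s • a s = 0 ∧ 0 ≤ ∑ s, y s * c s ∧ ∃ s, y s ≠ 0 := by
    set x : S → ℝ := fun s => if s ∈ T then r s else 0 with hx
    have hxT : ∀ s, w s = 0 → x s = 0 := fun s hs => by simp [hx, hT, hs]
    have hxa : ∑ s, x s • a s = 0 := by
      rw [← hr, ← Finset.sum_subset (Finset.subset_univ T)]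
      · exact Finset.sum_congr rfl fun s hs => by simp only [hx, if_pos hs]
      · intro s _ hs
        simp only [hx, if_neg hs, zero_smul]
    have hxs : x s₁ ≠ 0 := by simpa only [hx, if_pos hs₁] using hrs₁
    rcases le_total 0 (∑ s, x s * c s) with hc | hc
    · exact ⟨x, hxT, hxa, hc, s₁, hxs⟩
    · refine ⟨-x, fun s hs => by simp [hxT s hs], ?_, ?_, s₁, by simpa using hxs⟩
      · simp [hxa]
      · simpa using hc
  have hysum : ∑ s, y s = 0 := by
    have := congrArg ℓ hya
    simpa [hℓ] using this
  -- the coordinate that vanishes first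
  have hneg : (Finset.univ.filter fun s => y s < 0).Nonempty := by
    by_contra hemp
    rw [Finset.not_nonempty_iff_eq_empty, Finset.filter_eq_empty_iff] at hemp
    have hy0 : ∀ s ∈ Finset.univ, 0 ≤ y s := fun s hs => not_lt.1 (hemp hs)
    exact hys₂ ((Finset.sum_eq_zero_iff_of_nonneg hy0).1 hysum s₂ (Finset.mem_univ _))
  obtain ⟨s₃, hs₃, hmin⟩ := Finset.exists_min_image _ (fun s => w s / (-y s)) hneg
  have hy₃ : y s₃ < 0 := (Finset.mem_filter.1 hs₃).2
  set τ := w s₃ / (-y s₃) with hτ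
  have hτ0 : 0 ≤ τ := div_nonneg (hw _) (neg_nonneg.2 hy₃.le)
  have hw' : ∀ s, 0 ≤ w s + τ * y s := by
    intro s
    rcases lt_or_ge (y s) 0 with hs | hs
    · have h1 : τ ≤ w s / (-y s) := hmin s (Finset.mem_filter.2 ⟨Finset.mem_univ _, hs⟩)
      rw [le_div_iff₀ (neg_pos.2 hs)] at h1
      linarith
    · exact add_nonneg (hw s) (mul_nonneg hτ0 hs)
  have hlt : (Finset.univ.filter fun s => w s + τ * y s ≠ 0).card < N := by
    rw [← h]
    refine Finset.card_lt_card (Finset.ssubset_iff_of_subset ?_ |>.2 ⟨s₃, ?_, ?_⟩)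
    · intro s hs
      rw [hT]
      simp only [Finset.mem_filter, Finset.mem_univ, true_and] at hs ⊢
      intro h0
      exact hs (by rw [h0, hyT s h0]; simp)
    · rw [hT]
      simp only [Finset.mem_filter, Finset.mem_univ, true_and]
      exact fun h0 => hy₃.ne (hyT _ h0)
    · simp only [Finset.mem_filter, Finset.mem_univ, true_and, not_not]
      rw [hτ, div_mul_eq_mul_div, div_neg, mul_div_cancel_right₀ _ hy₃.ne]
      ring
  obtain ⟨w', h0, h1, h2, h3⟩ := ih _ hlt _ hw' rfl
  refine ⟨w', h0, h1.trans ?_, le_trans ?_ h2, h3⟩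
  · simp only [add_smul, Finset.sum_add_distrib, mul_smul]
    rw [← Finset.smul_sum, hya, smul_zero, add_zero]
  · simp only [add_mul, Finset.sum_add_distrib, mul_assoc]
    rw [← Finset.mul_sum]
    linarith [mul_nonneg hτ0 hyc]

/-- An enumeration of the support of a weight. -/
def supportEnum {S : Type*} [Fintype S] (w : S → ℝ)
    (j : Fin (Finset.univ.filter fun s => w s ≠ 0).card) : S :=
  (Finset.univ.filter fun s => w s ≠ 0).equivFin.symm j

lemma sum_supportEnum {S M : Type*} [Fintype S] [AddCommGroup M] [Module ℝ M] (w : S → ℝ)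
    (F : S → M) : ∑ j, w (supportEnum w j) • F (supportEnum w j) = ∑ s, w s • F s := by
  rw [← Finset.sum_subset (Finset.subset_univ (Finset.univ.filter fun s => w s ≠ 0)),
    ← Finset.sum_coe_sort (Finset.univ.filter fun s => w s ≠ 0) fun s => w s • F s]
  · exact Fintype.sum_equiv (Finset.univ.filter fun s => w s ≠ 0).equivFin.symm _ _ fun j => rfl
  · intro s _ hs
    have : w s = 0 := by simpa using hs
    rw [this, zero_smul]

lemma covered_mono {h i i' : ℝ} (hc : Covered h i) (hi : i ≤ i') : Covered h i' :=
  hc.imp_left fun h => h.trans_le hi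

section Info

variable {U V S X₁ X₂ B : Type*} [Fintype U] [Fintype V] [Fintype S] [Fintype X₁] [Fintype X₂]
  [Fintype B] [DecidableEq B] [DecidableEq U] [DecidableEq V] [DecidableEq S] [DecidableEq X₁]
  [DecidableEq X₂] {k : ℕ}
  {p : U × V → ℝ} {f : U → Fin k} {g : V → Fin k} {pS : S → ℝ} {q₁ : U → S → X₁ → ℝ}
  {q₂ : V → S → X₂ → ℝ} {ρ : X₁ → X₂ → Matrix B B ℂ}

/-- Replacing the distribution of `s`: it suffices to preserve four of the means entering the
information inequalities, and not to decrease the fifth. -/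
lemma exists_infoConditions_fin (hfg : ∀ u v, p (u, v) ≠ 0 → f u = g v)
    (hp : p ∈ stdSimplex ℝ (U × V)) (hρ : ∀ x₁ x₂, IsDensityMatrix (ρ x₁ x₂))
    (h : InfoConditions p f g ρ pS q₁ q₂) {w : S → ℝ} (hw : ∀ s, 0 ≤ w s)
    (hw1 : ∑ s, w s = 1)
    (h₁ : ∑ s, w s * entropyGivenX₂V p ρ (fun u => q₁ u s) (fun v => q₂ v s) =
      ∑ s, pS s * entropyGivenX₂V p ρ (fun u => q₁ u s) (fun v => q₂ v s))
    (h₂ : ∑ s, w s * entropyGivenX₁U p ρ (fun u => q₁ u s) (fun v => q₂ v s) =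
      ∑ s, pS s * entropyGivenX₁U p ρ (fun u => q₁ u s) (fun v => q₂ v s))
    (h₀ : ∑ s, w s * entropyGivenX₁X₂ p ρ (fun u => q₁ u s) (fun v => q₂ v s) =
      ∑ s, pS s * entropyGivenX₁X₂ p ρ (fun u => q₁ u s) (fun v => q₂ v s))
    (h₄ : ∑ s, w s • outputMean p ρ (fun u => q₁ u s) (fun v => q₂ v s) =
      ∑ s, pS s • outputMean p ρ (fun u => q₁ u s) (fun v => q₂ v s))
    (h₃ : ∑ s, pS s * entropyGivenW p f ρ (fun u => q₁ u s) (fun v => q₂ v s) ≤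
      ∑ s, w s * entropyGivenW p f ρ (fun u => q₁ u s) (fun v => q₂ v s)) :
    ∃ (pS' : Fin (Finset.univ.filter fun s => w s ≠ 0).card → ℝ)
      (q₁' : U → Fin (Finset.univ.filter fun s => w s ≠ 0).card → X₁ → ℝ)
      (q₂' : V → Fin (Finset.univ.filter fun s => w s ≠ 0).card → X₂ → ℝ),
      InfoConditions p f g ρ pS' q₁' q₂' := by
  set e := supportEnum w with he
  have he1 : ∀ F : S → ℝ, ∑ j, w (e j) * F (e j) = ∑ s, w s * F s := fun F =>
    sum_supportEnum (M := ℝ) w F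
  have he2 : ∀ F : S → Matrix B B ℂ, ∑ j, w (e j) • F (e j) = ∑ s, w s • F s :=
    sum_supportEnum w
  refine ⟨fun j => w (e j), fun u j => q₁ u (e j), fun v j => q₂ v (e j), ?_⟩
  have hi := (infoConditions_iff hfg hp hρ h.pmf_s h.pmf_x₁ h.pmf_x₂).1 h
  rw [infoConditions_iff hfg hp hρ ⟨fun j => hw _, ?_⟩ (fun u j => h.pmf_x₁ u _)
    (fun v j => h.pmf_x₂ v _)]
  · rw [he1 fun s => entropyGivenX₂V p ρ (fun u => q₁ u s) (fun v => q₂ v s),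
      he1 fun s => entropyGivenX₁U p ρ (fun u => q₁ u s) (fun v => q₂ v s),
      he1 fun s => entropyGivenX₁X₂ p ρ (fun u => q₁ u s) (fun v => q₂ v s),
      he1 fun s => entropyGivenW p f ρ (fun u => q₁ u s) (fun v => q₂ v s),
      he2 fun s => outputMean p ρ (fun u => q₁ u s) (fun v => q₂ v s), h₁, h₂, h₀, h₄]
    exact ⟨hi.1, hi.2.1, covered_mono hi.2.2.1 (sub_le_sub_right h₃ _), hi.2.2.2⟩
  · have := he1 fun _ => 1
    simpa [hw1] using this

lemma sum_weight_entropyGivenX₁X₂ (w : S → ℝ) :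
    ∑ s, w s * entropyGivenX₁X₂ p ρ (fun u => q₁ u s) (fun v => q₂ v s) =
      ∑ x₁, ∑ x₂, (∑ s, w s * pairDist p (fun u => q₁ u s) (fun v => q₂ v s) x₁ x₂) *
        vnEntropy (ρ x₁ x₂) := by
  simp only [entropyGivenX₁X₂, Finset.mul_sum, Finset.sum_mul, mul_assoc]
  rw [Finset.sum_comm]
  exact Finset.sum_congr rfl fun _ _ => Finset.sum_comm

lemma sum_weight_outputMean (w : S → ℝ) :
    ∑ s, w s • outputMean p ρ (fun u => q₁ u s) (fun v => q₂ v s) =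
      ∑ x₁, ∑ x₂, (∑ s, w s * pairDist p (fun u => q₁ u s) (fun v => q₂ v s) x₁ x₂) •
        ρ x₁ x₂ := by
  simp only [outputMean, Finset.smul_sum, Finset.sum_smul, smul_smul]
  rw [Finset.sum_comm]
  exact Finset.sum_congr rfl fun _ _ => Finset.sum_comm

lemma sum_pairDist (hp : p ∈ stdSimplex ℝ (U × V)) {r₁ : U → X₁ → ℝ} {r₂ : V → X₂ → ℝ}
    (h₁ : ∀ u, r₁ u ∈ stdSimplex ℝ X₁) (h₂ : ∀ v, r₂ v ∈ stdSimplex ℝ X₂) :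
    ∑ x₁, ∑ x₂, pairDist p r₁ r₂ x₁ x₂ = 1 := by
  have := sum_joint_pair (S := Unit) (M := ℝ) (p := p) (pS := fun _ => 1)
    (q₁ := fun u _ => r₁ u) (q₂ := fun v _ => r₂ v) fun _ _ => 1
  simp only [smul_eq_mul, mul_one, one_mul, Finset.univ_unique, Finset.sum_singleton] at this
  rw [← this]
  refine jointDist_sum hp ⟨fun _ => zero_le_one, by simp⟩ (fun u _ => h₁ u) (fun v _ => h₂ v)

lemma pairDist_nonneg (hp : p ∈ stdSimplex ℝ (U × V)) {r₁ : U → X₁ → ℝ} {r₂ : V → X₂ → ℝ}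
    (h₁ : ∀ u, r₁ u ∈ stdSimplex ℝ X₁) (h₂ : ∀ v, r₂ v ∈ stdSimplex ℝ X₂) (x₁ : X₁) (x₂ : X₂) :
    0 ≤ pairDist p r₁ r₂ x₁ x₂ :=
  Finset.sum_nonneg fun _ _ => Finset.sum_nonneg fun _ _ =>
    mul_nonneg (mul_nonneg (hp.1 _) ((h₁ _).1 _)) ((h₂ _).1 _)

/-- The bound by the number of pairs of codeword letters: the distribution of the pair and two
entropies are preserved. -/
lemma exists_infoConditions_card_pair (hfg : ∀ u v, p (u, v) ≠ 0 → f u = g v)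
    (hp : p ∈ stdSimplex ℝ (U × V)) (hρ : ∀ x₁ x₂, IsDensityMatrix (ρ x₁ x₂))
    (h : InfoConditions p f g ρ pS q₁ q₂) :
    ∃ m ≤ Fintype.card X₁ * Fintype.card X₂ + 2, ∃ (pS' : Fin m → ℝ)
      (q₁' : U → Fin m → X₁ → ℝ) (q₂' : V → Fin m → X₂ → ℝ),
      InfoConditions p f g ρ pS' q₁' q₂' := by
  obtain ⟨w, hw, ha, hc, hcard⟩ := exists_weight_card_support_le
    (E := (X₁ × X₂ → ℝ) × ℝ × ℝ)
    (fun s => (fun x => pairDist p (fun u => q₁ u s) (fun v => q₂ v s) x.1 x.2,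
      entropyGivenX₂V p ρ (fun u => q₁ u s) (fun v => q₂ v s),
      entropyGivenX₁U p ρ (fun u => q₁ u s) (fun v => q₂ v s)))
    ((∑ x, LinearMap.proj x) ∘ₗ LinearMap.fst ℝ _ _)
    (fun s => by
      simpa [Fintype.sum_prod_type] using
        sum_pairDist hp (fun u => h.pmf_x₁ u s) (fun v => h.pmf_x₂ v s))
    (fun s => entropyGivenW p f ρ (fun u => q₁ u s) (fun v => q₂ v s)) pS h.pmf_s.1
  have hd : ∀ x₁ x₂, ∑ s, w s * pairDist p (fun u => q₁ u s) (fun v => q₂ v s) x₁ x₂ =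
      ∑ s, pS s * pairDist p (fun u => q₁ u s) (fun v => q₂ v s) x₁ x₂ := by
    intro x₁ x₂
    simpa [Prod.fst_sum] using congrFun (congrArg Prod.fst ha) (x₁, x₂)
  have hw1 : ∑ s, w s = 1 := by
    have e : ∀ w : S → ℝ, ∑ s, w s = ∑ x₁, ∑ x₂,
        ∑ s, w s * pairDist p (fun u => q₁ u s) (fun v => q₂ v s) x₁ x₂ := by
      intro w
      rw [Finset.sum_congr rfl fun x₁ _ => Finset.sum_comm, Finset.sum_comm]
      refine Finset.sum_congr rfl fun s _ => ?_
      simp only [← Finset.mul_sum]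
      rw [sum_pairDist hp (fun u => h.pmf_x₁ u s) (fun v => h.pmf_x₂ v s), mul_one]
    rw [e]
    simp only [hd]
    rw [← e, h.pmf_s.2]
  refine ⟨_, ?_, exists_infoConditions_fin hfg hp hρ h hw hw1 ?_ ?_ ?_ ?_ hc⟩
  · refine hcard.trans (le_of_eq ?_)
    simp
  · simpa [Prod.fst_sum, Prod.snd_sum] using congrArg (fun z => z.2.1) ha
  · simpa [Prod.fst_sum, Prod.snd_sum] using congrArg (fun z => z.2.2) ha
  · simp only [sum_weight_entropyGivenX₁X₂, hd]
  · simp only [sum_weight_outputMean, hd]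

/-- The real coordinates `Re M i j + Im M i j` of a matrix; they determine a Hermitian matrix. -/
def hermCoord (M : Matrix B B ℂ) (x : B × B) : ℝ := (M x.1 x.2).re + (M x.1 x.2).im

lemma hermCoord_injective {M M' : Matrix B B ℂ} (hM : M.IsHermitian) (hM' : M'.IsHermitian)
    (h : hermCoord M = hermCoord M') : M = M' := by
  ext i j
  have h1 := congrFun h (i, j)
  have h2 := congrFun h (j, i)
  have h3 := hM.apply i j
  have h4 := hM'.apply i j
  simp only [hermCoord] at h1 h2
  rw [← h3, ← h4] at h1
  simp only [Complex.star_def, Complex.conj_re, Complex.conj_im] at h1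
  rw [← h3, ← h4]
  have hre : (M j i).re = (M' j i).re := by linarith
  have him : (M j i).im = (M' j i).im := by linarith
  rw [Complex.ext hre him]

lemma hermCoord_sum (w : S → ℝ) (M : S → Matrix B B ℂ) (x : B × B) :
    hermCoord (∑ s, w s • M s) x = ∑ s, w s * hermCoord (M s) x := by
  simp [hermCoord, Matrix.sum_apply, mul_add, Finset.sum_add_distrib, Complex.re_sum,
    Complex.im_sum]

lemma sum_hermCoord_diag {M : Matrix B B ℂ} (hM : M.trace = 1) : ∑ b, hermCoord M (b, b) = 1 := by
  have h1 := congrArg Complex.re hM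
  have h2 := congrArg Complex.im hM
  simp only [trace, diag_apply, Complex.re_sum, Complex.im_sum, Complex.one_re, Complex.one_im]
    at h1 h2
  simp only [hermCoord, Finset.sum_add_distrib, h1, h2, add_zero]

lemma outputMean_nonneg (hp : p ∈ stdSimplex ℝ (U × V))
    (hρ : ∀ x₁ x₂, IsDensityMatrix (ρ x₁ x₂)) {r₁ : U → X₁ → ℝ} {r₂ : V → X₂ → ℝ}
    (h₁ : ∀ u, r₁ u ∈ stdSimplex ℝ X₁) (h₂ : ∀ v, r₂ v ∈ stdSimplex ℝ X₂) :
    0 ≤ outputMean p ρ r₁ r₂ :=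
  Finset.sum_nonneg fun _ _ => Finset.sum_nonneg fun _ _ =>
    smul_nonneg (pairDist_nonneg hp h₁ h₂ _ _) (density_nonneg (hρ _ _))

lemma outputMean_trace (hp : p ∈ stdSimplex ℝ (U × V))
    (hρ : ∀ x₁ x₂, IsDensityMatrix (ρ x₁ x₂)) {r₁ : U → X₁ → ℝ} {r₂ : V → X₂ → ℝ}
    (h₁ : ∀ u, r₁ u ∈ stdSimplex ℝ X₁) (h₂ : ∀ v, r₂ v ∈ stdSimplex ℝ X₂) :
    (outputMean p ρ r₁ r₂).trace = 1 := by
  have h := congrArg (fun x : ℝ => (x : ℂ)) (sum_pairDist hp h₁ h₂)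
  simp only [Complex.ofReal_sum, Complex.ofReal_one] at h
  simpa only [outputMean, trace_sum, trace_smul, (hρ _ _).2, Complex.real_smul, mul_one] using h

/-- The bound by the dimension of the output: the state of the output and three entropies are
preserved. -/
lemma exists_infoConditions_card_dim (hfg : ∀ u v, p (u, v) ≠ 0 → f u = g v)
    (hp : p ∈ stdSimplex ℝ (U × V)) (hρ : ∀ x₁ x₂, IsDensityMatrix (ρ x₁ x₂))
    (h : InfoConditions p f g ρ pS q₁ q₂) :
    ∃ m ≤ Fintype.card B ^ 2 + 3, ∃ (pS' : Fin m → ℝ)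
      (q₁' : U → Fin m → X₁ → ℝ) (q₂' : V → Fin m → X₂ → ℝ),
      InfoConditions p f g ρ pS' q₁' q₂' := by
  have htr : ∀ s, ∑ b, hermCoord (outputMean p ρ (fun u => q₁ u s) (fun v => q₂ v s)) (b, b) = 1 :=
    fun s => sum_hermCoord_diag
      (outputMean_trace hp hρ (fun u => h.pmf_x₁ u s) (fun v => h.pmf_x₂ v s))
  obtain ⟨w, hw, ha, hc, hcard⟩ := exists_weight_card_support_le
    (E := (B × B → ℝ) × ℝ × ℝ × ℝ)
    (fun s => (hermCoord (outputMean p ρ (fun u => q₁ u s) (fun v => q₂ v s)),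
      entropyGivenX₁X₂ p ρ (fun u => q₁ u s) (fun v => q₂ v s),
      entropyGivenX₂V p ρ (fun u => q₁ u s) (fun v => q₂ v s),
      entropyGivenX₁U p ρ (fun u => q₁ u s) (fun v => q₂ v s)))
    ((∑ b, LinearMap.proj (b, b)) ∘ₗ LinearMap.fst ℝ _ _)
    (fun s => by simpa using htr s)
    (fun s => entropyGivenW p f ρ (fun u => q₁ u s) (fun v => q₂ v s)) pS h.pmf_s.1
  have hd : ∀ x, ∑ s, w s * hermCoord (outputMean p ρ (fun u => q₁ u s) (fun v => q₂ v s)) x =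
      ∑ s, pS s * hermCoord (outputMean p ρ (fun u => q₁ u s) (fun v => q₂ v s)) x := by
    intro x
    simpa [Prod.fst_sum] using congrFun (congrArg Prod.fst ha) x
  have hw1 : ∑ s, w s = 1 := by
    have e : ∀ w : S → ℝ, ∑ s, w s = ∑ b,
        ∑ s, w s * hermCoord (outputMean p ρ (fun u => q₁ u s) (fun v => q₂ v s)) (b, b) := by
      intro w
      rw [Finset.sum_comm]
      refine Finset.sum_congr rfl fun s _ => ?_
      rw [← Finset.mul_sum, htr, mul_one]
    rw [e]
    simp only [hd]
    rw [← e, h.pmf_s.2]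
  have hherm : ∀ w : S → ℝ, (∀ s, 0 ≤ w s) →
      (∑ s, w s • outputMean p ρ (fun u => q₁ u s) (fun v => q₂ v s)).IsHermitian :=
    fun w hw => isHermitian_of_nonneg <| Finset.sum_nonneg fun s _ => smul_nonneg (hw s) <|
      outputMean_nonneg hp hρ (fun u => h.pmf_x₁ u s) (fun v => h.pmf_x₂ v s)
  refine ⟨_, ?_, exists_infoConditions_fin hfg hp hρ h hw hw1 ?_ ?_ ?_ ?_ hc⟩
  · refine hcard.trans (le_of_eq ?_)
    simp [sq]
  · simpa [Prod.fst_sum, Prod.snd_sum] using congrArg (fun z => z.2.2.1) ha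
  · simpa [Prod.fst_sum, Prod.snd_sum] using congrArg (fun z => z.2.2.2) ha
  · simpa [Prod.fst_sum, Prod.snd_sum] using congrArg (fun z => z.2.1) ha
  · refine hermCoord_injective (hherm w hw) (hherm pS h.pmf_s.1) (funext fun x => ?_)
    rw [hermCoord_sum, hermCoord_sum, hd]

/-- The direct part of the coding theorem, for any common function of the source. -/
lemma reliablyTransmissible (hfg : ∀ u v, p (u, v) ≠ 0 → f u = g v)
    (hp : p ∈ stdSimplex ℝ (U × V)) (hρ : ∀ x₁ x₂, IsDensityMatrix (ρ x₁ x₂))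
    (h : InfoConditions p f g ρ pS q₁ q₂) : ReliablyTransmissible p ρ := by
  have hρ0 : ∀ x₁ x₂, 0 ≤ ρ x₁ x₂ := fun x₁ x₂ => density_nonneg (hρ x₁ x₂)
  have q0₁ : ∀ u s x, 0 ≤ q₁ u s x := fun u s => (h.pmf_x₁ u s).1
  have q0₂ : ∀ v s x, 0 ≤ q₂ v s x := fun u s => (h.pmf_x₂ u s).1
  obtain ⟨c₁, c₂, c₃, c₄⟩ := (infoConditions_iff hfg hp hρ h.pmf_s h.pmf_x₁ h.pmf_x₂).1 h
  refine reliablyTransmissible_of_covered hp hρ h.pmf_s h.pmf_x₁ h.pmf_x₂ hfg ?_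
    (condEntropyB_x₂vs hp.1 q0₁ q0₂ hρ0).symm (condEntropyB_x₁us hp.1 q0₁ q0₂ hρ0).symm
    (condEntropyB_ws hp.1 q0₁ q0₂ hρ0).symm ?_ c₁ c₂ c₃ c₄
  · rw [condEntropyB_of_factor (σ := jointState ρ) (fun ω => hρ0 _ _) (fun ω => (hρ _ _).2)
      (fun ω => (ω.2.2.2.1, ω.2.2.2.2)) (fun a => ρ a.1 a.2) (fun _ => rfl)]
    simpa [entropyGivenX₁X₂, jointState] using (sum_joint_pair (p := p) (pS := pS) (q₁ := q₁)
      (q₂ := q₂) fun x₁ x₂ => vnEntropy (ρ x₁ x₂)).symm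
  · have e : labelSum (jointDist p pS q₁ q₂) (jointState ρ) (fun _ => ()) () =
        meanB p f pS q₁ q₂ ρ := by
      rw [meanB_eq hp]
      simp [labelSum]
    simp only [condEntropyB, Finset.univ_unique, Finset.sum_singleton]
    rw [show (default : Unit) = () from rfl, e,
      weightedEntropy_of_trace_one (trace_meanB hp hρ h.pmf_s h.pmf_x₁ h.pmf_x₂), meanB_eq hp]
    exact congrArg vnEntropy (sum_joint_pair ρ).symm

end Info

end

end CqMac

theorem theorem1 {U V S X₁ X₂ B : Type*}
    [Fintype U] [DecidableEq U] [Fintype V] [DecidableEq V] [Fintype S] [DecidableEq S]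
    [Fintype X₁] [DecidableEq X₁] [Fintype X₂] [DecidableEq X₂] [Fintype B] [DecidableEq B]
    (p : U × V → ℝ) (hp : p ∈ stdSimplex ℝ (U × V))
    (ρ : X₁ → X₂ → Matrix B B ℂ) (hρ : ∀ x₁ x₂, IsDensityMatrix (ρ x₁ x₂))
    (k : ℕ) (f : U → Fin k) (g : V → Fin k) (hfg : IsCommonPart p k f g)
    (pS : S → ℝ) (q₁ : U → S → X₁ → ℝ) (q₂ : V → S → X₂ → ℝ)
    (h : InfoConditions p f g ρ pS q₁ q₂) :
    ReliablyTransmissible p ρ ∧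
    ∃ m : ℕ, m ≤ min (Fintype.card X₁ * Fintype.card X₂ + 2) (Fintype.card B ^ 2 + 3) ∧
      ∃ (pS' : Fin m → ℝ) (q₁' : U → Fin m → X₁ → ℝ) (q₂' : V → Fin m → X₂ → ℝ),
        InfoConditions p f g ρ pS' q₁' q₂' := by
  refine ⟨CqMac.reliablyTransmissible hfg.agree hp hρ h, ?_⟩
  rcases le_total (Fintype.card X₁ * Fintype.card X₂ + 2) (Fintype.card B ^ 2 + 3) with hle | hle
  · rw [min_eq_left hle]
    exact CqMac.exists_infoConditions_card_pair hfg.agree hp hρ h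
  · rw [min_eq_right hle]
    exact CqMac.exists_infoConditions_card_dim hfg.agree hp hρ h
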